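/- **Setting.** Let $\mathbb K$ be a field. The cost of a program over $\mathbb K$ (an algebraic computation tree, which may load constants, add, subtract, multiply, divide, and branch on whether an element is zero) is the number of such instructions that it executes. Let $\omega>2$ be a feasible exponent of matrix multiplication over $\mathbb K$: two $N\times N$ matrices can be multiplied in $O(N^{\omega})$ operations. Let $G$ be a finite group of diagonal matrices in $\mathrm{GL}_n(\mathbb K)$. The $G$-degree of a monomial $x^m$ is the character $g\mapsto\prod_i g_i^{m_i}$ by which $g=\mathrm{diag}(g_1,\dots,g_n)\in G$ scales it. Let $\Lambda\subseteq\mathbb Z^n$ be the lattice of the exponents of the Laurent monomials of trivial $G$-degree, and let $\mathcal A\subseteq\mathbb N^n$ be a set that contains $0$ and represents each class of $\mathbb Z^n/\Lambda$ exactly once. For a set $T$ of monomials, let $T_a=\{x^m\in T: m\in a+\Lambda\}$. For a table $u=(u_i)_{i\in\mathbb N^n}$ over $\mathbb K$, let $[\sum_s\gamma_s x^s]_u=\sum_s\gamma_s u_s$. A polynomial $g$ is a relation of $u$ if $[g\,x^i]_u=0$ for all $i\in\mathbb N^n$; the relations form the ideal of relations of $u$. Let $H_{X,Y}=([xy]_u)_{x\in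 X,\,y\in Y}$. Let $T$ be a finite staircase (a set of monomials closed under division), sorted for a monomial ordering $<$. * Scalar-FGLM computes the column rank profile of $H_{T,T}$ (the labels of the columns that are not combinations of the columns on their left), adds to it the elements of $T$ that divide one of its elements, which gives $S'$, and returns, for each $g\in T\setminus S'$ minimal for division, a polynomial $g+\sum_{s\in S'}\gamma_s s$ with $H_{S',S'}\gamma+H_{S',\{g\}}=0$. * Lattice-Scalar-FGLM computes the column rank profile $S'_a$ of $H_{\{1\}\cup T_a,\{1\}\cup T_a}$ for each $a\in\mathcal A$, adds to $\bigcup_a S'_a$ the elements of $T$ that divide one of its elements, which gives $S'$, and returns, for each $g\in T\setminus S'$ minimal for division, with $g\in T_a$, the polynomial $g+\sum_{s\in S'_a}\gamma_s s$ with $H_{S'_a,S'_a}\gamma+H_{S'_a,\{g\}}=0$. **Proposition.** There is a constant $C$, depending only on $\mathbb K$ and $\omega$, such that for all $n$, $G$ and $\varepsilon>0$ there is a $d_0$ with the following property. Let $d_1,\dots,d_n\ge d_0$, and let $f_1,\dots,f_n\in\mathbb K[x_1,\dots,x_n]$ be generic $G$-homogeneous polynomials of degrees at most $d_1,\dots,d_n$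 and of prescribed $G$-degrees $\chi_1,\dots,\chi_n$ (that is, all monomials of $f_i$ have $G$-degree $\chi_i$; generic means that a certain nonzero polynomial in the coefficients, which depends only on $\mathbb K,n,G,\varepsilon,(d_i),(\chi_i)$, does not vanish), such that the ideal $I=\langle f_1,\dots,f_n\rangle$, which is stable under $G$, is zero-dimensional. Let $\prec$ and $<$ be monomial orderings, let $\mathcal G$ and $\mathcal H$ be the reduced Gröbner bases of $I$ for $\prec$ and $<$, let $S$ be the staircase of $\mathcal H$ (the monomials that no leading monomial of $\mathcal H$ divides), and let $T=S\cup\mathrm{LM}_<(\mathcal H)$. Then: 1. $\#\mathcal A=|G|$, and $\bigl|\#T_a-\#T/|G|\bigr|\le\varepsilon\,\#T/|G|$ for all $a\in\mathcal A$. 2. Some program computes, from any table, an output of Scalar-FGLM on $T$ and $<$, at a cost of at most $C\,(\#T)^{\omega}$. 3. Some program computes, from any table, an output of Lattice-Scalar-FGLM on $T$, $<$, $\Lambda$ and $\mathcal A$, at a cost of at most $C\,(\#T)^{\omega}/|G|^{\omega-1}$. So using Lattice-Scalar-FGLM instead of Scalar-FGLM in the guessing step of the Sparse-FGLM algorithm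 divides the $O((\#T)^{\omega})$ cost bound of this step by $|G|^{\omega-1}$, up to a constant factor. 4. Let $u$ be a table of which all elements of $\mathcal G$ are relations (such are the tables that Sparse-FGLM builds from $\mathcal G$). If the ideal of relations of $u$ is $I$, then the output of Scalar-FGLM is $\mathcal H$. If $H_{\{1\}\cup S_a,\{1\}\cup S_a}$ is nonsingular for all $a\in\mathcal A$, then the output of Lattice-Scalar-FGLM is $\mathcal H$. -/

import Mathlib

noncomputable section

namespace LatticeFGLM

/-! ## Arithmetic cost model: algebraic computation trees over a field -/

/-- The field operations; division by `0` returns `0`. -/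
inductive FieldOp where
  | add | sub | mul | div

/-- The value of a field operation. -/
def FieldOp.eval {K : Type*} [Field K] : FieldOp → K → K → K
  | .add, x, y => x + y
  | .sub, x, y => x - y
  | .mul, x, y => x * y
  | .div, x, y => x / y

/-- Programs (algebraic computation trees) over the field `K`. The input is a family of field
elements indexed by `ι`; `m` is the number of registers filled so far. A program can only access
field elements through the addresses `ι ⊕ Fin m` (an input or a register), by loading a constant,
by performing a field operation, or by branching on whether an element is zero. A program halts
with a discrete label in `γ` (which depends only on the branch taken) and with field elements
indexed by `β`. -/
inductive Program (K ι β γ : Type*) : ℕ → Type _ where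
  | halt {m : ℕ} (label : γ) (out : β → ι ⊕ Fin m) : Program K ι β γ m
  | const {m : ℕ} (c : K) (next : Program K ι β γ (m + 1)) : Program K ι β γ m
  | op {m : ℕ} (o : FieldOp) (a b : ι ⊕ Fin m) (next : Program K ι β γ (m + 1)) :
      Program K ι β γ m
  | test {m : ℕ} (a : ι ⊕ Fin m) (ifZero ifNonzero : Program K ι β γ m) : Program K ι β γ m

open scoped Classical in
/-- Run a program on the input `x` with the registers `r`: the result is the label, the output
elements, and the number of instructions (constants, field operations and zero tests) executed. -/
def Program.run {K ι β γ : Type*} [Field K] (x : ι → K) :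
    {m : ℕ} → Program K ι β γ m → (Fin m → K) → (γ × (β → K)) × ℕ
  | _, .halt label out, r => ((label, fun b => Sum.elim x r (out b)), 0)
  | _, .const c next, r =>
      let res := next.run x (Fin.snoc (α := fun _ => K) r c)
      (res.1, res.2 + 1)
  | _, .op o a b next, r =>
      let res := next.run x
        (Fin.snoc (α := fun _ => K) r (o.eval (Sum.elim x r a) (Sum.elim x r b)))
      (res.1, res.2 + 1)
  | _, .test a p q, r =>
      let res := if Sum.elim x r a = 0 then p.run x r else q.run x r
      (res.1, res.2 + 1)

/-- The label and the field elements that a program returns on the input `x`. -/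
def Program.result {K ι β γ : Type*} [Field K] (p : Program K ι β γ 0) (x : ι → K) :
    γ × (β → K) :=
  (p.run x Fin.elim0).1

/-- The number of instructions that a program executes on the input `x`. -/
def Program.cost {K ι β γ : Type*} [Field K] (p : Program K ι β γ 0) (x : ι → K) : ℕ :=
  (p.run x Fin.elim0).2

/-- `ω` is a feasible exponent of matrix multiplication over `K`: two `N × N` matrices can be
multiplied in `O(N ^ ω)` operations. -/
def IsMatMulExponent (K : Type*) [Field K] (ω : ℝ) : Prop :=
  ∃ c : ℝ, ∀ N : ℕ, ∃ p : Program K ((Fin N × Fin N) ⊕ (Fin N × Fin N)) (Fin N × Fin N) Unit 0,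
    ∀ A B : Matrix (Fin N) (Fin N) K,
      (p.result (Sum.elim (fun e => A e.1 e.2) (fun e => B e.1 e.2))).2 =
          (fun e => (A * B) e.1 e.2) ∧
        (p.cost (Sum.elim (fun e => A e.1 e.2) (fun e => B e.1 e.2)) : ℝ) ≤ c * (N : ℝ) ^ ω

/-! ## Monomials, Gröbner bases, tables -/

/-- Monomials in `n` variables, given by their exponents. -/
abbrev Mon (n : ℕ) : Type := Fin n →₀ ℕ

/-- `B` is the reduced Gröbner basis of the ideal `I` for the monomial ordering `ord`. -/
structure IsReducedGB {K : Type*} [Field K] {n : ℕ} (ord : MonomialOrder (Fin n))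
    (I : Ideal (MvPolynomial (Fin n) K)) (B : Set (MvPolynomial (Fin n) K)) : Prop where
  subset : ∀ g ∈ B, g ∈ I
  lead_dvd : ∀ f ∈ I, f ≠ 0 → ∃ g ∈ B, ord.degree g ≤ ord.degree f
  monic : ∀ g ∈ B, ord.leadingCoeff g = 1
  reduced : ∀ g ∈ B, ∀ g' ∈ B, g ≠ g' → ∀ m ∈ g'.support, ¬ ord.degree g ≤ m

/-- The leading monomials of the elements of `B`. -/
def leadMons {K : Type*} [Field K] {n : ℕ} (ord : MonomialOrder (Fin n))
    (B : Set (MvPolynomial (Fin n) K)) : Set (Mon n) :=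
  ord.degree '' B

/-- The staircase of `B`: the monomials that no leading monomial of `B` divides. -/
def staircase {K : Type*} [Field K] {n : ℕ} (ord : MonomialOrder (Fin n))
    (B : Set (MvPolynomial (Fin n) K)) : Set (Mon n) :=
  {s | ∀ g ∈ B, ¬ ord.degree g ≤ s}

/-- The bracket `[f]_u`, for a table `u`. -/
def bracket {K : Type*} [Field K] {n : ℕ} (u : Mon n → K) (f : MvPolynomial (Fin n) K) : K :=
  ∑ m ∈ f.support, f.coeff m * u m

/-- `f` is a linear recurrence relation with constant coefficients of the table `u`. -/
def IsRelation {K : Type*} [Field K] {n : ℕ} (u : Mon n → K) (f : MvPolynomial (Fin n) K) :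
    Prop :=
  ∀ i : Mon n, bracket u (f * MvPolynomial.monomial i 1) = 0

/-- The multi-Hankel matrix `H_{X,Y}` of the table `u`. -/
def hankel {K : Type*} {n : ℕ} (u : Mon n → K) (X Y : Finset (Mon n)) : Matrix X Y K :=
  Matrix.of fun x y => u (x.1 + y.1)

open scoped Classical in
/-- The column rank profile of `H_{X,X}`, columns being sorted for `ord`: the labels of the columns
that are not linear combinations of the columns on their left. -/
def rankProfile {K : Type*} [Field K] {n : ℕ} (ord : MonomialOrder (Fin n)) (u : Mon n → K)
    (X : Finset (Mon n)) : Finset (Mon n) :=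
  (Finset.univ.filter fun c : X => (hankel u X X).col c ∉
    Submodule.span K ((hankel u X X).col '' {c' | ord.toSyn c'.1 < ord.toSyn c.1})).map
      (Function.Embedding.subtype _)

open scoped Classical in
/-- `S` together with the monomials of `T` that divide an element of `S`. -/
def stabilize {n : ℕ} (T S : Finset (Mon n)) : Finset (Mon n) :=
  S ∪ T.filter fun m => ∃ s ∈ S, m ≤ s

open scoped Classical in
/-- The monomials `g` that are selected by the loop which repeatedly takes the smallest element
of `T ∖ S` and removes its multiples: the elements of `T ∖ S` that are minimal for division. -/
def selected {n : ℕ} (T S : Finset (Mon n)) : Finset (Mon n) :=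
  (T \ S).filter fun g => ∀ h ∈ T \ S, h ≤ g → h = g

/-- `γ` solves the linear system `H_{S,S} γ + H_{S,{g}} = 0`. -/
def Solves {K : Type*} [Field K] {n : ℕ} (u : Mon n → K) (S : Finset (Mon n)) (g : Mon n)
    (γ : Mon n → K) : Prop :=
  (hankel u S S).mulVec (fun s => γ s.1) + (hankel u S {g}).col ⟨g, Finset.mem_singleton_self g⟩ = 0

/-- The polynomial `g + ∑_{s ∈ S} γ_s s`. -/
def relPoly {K : Type*} [Field K] {n : ℕ} (S : Finset (Mon n)) (g : Mon n) (γ : Mon n → K) :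
    MvPolynomial (Fin n) K :=
  MvPolynomial.monomial g 1 + ∑ s ∈ S, MvPolynomial.monomial s (γ s)

/-- `R` is an output of the Scalar-FGLM algorithm called on the table `u`, the ordering `ord` and
the staircase `T`. -/
def IsScalarFGLMOutput {K : Type*} [Field K] {n : ℕ} (ord : MonomialOrder (Fin n))
    (u : Mon n → K) (T : Finset (Mon n)) (R : Set (MvPolynomial (Fin n) K)) : Prop :=
  let S := stabilize T (rankProfile ord u T)
  ∃ γ : Mon n → Mon n → K,
    (∀ g ∈ selected T S, Solves u S g (γ g)) ∧
      R = {p | ∃ g ∈ selected T S, p = relPoly S g (γ g)}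

/-! ## Lattices and the lattice variant of the algorithm -/

/-- The monomial `m` lies in the translate `a + Λ`. -/
def InClass {n : ℕ} (Λ : AddSubgroup (Fin n → ℤ)) (a m : Mon n) : Prop :=
  (fun i => (m i : ℤ) - (a i : ℤ)) ∈ Λ

/-- `A ⊆ ℕⁿ` contains `0` and is a complete set of representatives of `ℤⁿ / Λ`. -/
def IsFundamentalDomain {n : ℕ} (Λ : AddSubgroup (Fin n → ℤ)) (A : Finset (Mon n)) : Prop :=
  0 ∈ A ∧ ∀ v : Fin n → ℤ, ∃! a : Mon n, a ∈ A ∧ (fun i => v i - (a i : ℤ)) ∈ Λ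

open scoped Classical in
/-- `T_a`, the monomials of `T` in `a + Λ`. -/
def part {n : ℕ} (Λ : AddSubgroup (Fin n → ℤ)) (T : Finset (Mon n)) (a : Mon n) :
    Finset (Mon n) :=
  T.filter (InClass Λ a)

open scoped Classical in
/-- `R` is an output of the lattice Scalar-FGLM algorithm called on the table `u`, the ordering
`ord`, the staircase `T`, the lattice `Λ` and the representatives `A` of `ℤⁿ / Λ`. -/
def IsLatticeFGLMOutput {K : Type*} [Field K] {n : ℕ} (ord : MonomialOrder (Fin n))
    (Λ : AddSubgroup (Fin n → ℤ)) (A : Finset (Mon n)) (u : Mon n → K) (T : Finset (Mon n))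
    (R : Set (MvPolynomial (Fin n) K)) : Prop :=
  let Sa := fun a : Mon n => rankProfile ord u (insert 0 (part Λ T a))
  let S := stabilize T (A.biUnion Sa)
  ∃ γ : Mon n → Mon n → K,
    (∀ g ∈ selected T S, ∀ a ∈ A, InClass Λ a g → Solves u (Sa a) g (γ g)) ∧
      R = {p | ∃ g ∈ selected T S, ∃ a ∈ A, InClass Λ a g ∧ p = relPoly (Sa a) g (γ g)}

/-- Programs that read the table and return a list of leading monomials (the label) and the
coefficients of the polynomials. -/
abbrev GuessProgram (K : Type*) (n : ℕ) : Type _ :=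
  Program K (Mon n) (Mon n × Mon n) (Finset (Mon n)) 0

/-- The set of polynomials, with support in `T`, that a guessing program returns on the
table `u`. -/
def GuessProgram.polys {K : Type*} [Field K] {n : ℕ} (p : GuessProgram K n)
    (T : Finset (Mon n)) (u : Mon n → K) : Set (MvPolynomial (Fin n) K) :=
  {f | ∃ g ∈ (p.result u).1, f = relPoly T g (fun s => (p.result u).2 (g, s))}

/-! ## Diagonal groups -/

/-- The `G`-degree of a monomial `m`, for a group `G` of diagonal matrices: the character
`g ↦ ∏ gᵢ ^ mᵢ`, by whose values the elements of `G` scale `m`. (For generators `D₁, …, D_ℓ` of `G`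
of orders `q₁ ∣ ⋯ ∣ q_ℓ` and a primitive `q_ℓ`-th root of unity `ζ`, it is recorded by the tuple
`μ` such that `Dᵢ` sends `m` onto `ζ ^ (μᵢ q_ℓ / qᵢ) m`.) -/
def gDegree {K : Type*} [Field K] {n : ℕ} (G : Subgroup (Fin n → Kˣ)) (m : Mon n) : G →* Kˣ where
  toFun g := ∏ i, g.1 i ^ m i
  map_one' := by simp
  map_mul' g h := by simp [mul_pow, Finset.prod_mul_distrib]

/-- The lattice `Λ` of `G`: the exponents of the Laurent monomials of trivial `G`-degree. -/
def gLattice {K : Type*} [Field K] {n : ℕ} (G : Subgroup (Fin n → Kˣ)) :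
    AddSubgroup (Fin n → ℤ) where
  carrier := {v | ∀ g ∈ G, ∏ i, g i ^ v i = 1}
  zero_mem' := by intro g _; simp
  add_mem' := by
    intro v w hv hw g hg
    simp [zpow_add, Finset.prod_mul_distrib, hv g hg, hw g hg]
  neg_mem' := by
    intro v hv g hg
    simp [Finset.prod_inv_distrib, hv g hg]

/-- The polynomials `f i` are `G`-homogeneous, of degrees at most `d i` and of `G`-degrees `χ i`. -/
def IsGSystem {K : Type*} [Field K] {n : ℕ} (G : Subgroup (Fin n → Kˣ)) (d : Fin n → ℕ)
    (χ : Fin n → (G →* Kˣ)) (f : Fin n → MvPolynomial (Fin n) K) : Prop :=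
  ∀ i, (f i).totalDegree ≤ d i ∧ ∀ m ∈ (f i).support, gDegree G m = χ i

/-- The indices of the coefficients of such systems: pairs of an `i` and a monomial of degree at
most `d i` and of `G`-degree `χ i`. -/
abbrev CoeffIndex {K : Type*} [Field K] {n : ℕ} (G : Subgroup (Fin n → Kˣ)) (d : Fin n → ℕ)
    (χ : Fin n → (G →* Kˣ)) : Type :=
  {p : Fin n × Mon n // p.2.degree ≤ d p.1 ∧ gDegree G p.2 = χ p.1}

/-- The coefficients of a system. -/
def coeffs {K : Type*} [Field K] {n : ℕ} {G : Subgroup (Fin n → Kˣ)} {d : Fin n → ℕ}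
    {χ : Fin n → (G →* Kˣ)} (f : Fin n → MvPolynomial (Fin n) K) (p : CoeffIndex G d χ) : K :=
  (f p.1.1).coeff p.1.2

end LatticeFGLM

end

/-! Write D for the product of the d_i, q for |G|, L = T \ S for the corners of the staircase.

Block sizes. Bézout's bound (`finrank_quotient_le_prod`) gives #S ≤ dim R/I ≤ D. The corners form an
antichain all of whose proper divisors lie in S, so they are few compared with S
(`card_mul_card_antichain_le`) and #T ≤ (1+δ)D. Conversely, for generic f some quotient algebra of
R/I has invertible variables and dimension at least ∏ N_i, where N_i is a multiple of q close to d_i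
(`exists_generic_quotient`). Multiplication by a monomial is injective there and shifts the
G-degree, so the span of the monomials of each G-degree has dimension at least ∏ N_i / q. As I is
G-stable, this span is generated by the standard monomials of that G-degree
(`finrank_le_card_mul_card`). So every block has at least about D/q elements, the blocks have at
most about D elements together, and all of them are close to #T/q.

The lower bound on the dimension. Take a point x and all coefficients but one per equation as
indeterminates, and solve equation i for the coefficient of a monomial x^(a_i); clearing
denominators makes the solution polynomial (`genericCoeff`). The equation also contains x^(a_i)
x_i^(N_i), because q divides N_i. Degenerating to the binomials on these two monomials shows that
the monomials x^m with m_i < N_i are linearly independent over the generic coefficients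
(`sum_aeval_genericCoeff_mul_eq_zero`). After one element P is inverted, the algebra generated by
the x_j and their inverses is finite over the ring of coefficients, and Nakayama's lemma carries the
bound to every specialization with P ≠ 0.

Cost. Divide-and-conquer elimination on columns yields the column rank profile together with a
generalized inverse W, in O(N^ω) operations because ω > 2 (`IsElimination.append`,
`exists_computes_elimination`). The matrix -WA contains the coefficients of all relations at once.
One run on T costs O((#T)^ω); q runs on blocks of size at most 3 #T/q cost q (3 #T/q)^ω up to a
constant.

Correctness. A relation against all test monomials in S is a relation, by reduction to normal form;
so H_{S,S} is nonsingular when the ideal of relations is I. In either algorithm, nonsingularity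
identifies the rank profile with the (block of the) staircase and makes the linear systems uniquely
solvable; the coefficients of the reduced basis solve them. In the lattice case this uses that
elements of the reduced basis are G-homogeneous (`IsReducedGB.gDegree_eq`). -/

/-! ### Regular sequences and the depth of zero-dimensional ideals -/

namespace LatticeFGLM
noncomputable section
open RingTheory.Sequence CategoryTheory CategoryTheory.Abelian Pointwise
universe u

/-- The long exact sequence of 0 → M → M → M/rM → 0 loses one degree of Ext vanishing for each
element of `rs`; as `rs` is shorter than the range of vanishing, degree 0 survives. -/
theorem subsingleton_linearMap_quot_ofList {R : Type u} [CommRing R] (N : ModuleCat.{u} R)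
    (rs : List R) : ∀ (n : ℕ) (M : ModuleCat.{u} R),
    (∀ i < n, Subsingleton (Ext N M i)) → IsWeaklyRegular M rs → rs.length < n →
    Subsingleton (N →ₗ[R] (M ⧸ (Ideal.ofList rs • ⊤ : Submodule R M))) := by
  induction rs with
  | nil =>
    intro n M h _ hn
    have := h 0 hn
    have h1 : Subsingleton (N →ₗ[R] M) :=
      (Ext.addEquiv₀.trans ModuleCat.homAddEquiv).symm.subsingleton
    have e : (M ⧸ (Ideal.ofList ([] : List R) • ⊤ : Submodule R M)) ≃ₗ[R] M :=
      Submodule.quotEquivOfEqBot _ (by simp)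
    exact (LinearEquiv.congrRight (M := N) e).toEquiv.subsingleton
  | cons r rs ih =>
    intro n M h hreg hn
    rw [isWeaklyRegular_cons_iff] at hreg
    obtain ⟨n, rfl⟩ : ∃ k, n = k + 1 := ⟨n - 1, by simp at hn; omega⟩
    have h' : ∀ i < n, Subsingleton (Ext N (ModuleCat.of R (QuotSMulTop r M)) i) := by
      intro i hi
      have zero1 := AddCommGrpCat.isZero_of_iff_subsingleton.mpr (h i (by omega))
      have zero2 := AddCommGrpCat.isZero_of_iff_subsingleton.mpr (h (i + 1) (by omega))
      exact AddCommGrpCat.subsingleton_of_isZero <| ShortComplex.Exact.isZero_of_both_zeros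
        ((Ext.covariant_sequence_exact₃' N hreg.1.smulShortComplex_shortExact) i (i + 1) rfl)
        (zero1.eq_zero_of_src _) (zero2.eq_zero_of_tgt _)
    have := ih n (ModuleCat.of R (QuotSMulTop r M)) h' hreg.2 (by simpa using hn)
    exact (LinearEquiv.congrRight (M := N)
      (Submodule.quotOfListConsSMulTopEquivQuotSMulTopInner M r rs)).toEquiv.subsingleton

/-- A monic polynomial stays monic over A/J, where it is not a zero divisor. -/
theorem isSMulRegular_quotient_map_C {A : Type*} [CommRing A] (J : Ideal A)
    (p : Polynomial A) (hp : p.Monic) :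
    IsSMulRegular (Polynomial A ⧸ J.map (Polynomial.C : A →+* Polynomial A)) p := by
  rw [isSMulRegular_quotient_iff_mem_of_smul_mem]
  intro q hq
  have key : ∀ f : Polynomial A, f ∈ J.map (Polynomial.C : A →+* Polynomial A) ↔
      f.map (Ideal.Quotient.mk J) = 0 := by
    intro f
    rw [Ideal.mem_map_C_iff, Polynomial.ext_iff]
    simp [Ideal.Quotient.eq_zero_iff_mem]
  rw [key] at hq ⊢
  rw [smul_eq_mul, Polynomial.map_mul] at hq
  exact (hp.map (Ideal.Quotient.mk J)).mul_right_eq_zero_iff.mp hq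

/-- Induction on the number of variables: the sequence for the last n variables stays regular in the
flat extension by the first one, and the polynomial in the first variable is monic over the
quotient. -/
theorem exists_isWeaklyRegular_aeval_X {K : Type u} [Field K] : ∀ (n : ℕ)
    (p : Fin n → Polynomial K), (∀ j, (p j).Monic) →
    ∃ rs : List (MvPolynomial (Fin n) K), rs.length = n ∧
      (∀ r ∈ rs, ∃ j, r = Polynomial.aeval (MvPolynomial.X j) (p j)) ∧
      IsWeaklyRegular (MvPolynomial (Fin n) K) rs := by
  intro n
  induction n with
  | zero => exact fun p _ => ⟨[], rfl, by simp, IsWeaklyRegular.nil _ _⟩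
  | succ n ih =>
    intro p hp
    obtain ⟨rs, hlen, hmem, hreg⟩ := ih (fun j => p j.succ) (fun j => hp _)
    let e := MvPolynomial.finSuccEquiv K n
    let S := Polynomial (MvPolynomial (Fin n) K)
    let ts : List S := rs.map Polynomial.C ++ [(p 0).map (algebraMap K _)]
    have hts : IsWeaklyRegular S ts := by
      rw [isWeaklyRegular_append_iff]
      refine ⟨IsWeaklyRegular.of_flat (S := S) hreg, ?_⟩
      rw [isWeaklyRegular_singleton_iff]
      have h1 := isSMulRegular_quotient_map_C (Ideal.ofList rs) ((p 0).map (algebraMap K _))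
        ((hp 0).map _)
      have h2 : (Ideal.ofList (rs.map Polynomial.C) • ⊤ : Submodule S S) =
          (Ideal.ofList rs).map (Polynomial.C : _ →+* S) := by
        rw [Ideal.map_ofList]; simp
      rw [h2]
      exact h1
    refine ⟨ts.map e.symm, by simp [ts, hlen], ?_, ?_⟩
    · intro r hr
      simp only [ts, List.map_append, List.map_map, List.map_cons, List.map_nil, List.mem_append,
        List.mem_map, List.mem_singleton, Function.comp] at hr
      rcases hr with ⟨a, ha, rfl⟩ | rfl
      · obtain ⟨j, rfl⟩ := hmem a ha
        refine ⟨j.succ, ?_⟩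
        rw [AlgEquiv.symm_apply_eq]
        refine (Polynomial.aeval_algebraMap_apply S _ _).symm.trans ?_
        refine Eq.trans ?_ (Polynomial.aeval_algHom_apply e.toAlgHom _ _)
        congr 2
        exact (MvPolynomial.finSuccEquiv_X_succ (R := K) (j := j)).symm
      · refine ⟨0, ?_⟩
        rw [AlgEquiv.symm_apply_eq, ← Polynomial.aeval_algHom_apply]
        simp only [e, MvPolynomial.finSuccEquiv_X_zero]
        rw [Polynomial.aeval_X_left_eq_map]
    · refine (AddEquiv.isWeaklyRegular_congr (e := e.symm.toAddEquiv) (as := ts)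
        (bs := ts.map e.symm) ?_).mp hts
      rw [List.forall₂_map_right_iff, List.forall₂_same]
      intro x _ y
      simp

/-- Unmixedness: fewer than n regular elements leave no associated prime containing I. The finite
quotient provides a monic polynomial in each variable inside I, hence a regular sequence of length n
in I, hence Ext^i(R/I, R) = 0 for i < n. So Hom(R/I, R/(rs)) = 0, while an h with I h ⊆ (rs) defines
the homomorphism 1 ↦ h. -/
theorem mem_ofList_of_mul_mem {K : Type u} [Field K] {n : ℕ} (I : Ideal (MvPolynomial (Fin n) K))
    [Module.Finite K (MvPolynomial (Fin n) K ⧸ I)] (rs : List (MvPolynomial (Fin n) K))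
    (hreg : IsWeaklyRegular (MvPolynomial (Fin n) K) rs)
    (hlen : rs.length < n)
    (h : MvPolynomial (Fin n) K) (hh : ∀ r ∈ I, r * h ∈ Ideal.ofList rs) : h ∈ Ideal.ofList rs := by
  let R := MvPolynomial (Fin n) K
  by_cases hI : I = ⊤
  · simpa using hh 1 (by simp [hI])
  have hint : ∀ j : Fin n, ∃ p : Polynomial K, p.Monic ∧
      (Polynomial.aeval (MvPolynomial.X j) p : R) ∈ I := by
    intro j
    obtain ⟨p, hp, hp'⟩ := Algebra.IsIntegral.isIntegral (R := K)
      (Ideal.Quotient.mk I (MvPolynomial.X j))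
    refine ⟨p, hp, ?_⟩
    rw [← Ideal.Quotient.eq_zero_iff_mem, ← hp', ← Ideal.Quotient.mkₐ_eq_mk K,
      ← Polynomial.aeval_algHom_apply]
    rfl
  choose p hp hpI using hint
  obtain ⟨ts, htl, htm, htr⟩ := exists_isWeaklyRegular_aeval_X n p hp
  have htI : ∀ t ∈ ts, t ∈ I := fun t ht => by
    obtain ⟨j, rfl⟩ := htm t ht; exact hpI j
  have htR : IsRegular R ts := ⟨htr, by
    rw [smul_eq_mul, Ideal.mul_top]
    intro h'
    apply hI
    rw [eq_top_iff, h']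
    exact Ideal.span_le.mpr htI⟩
  have hext := ModuleCat.subsingleton_ext_of_exists_isRegular I (ModuleCat.of R (R ⧸ I))
    (by rw [Module.support_eq_zeroLocus, Ideal.annihilator_quotient]) (ModuleCat.of R R)
    (by simpa [lt_top_iff_ne_top] using hI) ts htI htR
  rw [htl] at hext
  have hs := subsingleton_linearMap_quot_ofList (ModuleCat.of R (R ⧸ I)) rs n (ModuleCat.of R R)
    hext hreg hlen
  let J : Submodule R R := Ideal.ofList rs • ⊤
  have hJ : J = Ideal.ofList rs := by simp [J]
  let φ : (R ⧸ I) →ₗ[R] R ⧸ J := Submodule.liftQ I (LinearMap.toSpanSingleton R (R ⧸ J) (J.mkQ h))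
    (by
      intro r hr
      rw [LinearMap.mem_ker, LinearMap.toSpanSingleton_apply, ← map_smul]
      rw [Submodule.mkQ_apply, Submodule.Quotient.mk_eq_zero, hJ]
      exact hh r hr)
  have h0 : φ = 0 := @Subsingleton.elim _ hs φ 0
  have h1 : φ (Submodule.Quotient.mk 1) = J.mkQ h := by
    change (1 : R) • J.mkQ h = _
    rw [one_smul]
  rw [h0, LinearMap.zero_apply, eq_comm, Submodule.mkQ_apply, Submodule.Quotient.mk_eq_zero,
    hJ] at h1
  exact h1

end
end LatticeFGLM

/-! ### Powers of a regular sequence, and avoidance of subspaces -/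

namespace LatticeFGLM
noncomputable section
open RingTheory.Sequence Pointwise
universe u

/-- Modulo r only the terms with exponent 0 of a linear relation survive, so they vanish; regularity
of r then allows cancelling one factor r from the rest. -/
theorem linearIndependent_pow_smul {K A M κ : Type*} [Field K] [CommRing A] [Algebra K A]
    [AddCommGroup M] [Module A M] [Module K M] [IsScalarTower K A M] {r : A}
    (hr : IsSMulRegular M r) (v : κ → M)
    (hv : LinearIndependent K fun k => (Submodule.Quotient.mk (v k) : QuotSMulTop r M)) :
    LinearIndependent K fun p : ℕ × κ => r ^ p.1 • v p.2 := by
  have : SMulCommClass A K M := IsScalarTower.to_smulCommClass'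
  have key : ∀ (N : ℕ) (l : ℕ → κ →₀ K),
      ∑ a ∈ Finset.range N, r ^ a • Finsupp.linearCombination K v (l a) = 0 →
      ∀ a < N, l a = 0 := by
    intro N
    induction N with
    | zero => simp
    | succ N ih =>
      intro l hl
      rw [Finset.sum_range_succ'] at hl
      have h1 : ∑ a ∈ Finset.range N, r ^ (a + 1) • Finsupp.linearCombination K v (l (a + 1)) =
          r • ∑ a ∈ Finset.range N, r ^ a • Finsupp.linearCombination K v (l (a + 1)) := by
        rw [Finset.smul_sum]
        exact Finset.sum_congr rfl fun a _ => by rw [pow_succ', mul_smul]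
      rw [h1, pow_zero, one_smul] at hl
      have h0 : l 0 = 0 := by
        rw [linearIndependent_iff] at hv
        apply hv
        let q : M →ₗ[K] QuotSMulTop r M := (Submodule.mkQ (r • ⊤ : Submodule A M)).restrictScalars K
        have h2 : q (Finsupp.linearCombination K v (l 0)) = 0 := by
          rw [eq_neg_of_add_eq_zero_right hl]
          change Submodule.mkQ (r • ⊤ : Submodule A M) _ = 0
          rw [Submodule.mkQ_apply, Submodule.Quotient.mk_eq_zero]
          exact Submodule.neg_mem _ (Submodule.smul_mem_pointwise_smul _ _ _ trivial)
        rw [Finsupp.apply_linearCombination] at h2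
        exact h2
      rw [h0, map_zero, add_zero] at hl
      have h3 := ih (fun a => l (a + 1)) (hr (by simpa using hl))
      intro a ha
      cases a with
      | zero => exact h0
      | succ a => exact h3 a (by omega)
  rw [linearIndependent_iff]
  intro l hl
  obtain ⟨N, hN⟩ : ∃ N, l.curry.support ⊆ Finset.range N :=
    ⟨_, Finset.subset_range_sup_succ _⟩
  have h1 : ∑ a ∈ Finset.range N, r ^ a • Finsupp.linearCombination K v (l.curry a) = 0 := by
    rw [← hl, Finsupp.linearCombination_apply, ← Finsupp.sum_curry_index l
      (fun a k c => c • r ^ a • v k), Finsupp.sum,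
      ← Finset.sum_subset hN]
    · refine Finset.sum_congr rfl fun a _ => ?_
      rw [Finsupp.linearCombination_apply, Finsupp.sum, Finset.smul_sum, Finsupp.sum]
      exact Finset.sum_congr rfl fun k _ => smul_comm _ _ _
    · intro a _ ha
      rw [Finsupp.notMem_support_iff.mp ha]
      simp
  have h2 := key N _ h1
  ext ⟨a, k⟩
  rw [← Finsupp.curry_apply]
  by_cases ha : a < N
  · rw [h2 a ha]; rfl
  · rw [Finsupp.notMem_support_iff.mp fun h => ha (Finset.mem_range.mp (hN h))]; rfl

theorem linearIndependent_prod_pow_smul {K A ι : Type*} [Field K] [CommRing A] [Algebra K A]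
    (rs : List A) : ∀ {M : Type u} [AddCommGroup M] [Module A M] [Module K M]
    [IsScalarTower K A M], IsWeaklyRegular M rs → ∀ e : ι → M,
    (LinearIndependent K fun j => (Submodule.Quotient.mk (e j) :
      M ⧸ (Ideal.ofList rs • ⊤ : Submodule A M))) →
    LinearIndependent K
      fun p : (Fin rs.length → ℕ) × ι => (∏ i, rs.get i ^ p.1 i) • e p.2 := by
  induction rs with
  | nil =>
    intro M _ _ _ _ _ e he
    let q : (M ⧸ (Ideal.ofList ([] : List A) • ⊤ : Submodule A M)) ≃ₗ[A] M :=
      Submodule.quotEquivOfEqBot _ (by simp)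
    have h1 := he.map' (q.restrictScalars K).toLinearMap (LinearEquiv.ker _)
    have h2 : LinearIndependent K e := h1
    rw [← linearIndependent_equiv (Equiv.uniqueProd ι (Fin 0 → ℕ)).symm]
    convert h2 using 1
    ext j
    simp
  | cons r rs ih =>
    intro M _ _ _ _ hreg e he
    rw [isWeaklyRegular_cons_iff] at hreg
    have h1 := he.map' ((Submodule.quotOfListConsSMulTopEquivQuotSMulTopInner M r
      rs).restrictScalars K).toLinearMap (LinearEquiv.ker _)
    have h2 := ih hreg.2 (fun j => (Submodule.Quotient.mk (e j) : QuotSMulTop r M)) h1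
    have h3 := linearIndependent_pow_smul (K := K) hreg.1
      (fun p : (Fin rs.length → ℕ) × ι => (∏ i, rs.get i ^ p.1 i) • e p.2) h2
    let eq1 : (Fin (r :: rs).length → ℕ) × ι ≃ ℕ × (Fin rs.length → ℕ) × ι :=
      ((Fin.consEquiv (fun _ : Fin (rs.length + 1) => ℕ)).symm.prodCongr (Equiv.refl ι)).trans
        (Equiv.prodAssoc _ _ _)
    rw [← linearIndependent_equiv eq1] at h3
    convert h3 using 1
    ext ⟨a, j⟩
    simp only [Function.comp, eq1]
    change _ = r ^ (a 0) • (∏ i : Fin rs.length, rs.get i ^ a i.succ) • e j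
    rw [smul_smul]
    congr 1
    exact Fin.prod_univ_succ (n := rs.length) (fun i => (r :: rs).get i ^ a i)

/-- Over an infinite field, a space is not a finite union of proper subspaces. This is applied to
the space of coefficients of f and the g_i. -/
theorem exists_add_sum_notMem {K V : Type*} [Field K] [Infinite K] [AddCommGroup V] [Module K V]
    {m : ℕ} (f : V) (g : Fin m → V) (W : Set (Submodule K V)) (hW : W.Finite)
    (h : ∀ P ∈ W, f ∈ P → ∃ i, g i ∉ P) :
    ∃ c : Fin m → K, ∀ P ∈ W, f + ∑ i, c i • g i ∉ P := by
  let φ : (K × (Fin m → K)) →ₗ[K] V :=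
    (LinearMap.toSpanSingleton K V f).coprod (Fintype.linearCombination K g)
  have hφ : ∀ p, φ p = p.1 • f + ∑ i, p.2 i • g i := by
    intro p; simp [φ, Fintype.linearCombination_apply]
  -- The extra hyperplane excludes the coefficient 0 for f, which can then be scaled to 1.
  let Z : Set (Submodule K (K × (Fin m → K))) :=
    insert (LinearMap.ker (LinearMap.fst K K (Fin m → K))) (Submodule.comap φ '' W)
  have hZf : Z.Finite := (hW.image _).insert _
  have hZ : (⊤ : Submodule K (K × (Fin m → K))) ∉ Z := by
    rintro (h1 | ⟨P, hP, h1⟩)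
    · have : ((1, 0) : K × (Fin m → K)) ∈ LinearMap.ker (LinearMap.fst K K (Fin m → K)) := by
        rw [← h1]; trivial
      simp at this
    · have hall : ∀ p, φ p ∈ P := fun p => by
        rw [← Submodule.mem_comap, h1]; trivial
      have hf : f ∈ P := by simpa [hφ] using hall (1, 0)
      obtain ⟨i, hi⟩ := h P hP hf
      apply hi
      have := hall (0, Pi.single i 1)
      simpa [hφ, Pi.single_apply] using this
  have hne := Subspace.biUnion_ne_univ_of_top_notMem (s := hZf.toFinset)
    (fun h => hZ (hZf.mem_toFinset.mp h))
  obtain ⟨p, hp⟩ := (Set.ne_univ_iff_exists_notMem _).mp hne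
  simp only [Set.mem_iUnion, not_exists, Set.Finite.mem_toFinset] at hp
  have hp1 : p.1 ≠ 0 := fun h0 => hp _ (Set.mem_insert _ _) (by simpa using h0)
  refine ⟨fun i => p.1⁻¹ * p.2 i, fun P hP hmem => ?_⟩
  refine hp _ (Set.mem_insert_of_mem _ ⟨P, hP, rfl⟩) ?_
  change φ p ∈ P
  have := P.smul_mem p.1 hmem
  rw [smul_add, Finset.smul_sum] at this
  rw [hφ]
  convert this using 3 with i
  rw [smul_smul, mul_inv_cancel_left₀ hp1]

end
end LatticeFGLM

/-! ### Bézout's bound over an infinite field -/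

namespace LatticeFGLM
noncomputable section
open RingTheory.Sequence Pointwise
universe u

/-- Each f is replaced by f plus a combination of the later generators that avoids all associated
primes of R/(rs). This preserves the ideal, and also the degree bound because the bounds decrease
along the list. -/
theorem exists_isWeaklyRegular_of_finite_quotient {K : Type u} [Field K] [Infinite K] {n : ℕ}
    (I : Ideal (MvPolynomial (Fin n) K)) [Module.Finite K (MvPolynomial (Fin n) K ⧸ I)]
    (fs : List (MvPolynomial (Fin n) K)) : ∀ (rs : List (MvPolynomial (Fin n) K)) (ds : List ℕ),
    IsWeaklyRegular (MvPolynomial (Fin n) K) rs → Ideal.ofList rs ⊔ Ideal.ofList fs = I →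
    rs.length + fs.length = n → List.Forall₂ (fun f d => f.totalDegree ≤ d) fs ds →
    ds.Pairwise (· ≥ ·) →
    ∃ gs : List (MvPolynomial (Fin n) K),
      List.Forall₂ (fun f d => f.totalDegree ≤ d) gs ds ∧
      IsWeaklyRegular (MvPolynomial (Fin n) K) (rs ++ gs) ∧ Ideal.ofList (rs ++ gs) = I := by
  induction fs with
  | nil =>
    intro rs ds hreg hI _ hd _
    refine ⟨[], hd, by simpa using hreg, by simpa using hI⟩
  | cons f fs ih =>
    intro rs ds hreg hI hlen hd hs
    obtain ⟨d, ds, hfd, hd', rfl⟩ := List.forall₂_cons_left_iff.mp hd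
    rw [List.pairwise_cons] at hs
    let R := MvPolynomial (Fin n) K
    let J := Ideal.ofList rs
    let W : Set (Submodule K R) := (Submodule.restrictScalars K) '' (associatedPrimes R (R ⧸ J))
    have hWf : W.Finite := (associatedPrimes.finite R (R ⧸ J)).image _
    have hW : ∀ P ∈ W, f ∈ P → ∃ i, fs.get i ∉ P := by
      rintro _ ⟨P, hP, rfl⟩ hf
      by_contra hall
      push Not at hall
      obtain ⟨hPp, x, hx⟩ := isAssociatedPrime_iff.mp hP
      obtain ⟨h, rfl⟩ := Ideal.Quotient.mk_surjective x
      have hmem : ∀ r : R, r ∈ P ↔ r * h ∈ J := by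
        intro r
        rw [hx, Submodule.mem_colon_singleton, Submodule.mem_bot]
        change (Ideal.Quotient.mk J) (r * h) = 0 ↔ _
        exact Ideal.Quotient.eq_zero_iff_mem
      have hIP : I ≤ P := by
        rw [← hI, Ideal.ofList_cons]
        refine sup_le ?_ (sup_le ?_ ?_)
        · intro r hr
          exact (hmem r).mpr (Ideal.mul_mem_right _ _ hr)
        · rw [Ideal.span_singleton_le_iff_mem]; exact hf
        · refine Ideal.span_le.mpr fun r hr => ?_
          obtain ⟨i, rfl⟩ := List.mem_iff_get.mp hr
          exact hall i
      -- P is the colon ideal (J : h); if it contained I, then h would lie in J and P would be the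
      -- whole ring.
      have h1 := mem_ofList_of_mul_mem I rs hreg (by simp at hlen; omega) h
        (fun r hr => (hmem r).mp (hIP hr))
      exact hPp.ne_top ((Ideal.eq_top_iff_one _).mpr ((hmem 1).mpr (by simpa using h1)))
    obtain ⟨c, hc⟩ := exists_add_sum_notMem f fs.get W hWf hW
    let g : R := f + ∑ i, c i • fs.get i
    have hgreg : IsWeaklyRegular R (rs ++ [g]) := by
      rw [isWeaklyRegular_append_iff]
      refine ⟨hreg, ?_⟩
      rw [isWeaklyRegular_singleton_iff]
      have h2 : (Ideal.ofList rs • ⊤ : Submodule R R) = J := by simp [J]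
      rw [h2]
      by_contra hn
      have : g ∈ ⋃ P ∈ associatedPrimes R (R ⧸ J), (P : Set R) := by
        rw [biUnion_associatedPrimes_eq_compl_regular]
        exact hn
      simp only [Set.mem_iUnion] at this
      obtain ⟨P, hP, hgP⟩ := this
      exact hc _ ⟨P, hP, rfl⟩ hgP
    have hsum : ∑ i, c i • fs.get i ∈ Ideal.ofList fs :=
      Ideal.sum_mem _ fun i _ => Submodule.smul_of_tower_mem _ _
        (Ideal.subset_span (List.get_mem _ _))
    have hgI : Ideal.ofList (rs ++ [g]) ⊔ Ideal.ofList fs = I := by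
      rw [← hI, Ideal.ofList_append, Ideal.ofList_singleton, Ideal.ofList_cons, sup_assoc]
      congr 1
      apply le_antisymm
      · refine sup_le ?_ le_sup_right
        rw [Ideal.span_singleton_le_iff_mem]
        exact Ideal.add_mem _ (Ideal.mem_sup_left (Ideal.mem_span_singleton_self f))
          (Ideal.mem_sup_right hsum)
      · refine sup_le ?_ le_sup_right
        rw [Ideal.span_singleton_le_iff_mem]
        have : f = g - ∑ i, c i • fs.get i := by simp [g]
        rw [this]
        exact Ideal.sub_mem _ (Ideal.mem_sup_left (Ideal.mem_span_singleton_self g))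
          (Ideal.mem_sup_right hsum)
    obtain ⟨gs, h1, h2, h3⟩ := ih (rs ++ [g]) ds hgreg hgI (by simp at hlen ⊢; omega) hd' hs.2
    refine ⟨g :: gs, List.Forall₂.cons ?_ h1, by simpa using h2, by simpa using h3⟩
    refine (MvPolynomial.totalDegree_add _ _).trans (max_le hfd ?_)
    refine MvPolynomial.totalDegree_finsetSum_le fun i _ => ?_
    refine (MvPolynomial.totalDegree_smul_le _ _).trans ?_
    have hlen' : fs.length = ds.length := hd'.length_eq
    have := (List.forall₂_iff_get.mp hd').2 i.1 i.2 (hlen' ▸ i.2)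
    exact this.trans (hs.1 _ (List.get_mem _ _))

/-- The monomials of degree at most `s` in `n` variables. -/
def degreeBox (n s : ℕ) : Finset (Fin n → ℕ) :=
  (Fintype.piFinset fun _ => Finset.range (s + 1)).filter fun m => ∑ i, m i ≤ s

theorem mem_degreeBox {n s : ℕ} {m : Fin n → ℕ} : m ∈ degreeBox n s ↔ ∑ i, m i ≤ s := by
  simp only [degreeBox, Finset.mem_filter, Fintype.mem_piFinset, Finset.mem_range,
    and_iff_right_iff_imp]
  exact fun h i => Nat.lt_succ_of_le
    ((Finset.single_le_sum (f := m) (fun _ _ => Nat.zero_le _) (Finset.mem_univ i)).trans h)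

theorem card_degreeBox_le (n s : ℕ) : (degreeBox n s).card ≤ (s + 1) ^ n :=
  (Finset.card_filter_le _ _).trans (by simp)

theorem card_degreeBox_zero (n : ℕ) : 1 ≤ (degreeBox n 0).card :=
  Finset.card_pos.mpr ⟨0, mem_degreeBox.mpr (by simp)⟩

theorem finrank_restrictTotalDegree (K : Type*) [Field K] (n s : ℕ) :
    Module.finrank K (MvPolynomial.restrictTotalDegree (Fin n) K s) = (degreeBox n s).card ∧
    Module.Finite K (MvPolynomial.restrictTotalDegree (Fin n) K s) := by
  let S : Set (Fin n →₀ ℕ) := {m | m.degree ≤ s}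
  have e : S ≃ degreeBox n s := Finsupp.equivFunOnFinite.subtypeEquiv fun m => by
    rw [mem_degreeBox]
    simp [S, Finsupp.degree_eq_sum]
  have := Finite.of_equiv _ e.symm
  have := Fintype.ofFinite S
  let b := MvPolynomial.basisRestrictSupport K S
  have h : MvPolynomial.restrictTotalDegree (Fin n) K s = MvPolynomial.restrictSupport K S := rfl
  rw [h]
  refine ⟨?_, Module.Finite.of_basis b⟩
  rw [Module.finrank_eq_card_basis b, Fintype.card_congr e]
  simp

/-- If D > Δ, the number of monomials is multiplied by at least 1 + 1/Δ each time the degree grows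
by δ; this exponential growth contradicts the polynomial bound `card_degreeBox_le`. -/
theorem le_of_mul_card_degreeBox_le {n D Δ δ : ℕ}
    (h : ∀ s, D * (degreeBox n s).card ≤ Δ * (degreeBox n (s + δ)).card) : D ≤ Δ := by
  by_contra hlt
  push Not at hlt
  rcases Nat.eq_zero_or_pos Δ with h0 | hpos
  · subst h0
    have := h 0
    have h1 := card_degreeBox_zero n
    nlinarith
  let q : ℝ := 1 + 1 / Δ
  have hq : 1 < q := by simp only [q]; linarith [show (0 : ℝ) < 1 / Δ by positivity]
  have hstep : ∀ s, q * (degreeBox n s).card ≤ (degreeBox n (s + δ)).card := by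
    intro s
    have h1 : ((Δ + 1 : ℕ) : ℝ) * (degreeBox n s).card ≤ Δ * (degreeBox n (s + δ)).card := by
      exact_mod_cast (Nat.mul_le_mul_right _ hlt).trans (h s)
    have hΔ : (0 : ℝ) < Δ := by exact_mod_cast hpos
    push_cast at h1
    have h2 : q * (degreeBox n s).card = ((Δ + 1) * (degreeBox n s).card) / Δ := by
      simp only [q]; field_simp
    rw [h2, div_le_iff₀ hΔ]
    linarith
  have hpow : ∀ k : ℕ, q ^ k ≤ (degreeBox n (k * δ)).card := by
    intro k
    induction k with
    | zero => simpa using card_degreeBox_zero n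
    | succ k ih =>
      rw [pow_succ', Nat.succ_mul]
      exact (mul_le_mul_of_nonneg_left ih (by linarith)).trans (hstep _)
  have hlim := tendsto_pow_const_div_const_pow_of_one_lt n hq
  -- The threshold comes from the bound (kδ + 1)^n ≤ (k(δ + 2))^n, which holds for k ≥ 1.
  have hev := (hlim.eventually_lt_const (u := 1 / ((δ + 2 : ℕ) : ℝ) ^ n) (by positivity)).and
    (Filter.eventually_ge_atTop 1)
  obtain ⟨k, hk, hk1⟩ := hev.exists
  have h1 := hpow k
  have h2 : ((degreeBox n (k * δ)).card : ℝ) ≤ ((k * (δ + 2) : ℕ) : ℝ) ^ n := by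
    have : (degreeBox n (k * δ)).card ≤ (k * (δ + 2)) ^ n :=
      (card_degreeBox_le _ _).trans (Nat.pow_le_pow_left (by nlinarith) _)
    exact_mod_cast this
  rw [div_lt_div_iff₀ (by positivity) (by positivity), one_mul] at hk
  push_cast at h2 hk
  rw [mul_pow] at h2
  linarith

/-- Euclidean division of the i-th exponent by d_i is injective; the quotients satisfy the weighted
bound and there are ∏ d_i tuples of remainders. -/
theorem card_degreeBox_le_mul {n : ℕ} (d : Fin n → ℕ) (hd : ∀ i, 0 < d i) (s : ℕ) :
    (degreeBox n s).card ≤ (∏ i, d i) *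
      ((degreeBox n s).filter fun a => ∑ i, a i * d i ≤ s).card := by
  classical
  rw [mul_comm]
  let B : Finset (Fin n → ℕ) := Fintype.piFinset fun i => Finset.range (d i)
  have hB : B.card = ∏ i, d i := by simp [B]
  rw [← hB, ← Finset.card_product]
  refine Finset.card_le_card_of_injOn (fun m => (fun i => m i / d i, fun i => m i % d i)) ?_ ?_
  · intro m hm
    have hm' := mem_degreeBox.mp hm
    simp only [Finset.coe_product, Set.mem_prod, Finset.mem_coe, Finset.mem_filter, mem_degreeBox,
      B, Fintype.mem_piFinset, Finset.mem_range]
    exact ⟨⟨(Finset.sum_le_sum fun i _ => Nat.div_le_self _ _).trans hm',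
      (Finset.sum_le_sum fun i _ => Nat.div_mul_le_self _ _).trans hm'⟩,
      fun i => Nat.mod_lt _ (hd i)⟩
  · intro m _ m' _ hmm
    simp only [Prod.mk.injEq, funext_iff] at hmm
    ext i
    rw [← Nat.div_add_mod (m i) (d i), hmm.1 i, hmm.2 i, Nat.div_add_mod]

/-- Once the generators form a regular sequence g, the products of the powers of g with lifts of a
basis of R/I are linearly independent. Counting those of degree at most s + δ compares the dimension
with ∏ d_i for every s. -/
theorem finrank_quotient_le_prod_of_infinite {K : Type u} [Field K] [Infinite K] {n : ℕ}
    (f : Fin n → MvPolynomial (Fin n) K) (d : Fin n → ℕ) (hd : ∀ i, 0 < d i)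
    (hf : ∀ i, (f i).totalDegree ≤ d i)
    [hfin : Module.Finite K (MvPolynomial (Fin n) K ⧸ Ideal.span (Set.range f))] :
    Module.finrank K (MvPolynomial (Fin n) K ⧸ Ideal.span (Set.range f)) ≤ ∏ i, d i := by
  let R := MvPolynomial (Fin n) K
  let I := Ideal.span (Set.range f)
  -- Sorting by decreasing degree is what allows adding later generators to earlier ones.
  wlog hanti : Antitone d generalizing f d with hw
  · let σ := Tuple.sort (fun i => OrderDual.toDual (d i))
    have hmono : Antitone (d ∘ σ) := Tuple.monotone_sort (fun i => OrderDual.toDual (d i))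
    have hr : Set.range (f ∘ σ) = Set.range f := σ.surjective.range_comp f
    have := hw (f ∘ σ) (d ∘ σ) (fun i => hd _) (fun i => hf _) (hfin := by rw [hr]; exact hfin)
      hmono
    rw [hr] at this
    exact this.trans (Equiv.prod_comp σ d).le
  obtain ⟨gs, hgd, hreg, hgI⟩ := exists_isWeaklyRegular_of_finite_quotient I (List.ofFn f) []
    (List.ofFn d) (IsWeaklyRegular.nil _ _)
    (by rw [Ideal.ofList_nil, bot_sup_eq]
        exact congrArg Ideal.span (Set.ext fun x => List.mem_ofFn))
    (by simp) (by
      rw [List.forall₂_iff_get]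
      refine ⟨by simp, fun i h1 h2 => ?_⟩
      simpa using hf _) (by
      rw [List.pairwise_ofFn]
      exact fun i j hij => hanti hij.le)
  rw [List.nil_append] at hreg hgI
  have hgl : gs.length = n := by simpa using hgd.length_eq
  let b := Module.finBasis K (R ⧸ I)
  choose e he using fun j => Ideal.Quotient.mk_surjective (b j)
  have hind := linearIndependent_prod_pow_smul (K := K) gs hreg e (by
    have h2 : (Ideal.ofList gs • ⊤ : Submodule R R) = I := by
      rw [hgI]; simp
    rw [h2]
    convert b.linearIndependent using 1
    ext j; exact he j)
  let δ := Finset.univ.sup fun j => (e j).totalDegree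
  refine le_of_mul_card_degreeBox_le (n := n) (δ := δ) fun s => ?_
  let A := (degreeBox n s).filter fun a => ∑ i, a i * d i ≤ s
  have hcount : A.card * Module.finrank K (R ⧸ I) ≤ (degreeBox n (s + δ)).card := by
    obtain ⟨hfr, hfin'⟩ := finrank_restrictTotalDegree K n (s + δ)
    rw [← hfr]
    let c : A × Fin (Module.finrank K (R ⧸ I)) → (Fin gs.length → ℕ) × Fin _ :=
      fun p => (fun i => p.1.1 (Fin.cast hgl i), p.2)
    have hc : Function.Injective c := by
      rintro ⟨⟨a, ha⟩, j⟩ ⟨⟨a', ha'⟩, j'⟩ h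
      simp only [c, Prod.mk.injEq, funext_iff] at h
      simp only [Prod.mk.injEq, Subtype.mk.injEq, h.2, and_true]
      ext i
      exact h.1 (Fin.cast hgl.symm i)
    have h1 := hind.comp c hc
    have hmem : ∀ p, ((fun p : (Fin gs.length → ℕ) × Fin _ =>
        (∏ i, gs.get i ^ p.1 i) • e p.2) ∘ c) p ∈
        MvPolynomial.restrictTotalDegree (Fin n) K (s + δ) := by
      rintro ⟨⟨a, ha⟩, j⟩
      rw [MvPolynomial.mem_restrictTotalDegree]
      simp only [Function.comp, c, smul_eq_mul]
      refine (MvPolynomial.totalDegree_mul _ _).trans (add_le_add ?_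
        (Finset.le_sup (f := fun j => (e j).totalDegree) (Finset.mem_univ j)))
      refine (MvPolynomial.totalDegree_finsetProd _ _).trans ?_
      refine le_trans ?_ (Finset.mem_filter.mp ha).2
      rw [← (finCongr hgl).sum_comp]
      refine Finset.sum_le_sum fun i _ => ?_
      refine (MvPolynomial.totalDegree_pow _ _).trans ?_
      refine Nat.mul_le_mul_left _ ?_
      have := (List.forall₂_iff_get.mp hgd).2 i.1 i.2 (by simp [← hgl])
      rw [List.get_ofFn] at this
      exact this
    have h2 : LinearIndependent K (fun p => (⟨_, hmem p⟩ :
        MvPolynomial.restrictTotalDegree (Fin n) K (s + δ))) :=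
      LinearIndependent.of_comp (Submodule.subtype _) h1
    have h3 := h2.fintype_card_le_finrank
    simpa using h3
  calc _ ≤ Module.finrank K (R ⧸ I) * ((∏ i, d i) * A.card) :=
        Nat.mul_le_mul_left _ (card_degreeBox_le_mul d hd s)
    _ = (∏ i, d i) * (A.card * Module.finrank K (R ⧸ I)) := by ring
    _ ≤ _ := Nat.mul_le_mul_left _ hcount

end
end LatticeFGLM

/-! ### Bézout's bound over any field -/

namespace LatticeFGLM
noncomputable section
open scoped TensorProduct
universe u

/-- Bézout's bound for zero-dimensional complete intersections. -/
theorem finrank_quotient_le_prod {K : Type u} [Field K] {n : ℕ}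
    (f : Fin n → MvPolynomial (Fin n) K) (d : Fin n → ℕ) (hd : ∀ i, 0 < d i)
    (hf : ∀ i, (f i).totalDegree ≤ d i)
    (hfin : Module.Finite K (MvPolynomial (Fin n) K ⧸ Ideal.span (Set.range f))) :
    Module.finrank K (MvPolynomial (Fin n) K ⧸ Ideal.span (Set.range f)) ≤ ∏ i, d i := by
  -- Extension of scalars to an infinite field keeps the degree bounds and the dimension of the
  -- quotient.
  let L := AlgebraicClosure K
  have : Infinite L := IsAlgClosed.instInfinite
  let R := MvPolynomial (Fin n) K
  let I := Ideal.span (Set.range f)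
  let g : Fin n → MvPolynomial (Fin n) L := fun i => MvPolynomial.map (algebraMap K L) (f i)
  let e : L ⊗[K] R ≃ₐ[L] MvPolynomial (Fin n) L := MvPolynomial.algebraTensorAlgEquiv K L
  let J : Ideal (L ⊗[K] R) := I.map (Algebra.TensorProduct.includeRight : R →ₐ[K] L ⊗[K] R)
  let e1 : (L ⊗[K] R ⧸ J) ≃ₐ[L] L ⊗[K] (R ⧸ I) :=
    (Algebra.TensorProduct.tensorQuotientEquiv (R := K) L R L I).symm
  have hI : Ideal.span (Set.range g) = J.map (e : L ⊗[K] R →+* MvPolynomial (Fin n) L) := by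
    have h1 : J = Ideal.span (Set.range fun i => (1 : L) ⊗ₜ[K] f i) := by
      simp only [J, I, Ideal.map_span, ← Set.range_comp]
      rfl
    rw [h1, Ideal.map_span, ← Set.range_comp]
    congr 2
    ext i : 1
    refine Eq.trans ?_ (MvPolynomial.algebraTensorAlgEquiv_tmul K L (1 : L) (f i)).symm
    rw [one_smul]
  let e2 := Ideal.quotientEquivAlg _ _ e hI
  let e3 := (e2.symm.trans e1).toLinearEquiv
  have h1 : Module.Finite L (MvPolynomial (Fin n) L ⧸ Ideal.span (Set.range g)) :=
    Module.Finite.equiv e3.symm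
  have h2 := finrank_quotient_le_prod_of_infinite g d hd fun i =>
    (Finset.sup_mono (MvPolynomial.support_map_subset _ _)).trans (hf i)
  rw [e3.finrank_eq, Module.finrank_baseChange] at h2
  exact h2

end
end LatticeFGLM

/-! ### Degeneration to monomials, and dimension of special fibres -/

namespace LatticeFGLM
noncomputable section
universe u

/-- The polynomial variable is a deformation parameter t. At t = 0 the relation involves only the
constant terms of the q m, which vanish by `hb`; then t divides the whole relation and the degrees
drop. -/
theorem eq_zero_of_sum_map_mul_eq_zero {R S β : Type*} [CommRing R] [CommRing S] [Fintype β]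
    (Φ : R →+* Polynomial S) (b : β → S)
    (hb : ∀ p : β → R, ∑ m, Polynomial.constantCoeff (Φ (p m)) * b m = 0 → p = 0)
    (q : β → Polynomial R)
    (hq : ∑ m, Polynomial.eval₂ Φ Polynomial.X (q m) * Polynomial.C (b m) = 0) : q = 0 := by
  have key : ∀ (N : ℕ) (q : β → Polynomial R), (∀ m, (q m).natDegree < N) →
      ∑ m, Polynomial.eval₂ Φ Polynomial.X (q m) * Polynomial.C (b m) = 0 → q = 0 := by
    intro N
    induction N with
    | zero => exact fun q h _ => funext fun m => absurd (h m) (Nat.not_lt_zero _)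
    | succ N ih =>
      intro q hN hq
      have hdiv : ∀ m, q m = Polynomial.divX (q m) * Polynomial.X + Polynomial.C ((q m).coeff 0) :=
        fun m => (Polynomial.divX_mul_X_add _).symm
      have h0 : (fun m => (q m).coeff 0) = 0 := by
        apply hb
        have := congrArg Polynomial.constantCoeff hq
        rw [map_sum, map_zero] at this
        rw [← this]
        refine Finset.sum_congr rfl fun m _ => ?_
        conv_rhs => rw [hdiv m]
        simp [Polynomial.eval₂_add, Polynomial.eval₂_mul]
      have h1 : ∀ m, q m = Polynomial.divX (q m) * Polynomial.X := fun m => by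
        conv_lhs => rw [hdiv m]
        rw [show (q m).coeff 0 = 0 from congrFun h0 m]
        simp
      have h2 : (fun m => Polynomial.divX (q m)) = 0 := by
        by_cases hnt : Nontrivial R
        · by_cases hz : ∀ m, q m = 0
          · funext m; simp [hz m]
          apply ih
          · intro m
            rw [Polynomial.natDegree_divX_eq_natDegree_tsub_one]
            have := hN m
            by_cases hN0 : N = 0
            · exfalso
              apply hz
              intro m
              have h3 := hN m
              rw [Polynomial.eq_C_of_natDegree_eq_zero (by omega : (q m).natDegree = 0),
                show (q m).coeff 0 = 0 from congrFun h0 m, map_zero]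
            · omega
          · have h3 : (∑ m, Polynomial.eval₂ Φ Polynomial.X (Polynomial.divX (q m)) *
                Polynomial.C (b m)) * Polynomial.X = 0 := by
              rw [Finset.sum_mul, ← hq]
              refine Finset.sum_congr rfl fun m _ => ?_
              conv_rhs => rw [h1 m]
              rw [Polynomial.eval₂_mul, Polynomial.eval₂_X]
              ring
            exact Polynomial.monic_X.mul_left_eq_zero_iff.mp h3
        · rw [not_nontrivial_iff_subsingleton] at hnt
          exact Subsingleton.elim _ _
      funext m
      rw [h1 m, show Polynomial.divX (q m) = 0 from congrFun h2 m, zero_mul]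
      rfl
  exact key (Finset.univ.sup (fun m => (q m).natDegree) + 1) q
    (fun m => Nat.lt_succ_of_le (Finset.le_sup (f := fun m => (q m).natDegree) (Finset.mem_univ m)))
    hq

/-- Distinct terms of the p m are sent to nonzero multiples of distinct monomials, so nothing
cancels. -/
theorem eq_zero_of_sum_monomial_mul_eq_zero {K C τ β : Type*} [Field K] [Fintype β]
    (s : C → K) (hs : ∀ c, s c ≠ 0) (E : C → τ →₀ ℕ) (b : β → τ →₀ ℕ)
    (hE : Function.Injective fun p : β × (C →₀ ℕ) => p.2.sum (fun c k => k • E c) + b p.1)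
    (p : β → MvPolynomial C K)
    (hp : ∑ m, MvPolynomial.aeval (fun c => MvPolynomial.monomial (E c) (s c)) (p m) *
      MvPolynomial.monomial (b m) 1 = 0) : p = 0 := by
  classical
  have haev : ∀ q : MvPolynomial C K,
      MvPolynomial.aeval (fun c => MvPolynomial.monomial (E c) (s c)) q =
        ∑ α ∈ q.support, MvPolynomial.monomial (α.sum fun c k => k • E c)
          (q.coeff α * α.prod fun c k => s c ^ k) := by
    intro q
    rw [MvPolynomial.aeval_def, MvPolynomial.eval₂_eq]
    refine Finset.sum_congr rfl fun α _ => ?_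
    rw [MvPolynomial.algebraMap_eq, Finsupp.sum, Finsupp.prod]
    simp only [MvPolynomial.monomial_pow]
    rw [← MvPolynomial.monomial_sum_prod, MvPolynomial.C_mul_monomial]
  funext m₀
  ext α₀
  have h1 := congrArg (MvPolynomial.coeff (α₀.sum (fun c k => k • E c) + b m₀)) hp
  rw [MvPolynomial.coeff_sum, MvPolynomial.coeff_zero, Finset.sum_eq_single m₀] at h1
  · rw [haev, Finset.sum_mul, MvPolynomial.coeff_sum, Finset.sum_eq_single α₀] at h1
    · rw [MvPolynomial.monomial_mul, MvPolynomial.coeff_monomial, if_pos rfl, mul_one,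
        mul_eq_zero] at h1
      refine h1.resolve_right ?_
      exact Finset.prod_ne_zero_iff.mpr fun c _ => pow_ne_zero _ (hs c)
    · intro α _ hα
      rw [MvPolynomial.monomial_mul, MvPolynomial.coeff_monomial, if_neg]
      intro h
      exact hα (congrArg Prod.snd (@hE (m₀, α) (m₀, α₀) h))
    · intro h
      rw [MvPolynomial.notMem_support_iff.mp h]
      simp
  · intro m _ hm
    rw [haev, Finset.sum_mul, MvPolynomial.coeff_sum]
    refine Finset.sum_eq_zero fun α _ => ?_
    rw [MvPolynomial.monomial_mul, MvPolynomial.coeff_monomial, if_neg]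
    intro h
    exact hm (congrArg Prod.fst (@hE (m, α) (m₀, α₀) h))
  · simp

/-- The dimension of a fibre of a finite algebra is at least the generic rank. By Nakayama, lifts of
a basis of the fibre span a submodule N containing s B for some s ≡ 1 modulo the maximal ideal; s is
nonzero in the domain A, so the s e_i are independent in N, which has as many generators as the
fibre has dimensions. -/
theorem card_le_finrank_quotient {K A B ι : Type*} [Field K] [CommRing A] [IsDomain A]
    [Algebra K A] [CommRing B] [Algebra K B] [Algebra A B] [IsScalarTower K A B]
    [Module.Finite A B] (ev : A →ₐ[K] K) [Fintype ι] (e : ι → B) (he : LinearIndependent A e) :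
    Module.Finite K (B ⧸ (RingHom.ker ev).map (algebraMap A B)) ∧
      Fintype.card ι ≤ Module.finrank K (B ⧸ (RingHom.ker ev).map (algebraMap A B)) := by
  let 𝔪 := RingHom.ker ev
  let Q := B ⧸ 𝔪.map (algebraMap A B)
  have hsm : ∀ (a : A) (x : Q), a • x = ev a • x := by
    intro a x
    have h1 : a - algebraMap K A (ev a) ∈ 𝔪 := by
      rw [RingHom.mem_ker]
      simp
    have h2 : (a - algebraMap K A (ev a)) • x = 0 := by
      obtain ⟨y, rfl⟩ := Ideal.Quotient.mk_surjective x
      have : (a - algebraMap K A (ev a)) • (Ideal.Quotient.mk _ y : Q) =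
        Ideal.Quotient.mk _ ((a - algebraMap K A (ev a)) • y) := rfl
      rw [this, Ideal.Quotient.eq_zero_iff_mem, Algebra.smul_def]
      exact Ideal.mul_mem_right _ _ (Ideal.mem_map_of_mem _ h1)
    rw [sub_smul, sub_eq_zero, algebraMap_smul] at h2
    exact h2
  have hfin : Module.Finite K Q := by
    obtain ⟨S, hS⟩ := (inferInstance : Module.Finite A Q).fg_top
    refine ⟨S, ?_⟩
    rw [eq_top_iff]
    intro x _
    have hx : x ∈ Submodule.span A (S : Set Q) := by rw [hS]; trivial
    induction hx using Submodule.span_induction with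
    | mem x h => exact Submodule.subset_span h
    | zero => exact Submodule.zero_mem _
    | add x y _ _ hx hy => exact Submodule.add_mem _ (hx trivial) (hy trivial)
    | smul a x _ hx => rw [hsm]; exact Submodule.smul_mem _ _ (hx trivial)
  refine ⟨hfin, ?_⟩
  let v := Module.finBasis K Q
  choose w hw using fun j => Ideal.Quotient.mk_surjective (v j)
  let N : Submodule A B := Submodule.span A (Set.range w)
  -- The basis of the fibre lifts into N, so B = N + 𝔪 B.
  have htop : (⊤ : Submodule A (B ⧸ N)) ≤ 𝔪 • ⊤ := by
    rintro x -
    obtain ⟨b, rfl⟩ := Submodule.mkQ_surjective _ x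
    have h1 : b - ∑ j, algebraMap K A (v.repr (Ideal.Quotient.mk _ b) j) • w j ∈
        𝔪.map (algebraMap A B) := by
      rw [← Ideal.Quotient.eq_zero_iff_mem, map_sub, map_sum, sub_eq_zero]
      conv_lhs => rw [← v.sum_repr (Ideal.Quotient.mk _ b)]
      refine Finset.sum_congr rfl fun j _ => ?_
      rw [algebraMap_smul, ← hw]
      rfl
    have h2 : (b - ∑ j, algebraMap K A (v.repr (Ideal.Quotient.mk _ b) j) • w j) ∈
        (𝔪 • ⊤ : Submodule A B) := by
      rw [Ideal.smul_top_eq_map]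
      exact h1
    have h3 : N.mkQ b =
        N.mkQ (b - ∑ j, algebraMap K A (v.repr (Ideal.Quotient.mk _ b) j) • w j) := by
      rw [map_sub, eq_comm, sub_eq_self, Submodule.mkQ_apply, Submodule.Quotient.mk_eq_zero]
      exact Submodule.sum_mem _ fun j _ =>
        Submodule.smul_mem _ _ (Submodule.subset_span (Set.mem_range_self j))
    rw [h3]
    have h4 := Submodule.mem_map_of_mem (f := N.mkQ) h2
    rw [Submodule.map_smul''] at h4
    exact (smul_mono_right 𝔪 le_top : _ ≤ 𝔪 • (⊤ : Submodule A (B ⧸ N))) h4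
  obtain ⟨s, hs1, hs2⟩ := Submodule.exists_sub_one_mem_and_smul_eq_zero_of_fg_of_le_smul 𝔪 ⊤
    Module.Finite.fg_top htop
  have hs0 : s ≠ 0 := by
    rintro rfl
    rw [RingHom.mem_ker] at hs1
    simp at hs1
  have hsN : ∀ b : B, s • b ∈ N := by
    intro b
    have := hs2 (N.mkQ b) trivial
    rwa [← map_smul, Submodule.mkQ_apply, Submodule.Quotient.mk_eq_zero] at this
  have hind : LinearIndependent A fun i => (⟨s • e i, hsN _⟩ : N) := by
    refine LinearIndependent.of_comp N.subtype ?_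
    rw [Fintype.linearIndependent_iff] at he ⊢
    intro g hg i
    have h5 := he (fun i => g i * s) (by
      rw [← hg]
      exact Finset.sum_congr rfl fun i _ => by simp [mul_smul]) i
    exact (mul_eq_zero.mp h5).resolve_right hs0
  have : Module.Finite A N := Module.Finite.span_of_finite A (Set.finite_range w)
  have h6 := finrank_range_le_card (R := A) w
  rw [Fintype.card_fin] at h6
  exact hind.fintype_card_le_finrank.trans h6

end
end LatticeFGLM

/-! ### Independence of monomials over generic coefficients -/

namespace LatticeFGLM
noncomputable section
universe u

section GenericSystem

variable {K : Type*} [Field K] {n : ℕ} {C : Type*} [Fintype C]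

open scoped Classical in
/-- The parametrization of the systems `∑ c, v c * x ^ ex c` (over the `c` with `ix c = i`) that
vanish at a generic point `x`: the coefficients `c ∉ Set.range c₀` are free up to a monomial
factor, and the coefficient `c₀ i` is determined by the equation `i`. -/
def genericCoeff (ix : C → Fin n) (ex : C → Mon n) (c₀ : Fin n → C) (c : C) :
    MvPolynomial ({c // c ∉ Set.range c₀} ⊕ Fin n) K :=
  if h : c ∈ Set.range c₀ then
    -∑ c' : {c // c ∉ Set.range c₀}, if ix c' = ix c then
      MvPolynomial.X (Sum.inl c') * MvPolynomial.monomial ((ex c').mapDomain Sum.inr) 1 else 0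
  else MvPolynomial.X (Sum.inl ⟨c, h⟩) *
    MvPolynomial.monomial ((ex (c₀ (ix c))).mapDomain Sum.inr) 1

/-- The factor x^(ex (c₀ i)) of each free coefficient matches the monomial that multiplies the
solved coefficient, so the terms cancel. -/
theorem sum_genericCoeff_mul {ix : C → Fin n} {ex : C → Mon n} {c₀ : Fin n → C}
    (h₀ : ∀ i, ix (c₀ i) = i) (i : Fin n) [DecidableEq (Fin n)] :
    ∑ c with ix c = i, genericCoeff (K := K) ix ex c₀ c *
      MvPolynomial.monomial ((ex c).mapDomain Sum.inr) 1 = 0 := by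
  classical
  have h1 : (Finset.univ.filter fun c => ix c = i) =
      insert (c₀ i) (Finset.univ.filter fun c => ix c = i ∧ c ∉ Set.range c₀) := by
    ext c
    simp only [Finset.mem_filter, Finset.mem_univ, true_and, Finset.mem_insert]
    constructor
    · intro hc
      by_cases hr : c ∈ Set.range c₀
      · obtain ⟨j, rfl⟩ := hr
        left; rw [← hc, h₀]
      · exact Or.inr ⟨hc, hr⟩
    · rintro (rfl | ⟨hc, _⟩)
      · exact h₀ i
      · exact hc
  rw [h1, Finset.sum_insert (by simp)]
  have h2 : ∑ c with ix c = i ∧ c ∉ Set.range c₀, genericCoeff (K := K) ix ex c₀ c *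
      MvPolynomial.monomial ((ex c).mapDomain Sum.inr) 1 =
      ∑ c' : {c // c ∉ Set.range c₀}, if ix c' = i then
        genericCoeff (K := K) ix ex c₀ c'.1 *
          MvPolynomial.monomial ((ex c'.1).mapDomain Sum.inr) 1 else 0 := by
    rw [← Finset.sum_filter]
    symm
    refine Finset.sum_bij (fun c _ => c.1) ?_ ?_ ?_ ?_
    · intro c hc
      simp only [Finset.mem_filter, Finset.mem_univ, true_and] at hc ⊢
      exact ⟨hc, c.2⟩
    · exact fun a _ b _ h => Subtype.ext h
    · intro c hc
      simp only [Finset.mem_filter, Finset.mem_univ, true_and] at hc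
      exact ⟨⟨c, hc.2⟩, by simp [hc.1], rfl⟩
    · exact fun _ _ => rfl
  rw [h2, genericCoeff, dif_pos (Set.mem_range_self i), neg_mul, Finset.sum_mul, neg_add_eq_zero]
  refine Finset.sum_congr rfl fun c' _ => ?_
  rw [h₀]
  split_ifs with h
  · rw [genericCoeff, dif_neg c'.2, h]
    ring
  · simp

/-- This contains both the algebraic independence of the generic coefficients and the independence
over them of the monomials x^m with m_i < N_i. It is proved by degenerating each equation to its two
terms `c₀ i` and `c₁ i`, where all the images are monomials. -/
theorem sum_aeval_genericCoeff_mul_eq_zero {ix : C → Fin n} {ex : C → Mon n} {c₀ c₁ : Fin n → C}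
    {N : Fin n → ℕ} (h₀ : ∀ i, ix (c₀ i) = i) (h₁ : ∀ i, ix (c₁ i) = i)
    (h₁₀ : ∀ i, ex (c₁ i) = ex (c₀ i) + Finsupp.single i (N i)) (hN : ∀ i, 0 < N i)
    (p : (∀ i, Fin (N i)) → MvPolynomial C K)
    (hp : ∑ m, MvPolynomial.aeval (genericCoeff (K := K) ix ex c₀) (p m) *
      MvPolynomial.monomial ((Finsupp.equivFunOnFinite.symm fun i => (m i : ℕ)).mapDomain
        Sum.inr) 1 = 0) : p = 0 := by
  classical
  have hc₁ : ∀ i, c₁ i ∉ Set.range c₀ := by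
    rintro i ⟨j, hj⟩
    have hij : j = i := by rw [← h₀ j, hj, h₁]
    subst hij
    have := h₁₀ j
    rw [← hj, left_eq_add] at this
    have h2 := congrArg (fun f => f j) this
    simp at h2
    exact (hN j).ne' h2
  let S := MvPolynomial ({c // c ∉ Set.range c₀} ⊕ Fin n) K
  let b : (∀ i, Fin (N i)) → ({c // c ∉ Set.range c₀} ⊕ Fin n) →₀ ℕ := fun m =>
    (Finsupp.equivFunOnFinite.symm fun i => (m i : ℕ)).mapDomain Sum.inr
  let φ : MvPolynomial C K →ₐ[K] S := MvPolynomial.aeval (genericCoeff ix ex c₀)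
  -- The degeneration multiplies by t the free variables of all terms other than the `c₁ i`.
  let θ : S →ₐ[K] Polynomial S := MvPolynomial.aeval (Sum.elim
    (fun c => if c.1 ∈ Set.range c₁ then Polynomial.C (MvPolynomial.X (Sum.inl c)) else
      Polynomial.X * Polynomial.C (MvPolynomial.X (Sum.inl c)))
    (fun j => Polynomial.C (MvPolynomial.X (Sum.inr j))))
  let Φ : MvPolynomial C K →ₐ[K] Polynomial S := MvPolynomial.aeval (fun c =>
    if c ∈ Set.range c₀ then θ (genericCoeff ix ex c₀ c) else
      Polynomial.C (genericCoeff ix ex c₀ c))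
  -- The factors t of the coefficients outside `c₀` are put into ρ instead of Φ; otherwise these
  -- coefficients would vanish at t = 0 and independence would be lost.
  let ρ : MvPolynomial C K →ₐ[K] Polynomial (MvPolynomial C K) := MvPolynomial.aeval (fun c =>
    if c ∈ Set.range c₀ ∨ c ∈ Set.range c₁ then Polynomial.C (MvPolynomial.X c) else
      Polynomial.X * Polynomial.C (MvPolynomial.X c))
  have hθl : ∀ c, θ (MvPolynomial.X (Sum.inl c)) = if c.1 ∈ Set.range c₁ then
      Polynomial.C (MvPolynomial.X (Sum.inl c)) else
      Polynomial.X * Polynomial.C (MvPolynomial.X (Sum.inl c)) :=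
    fun c => MvPolynomial.aeval_X _ _
  have hθr : ∀ j, θ (MvPolynomial.X (Sum.inr j)) = Polynomial.C (MvPolynomial.X (Sum.inr j)) :=
    fun j => MvPolynomial.aeval_X _ _
  have hθm : ∀ m : Mon n, θ (MvPolynomial.monomial (m.mapDomain Sum.inr) 1) =
      Polynomial.C (MvPolynomial.monomial (m.mapDomain Sum.inr) 1) := by
    intro m
    rw [MvPolynomial.monomial_eq, map_one, one_mul, Finsupp.prod_mapDomain_index_inj
      Sum.inr_injective, Finsupp.prod, map_prod, map_prod]
    refine Finset.prod_congr rfl fun j _ => ?_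
    rw [map_pow, map_pow, hθr]
  have hcomm : ∀ q, θ (φ q) = Polynomial.eval₂ (Φ : MvPolynomial C K →+* Polynomial S)
      Polynomial.X (ρ q) := by
    intro q
    let e2 : Polynomial (MvPolynomial C K) →+* Polynomial S :=
      Polynomial.eval₂RingHom (Φ : MvPolynomial C K →+* Polynomial S) Polynomial.X
    change (θ : S →+* Polynomial S).comp (φ : _ →+* S) q = e2.comp (ρ : _ →+* _) q
    congr 1
    refine MvPolynomial.ringHom_ext ?_ ?_
    · intro r
      simp [e2, MvPolynomial.algebraMap_eq]
    · intro c
      simp only [RingHom.comp_apply, RingHom.coe_coe, φ, ρ, MvPolynomial.aeval_X, e2,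
        Polynomial.coe_eval₂RingHom]
      by_cases hc : c ∈ Set.range c₀
      · rw [if_pos (Or.inl hc), Polynomial.eval₂_C]
        simp only [RingHom.coe_coe, Φ, MvPolynomial.aeval_X]
        rw [if_pos hc]
      · have h3 : θ (genericCoeff ix ex c₀ c) = (if c ∈ Set.range c₁ then 1 else Polynomial.X) *
            Polynomial.C (genericCoeff ix ex c₀ c) := by
          rw [genericCoeff, dif_neg hc, map_mul, hθm, hθl, map_mul]
          split_ifs
          · rw [one_mul]
          · rw [mul_assoc]
        rw [h3]
        by_cases hc' : c ∈ Set.range c₁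
        · rw [if_pos (Or.inr hc'), if_pos hc', Polynomial.eval₂_C, one_mul]
          simp only [RingHom.coe_coe, Φ, MvPolynomial.aeval_X]
          rw [if_neg hc]
        · rw [if_neg (not_or.mpr ⟨hc, hc'⟩), if_neg hc', Polynomial.eval₂_mul, Polynomial.eval₂_C,
            Polynomial.eval₂_X]
          simp only [RingHom.coe_coe, Φ, MvPolynomial.aeval_X]
          rw [if_neg hc]
  -- Exponents of the coefficients at t = 0: only the term of `c₁ i`, with sign -1, remains in the
  -- solved coefficient of `c₀ i`.
  let E : C → ({c // c ∉ Set.range c₀} ⊕ Fin n) →₀ ℕ := fun c =>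
    if h : c ∈ Set.range c₀ then Finsupp.single (Sum.inl ⟨c₁ (ix c), hc₁ _⟩) 1 +
      (ex (c₁ (ix c))).mapDomain Sum.inr
    else Finsupp.single (Sum.inl ⟨c, h⟩) 1 + (ex (c₀ (ix c))).mapDomain Sum.inr
  let sg : C → K := fun c => if c ∈ Set.range c₀ then -1 else 1
  have hsg : ∀ c, sg c ≠ 0 := fun c => by simp only [sg]; split_ifs <;> simp
  have hmon : ∀ (c' : {c // c ∉ Set.range c₀}) (m : Mon n),
      (MvPolynomial.X (Sum.inl c') * MvPolynomial.monomial (m.mapDomain Sum.inr) 1 : S) =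
      MvPolynomial.monomial (Finsupp.single (Sum.inl c') 1 + m.mapDomain Sum.inr) 1 := by
    intro c' m
    rw [MvPolynomial.X, MvPolynomial.monomial_mul, one_mul]
  have hΦ0 : ∀ q, Polynomial.constantCoeff (Φ q) =
      MvPolynomial.aeval (fun c => MvPolynomial.monomial (E c) (sg c)) q := by
    intro q
    change (Polynomial.constantCoeff).comp (Φ : _ →+* _) q =
      ((MvPolynomial.aeval (fun c => MvPolynomial.monomial (E c) (sg c)) :
        MvPolynomial C K →ₐ[K] S) : MvPolynomial C K →+* S) q
    congr 1
    refine MvPolynomial.ringHom_ext ?_ ?_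
    · intro r
      simp
    · intro c
      simp only [RingHom.comp_apply, RingHom.coe_coe, Φ, MvPolynomial.aeval_X, E, sg]
      by_cases hc : c ∈ Set.range c₀
      · rw [if_pos hc, if_pos hc, dif_pos hc, genericCoeff, dif_pos hc, map_neg, map_sum, map_neg,
          map_sum, Finset.sum_eq_single ⟨c₁ (ix c), hc₁ _⟩]
        · rw [if_pos (h₁ _), map_mul, hθm, map_neg, ← hmon, hθl, if_pos (Set.mem_range_self _)]
          simp
        · intro c' _ hc'
          split_ifs with h
          · rw [map_mul, hθm]
            have : c'.1 ∉ Set.range c₁ := by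
              rintro ⟨j, hj⟩
              apply hc'
              apply Subtype.ext
              rw [← h, ← hj, h₁]
            rw [hθl, if_neg this]
            simp
          · simp
        · simp
      · rw [if_neg hc, if_neg hc, dif_neg hc, genericCoeff, dif_neg hc, ← hmon]
        simp
  -- Each E c contains exactly one free variable, which belongs to the equation of c; so the
  -- exponents of the free variables determine how many factors come from each equation. What
  -- remains in the exponent of x_j is α(c₀ j) N_j + m_j with m_j < N_j, and Euclidean division
  -- recovers both. The other α(c) follow by subtraction.
  have hE : Function.Injective fun p : (∀ i, Fin (N i)) × (C →₀ ℕ) =>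
      p.2.sum (fun c k => k • E c) + b p.1 := by
    have hL : ∀ (α : C →₀ ℕ) (t), α.sum (fun c k => k • E c) t = ∑ c, α c * E c t := by
      intro α t
      rw [Finsupp.sum_fintype _ _ (by simp), Finsupp.finsetSum_apply]
      simp
    have hinr : ∀ (m : Mon n) (j : Fin n),
        (m.mapDomain Sum.inr : ({c // c ∉ Set.range c₀} ⊕ Fin n) →₀ ℕ) (Sum.inr j) = m j :=
      fun m j => Finsupp.mapDomain_apply Sum.inr_injective m j
    have hinl : ∀ (m : Mon n) c',
        (m.mapDomain Sum.inr : ({c // c ∉ Set.range c₀} ⊕ Fin n) →₀ ℕ) (Sum.inl c') = 0 :=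
      fun m c' => Finsupp.mapDomain_of_notMem_range _ _ (by simp)
    have hEinr : ∀ c j, E c (Sum.inr j) = ex (c₀ (ix c)) j + if c = c₀ j then N j else 0 := by
      intro c j
      simp only [E]
      split_ifs with h h' h'
      · subst h'
        simp [hinr, h₁₀, h₀]
      · obtain ⟨i, rfl⟩ := h
        have : i ≠ j := fun h => h' (by rw [h])
        simp [hinr, h₁₀, h₀, this]
      · exact absurd ⟨j, h'.symm⟩ h
      · simp [hinr]
    have hEw : ∀ (w : Fin n → ℕ) c, ∑ c' : {c // c ∉ Set.range c₀}, E c (Sum.inl c') * w (ix c') =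
        w (ix c) := by
      intro w c
      simp only [E]
      split_ifs with h
      · rw [Finset.sum_eq_single ⟨c₁ (ix c), hc₁ _⟩]
        · simp [hinl, h₁]
        · intro c' _ hc'
          simp [hinl, Ne.symm hc']
        · simp
      · rw [Finset.sum_eq_single ⟨c, h⟩]
        · simp [hinl]
        · intro c' _ hc'
          simp [hinl, Ne.symm hc']
        · simp
    have hw : ∀ (α : C →₀ ℕ) (w : Fin n → ℕ), ∑ c' : {c // c ∉ Set.range c₀},
        (∑ c, α c * E c (Sum.inl c')) * w (ix c') = ∑ c, α c * w (ix c) := by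
      intro α w
      simp_rw [Finset.sum_mul]
      rw [Finset.sum_comm]
      refine Finset.sum_congr rfl fun c _ => ?_
      rw [← hEw w c, Finset.mul_sum]
      exact Finset.sum_congr rfl fun c' _ => mul_assoc _ _ _
    rintro ⟨m, α⟩ ⟨m', α'⟩ h
    have hl : ∀ c', ∑ c, α c * E c (Sum.inl c') = ∑ c, α' c * E c (Sum.inl c') := by
      intro c'
      have := DFunLike.congr_fun h (Sum.inl c')
      simpa [hL, b, hinl] using this
    have hr : ∀ j, α (c₀ j) * N j + m j = α' (c₀ j) * N j + m' j := by
      intro j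
      have h6 := DFunLike.congr_fun h (Sum.inr j)
      simp only [Finsupp.add_apply, hL, b, hinr, Finsupp.equivFunOnFinite_symm_apply_apply, hEinr,
        mul_add, Finset.sum_add_distrib, mul_ite, mul_zero, Finset.sum_ite_eq',
        Finset.mem_univ, if_true] at h6
      rw [← hw α fun i => ex (c₀ i) j, ← hw α' fun i => ex (c₀ i) j] at h6
      simp only [hl] at h6
      omega
    have hm : m = m' := by
      funext j
      apply Fin.ext
      have h7 := congrArg (· % N j) (hr j)
      simpa [Nat.add_mod, Nat.mod_eq_of_lt] using h7
    subst hm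
    have hα0 : ∀ j, α (c₀ j) = α' (c₀ j) := fun j =>
      Nat.eq_of_mul_eq_mul_right (hN j) (Nat.add_right_cancel (hr j))
    congr 1
    ext c'
    by_cases hc' : c' ∈ Set.range c₀
    · obtain ⟨j, rfl⟩ := hc'
      exact hα0 j
    · have hsplit : ∀ α : C →₀ ℕ, ∑ c, α c * E c (Sum.inl ⟨c', hc'⟩) =
          (∑ c with c ∈ Set.range c₀, α c * E c (Sum.inl ⟨c', hc'⟩)) + α c' := by
        intro α
        rw [← Finset.sum_filter_add_sum_filter_not Finset.univ (fun c => c ∈ Set.range c₀)]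
        congr 1
        rw [Finset.sum_eq_single c']
        · simp only [E]
          rw [dif_neg hc']
          simp [hinl]
        · intro c hc hcc
          have hc2 := (Finset.mem_filter.mp hc).2
          simp only [E]
          rw [dif_neg hc2]
          simp [hinl, hcc]
        · exact fun h => (h (Finset.mem_filter.mpr ⟨Finset.mem_univ c', hc'⟩)).elim
      have h8 := hl ⟨c', hc'⟩
      rw [hsplit, hsplit, Finset.sum_congr rfl (g := fun c => α' c * E c (Sum.inl ⟨c', hc'⟩))] at h8
      · exact Nat.add_left_cancel h8
      · intro c hc
        obtain ⟨j, rfl⟩ := (Finset.mem_filter.mp hc).2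
        rw [hα0]
  -- Setting t = 1 inverts ρ.
  have hρ : Function.Injective ρ := by
    have : ∀ q, Polynomial.eval 1 (ρ q) = q := by
      intro q
      change (Polynomial.evalRingHom 1).comp (ρ : _ →+* _) q = RingHom.id _ q
      congr 1
      refine MvPolynomial.ringHom_ext ?_ ?_
      · intro r; simp [MvPolynomial.algebraMap_eq]
      · intro c
        simp only [RingHom.comp_apply, RingHom.coe_coe, ρ, MvPolynomial.aeval_X, RingHom.id_apply]
        split_ifs <;> simp
    exact Function.LeftInverse.injective this
  have h4 := eq_zero_of_sum_map_mul_eq_zero (Φ : MvPolynomial C K →+* Polynomial S)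
    (fun m => MvPolynomial.monomial (b m) 1) (fun q hq => by
      refine eq_zero_of_sum_monomial_mul_eq_zero sg hsg E b hE q ?_
      rw [← hq]
      exact Finset.sum_congr rfl fun m _ => by rw [← hΦ0]; rfl)
    (fun m => ρ (p m)) (by
      have h5 := congrArg θ hp
      rw [map_sum, map_zero] at h5
      rw [← h5]
      refine Finset.sum_congr rfl fun m _ => ?_
      rw [map_mul, hθm, ← hcomm])
  funext m
  apply hρ
  rw [Pi.zero_apply, map_zero]
  exact congrFun h4 m

end GenericSystem

end
end LatticeFGLM

/-! ### The torus part of a generic system -/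

namespace LatticeFGLM
noncomputable section
universe u w

/-- Multiplication by a unit is injective on the finite-dimensional image of ψ, hence surjective, so
the inverse already lies in the image. -/
theorem AlgHom.surjective_of_isUnit {K A : Type*} [Field K] [CommRing A] [Algebra K A]
    [Module.Finite K A] {n : ℕ} (ψ : MvPolynomial (Fin n) K →ₐ[K] A) {x : MvPolynomial (Fin n) K}
    {y : A} (h : ψ x * y = 1) : y ∈ ψ.range := by
  let V := ψ.range
  let f : V →ₗ[K] V := LinearMap.mulLeft K (⟨ψ x, x, rfl⟩ : V)
  have hf : Function.Injective f := by
    rw [injective_iff_map_eq_zero]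
    intro v hv
    have h1 : ψ x * v = 0 := congrArg Subtype.val hv
    apply Subtype.ext
    change (v : A) = 0
    calc (v : A) = y * (ψ x * v) := by rw [← mul_assoc, mul_comm y, h, one_mul]
      _ = 0 := by rw [h1, mul_zero]
  obtain ⟨v, hv⟩ := LinearMap.surjective_of_injective hf 1
  have h1 : ψ x * v = 1 := congrArg Subtype.val hv
  have : y = v := by
    calc y = y * (ψ x * v) := by rw [h1, mul_one]
      _ = (ψ x * y) * v := by ring
      _ = v := by rw [h, one_mul]
  rw [this]
  exact v.2

/-- An algebraically independent family as large as the transcendence degree is a transcendence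
basis. -/
theorem isAlgebraic_of_algebraicIndependent {K : Type u} [Field K] {C τ : Type*} [Fintype C]
    [Fintype τ] (hcard : Fintype.card τ = Fintype.card C) (g : C → MvPolynomial τ K)
    (hg : AlgebraicIndependent K g) (y : MvPolynomial τ K) :
    ∃ p : Polynomial (MvPolynomial C K), p ≠ 0 ∧
      Polynomial.eval₂ (MvPolynomial.aeval g : MvPolynomial C K →ₐ[K] MvPolynomial τ K).toRingHom
        y p = 0 := by
  have hb : IsTranscendenceBasis K g := by
    apply hg.isTranscendenceBasis_of_lift_trdeg_le_of_finite
    rw [MvPolynomial.trdeg_of_isDomain]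
    simp [hcard]
  obtain ⟨p, hp, hpy⟩ := hb.isAlgebraic.isAlgebraic y
  let e := hg.aevalEquiv
  refine ⟨p.map (e.symm : _ →+* MvPolynomial C K), ?_, ?_⟩
  · refine (Polynomial.map_ne_zero_iff ?_).mpr hp
    exact e.symm.injective
  · rw [Polynomial.eval₂_map, ← hpy, Polynomial.aeval_def]
    congr 1
    ext z
    obtain ⟨w, rfl⟩ := e.surjective z
    simp [e]

section GenericSystem

variable {K : Type u} [Field K] {n : ℕ}

/-- The algebra A is the fibre of B at `ev`. The equations specialize, `card_le_finrank_quotient`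
bounds the dimension, and the variables alone generate the fibre because their inverses are
polynomials in them. -/
theorem exists_quotient_of_finite {B : Type w} {R C : Type*} [Fintype C] [CommRing R] [IsDomain R]
    [Algebra K R] [CommRing B] [Algebra R B] [Algebra K B] [IsScalarTower K R B]
    [Module.Finite R B] (ev : R →ₐ[K] K) (x y : Fin n → B) (hxy : ∀ j, x j * y j = 1)
    (hgen : Algebra.adjoin R (Set.range x ∪ Set.range y) = ⊤) (N : Fin n → ℕ)
    (he : LinearIndependent R fun m : (∀ i, Fin (N i)) => ∏ j, x j ^ (m j : ℕ))
    (ix : C → Fin n) (ex : C → Mon n) (r : C → R)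
    (hr : ∀ i, ∑ c with ix c = i, algebraMap R B (r c) * ∏ j, x j ^ (ex c) j = 0) :
    ∃ (A : Type w) (_ : CommRing A) (_ : Algebra K A)
        (ψ : MvPolynomial (Fin n) K →ₐ[K] A), Module.Finite K A ∧ Function.Surjective ψ ∧
        (∀ j, IsUnit (ψ (MvPolynomial.X j))) ∧
        (∀ i, ψ (∑ c with ix c = i, MvPolynomial.monomial (ex c) (ev (r c))) = 0) ∧
        ∏ i, N i ≤ Module.finrank K A := by
  obtain ⟨hAfin, hAcard⟩ := card_le_finrank_quotient (K := K) ev _ he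
  let 𝔪B := (RingHom.ker ev).map (algebraMap R B)
  let π : B →ₐ[K] B ⧸ 𝔪B := Ideal.Quotient.mkₐ K 𝔪B
  have hπ : ∀ r : R, π (algebraMap R B r) = algebraMap K _ (ev r) := by
    intro r
    have h1 : r - algebraMap K R (ev r) ∈ RingHom.ker ev := by
      rw [RingHom.mem_ker]; simp
    have h2 : π (algebraMap R B (r - algebraMap K R (ev r))) = 0 :=
      Ideal.Quotient.eq_zero_iff_mem.mpr (Ideal.mem_map_of_mem _ h1)
    rw [map_sub, map_sub, sub_eq_zero, ← IsScalarTower.algebraMap_apply K R B,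
      AlgHom.commutes] at h2
    exact h2
  let ψ : MvPolynomial (Fin n) K →ₐ[K] B ⧸ 𝔪B := MvPolynomial.aeval fun j => π (x j)
  have hψX : ∀ j, ψ (MvPolynomial.X j) = π (x j) := fun j => MvPolynomial.aeval_X _ _
  have hψY : ∀ j, ψ (MvPolynomial.X j) * π (y j) = 1 := fun j => by
    rw [hψX, ← map_mul, hxy, map_one]
  refine ⟨B ⧸ 𝔪B, inferInstance, inferInstance, ψ, hAfin, ?_, ?_, ?_, ?_⟩
  · intro z
    obtain ⟨b, rfl⟩ := Ideal.Quotient.mk_surjective z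
    change π b ∈ ψ.range
    have hb : b ∈ Algebra.adjoin R (Set.range x ∪ Set.range y) := by rw [hgen]; trivial
    induction hb using Algebra.adjoin_induction with
    | mem b h =>
      rcases h with ⟨j, rfl⟩ | ⟨j, rfl⟩
      · exact ⟨MvPolynomial.X j, hψX j⟩
      · exact AlgHom.surjective_of_isUnit ψ (hψY j)
    | algebraMap r => rw [hπ]; exact ψ.range.algebraMap_mem _
    | add b c hb hc h1 h2 => rw [map_add]; exact ψ.range.add_mem h1 h2
    | mul b c hb hc h1 h2 => rw [map_mul]; exact ψ.range.mul_mem h1 h2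
  · exact fun j => IsUnit.of_mul_eq_one _ (hψY j)
  · intro i
    have h6 := congrArg π (hr i)
    rw [map_sum, map_zero] at h6
    rw [map_sum, ← h6]
    refine Finset.sum_congr rfl fun c _ => ?_
    rw [map_mul, hπ, map_prod, MvPolynomial.monomial_eq, map_mul,
      Finsupp.prod_fintype _ _ (by simp), map_prod]
    congr 1
    · exact ψ.commutes _
    · simp only [map_pow, hψX]
  · simpa using hAcard

/-- For generic coefficients `v`, the torus part of the algebra that is defined by the system
`∑ c, v c * x ^ ex c` (over the `c` with `ix c = i`) has dimension at least `∏ i, N i`. -/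
theorem exists_generic_quotient {C : Type w} [Fintype C] (ix : C → Fin n) (ex : C → Mon n)
    (c₀ c₁ : Fin n → C) (N : Fin n → ℕ) (h₀ : ∀ i, ix (c₀ i) = i) (h₁ : ∀ i, ix (c₁ i) = i)
    (h₁₀ : ∀ i, ex (c₁ i) = ex (c₀ i) + Finsupp.single i (N i)) (hN : ∀ i, 0 < N i) :
    ∃ P : MvPolynomial C K, P ≠ 0 ∧ ∀ v : C → K, MvPolynomial.eval v P ≠ 0 →
      ∃ (A : Type (max u w)) (_ : CommRing A) (_ : Algebra K A)
        (ψ : MvPolynomial (Fin n) K →ₐ[K] A), Module.Finite K A ∧ Function.Surjective ψ ∧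
        (∀ j, IsUnit (ψ (MvPolynomial.X j))) ∧
        (∀ i, ψ (∑ c with ix c = i, MvPolynomial.monomial (ex c) (v c)) = 0) ∧
        ∏ i, N i ≤ Module.finrank K A := by
  classical
  let τ := {c // c ∉ Set.range c₀} ⊕ Fin n
  let R := MvPolynomial C K
  let S := MvPolynomial τ K
  let L := FractionRing S
  let g : C → S := genericCoeff ix ex c₀
  let φ : R →ₐ[K] S := MvPolynomial.aeval g
  have hφ : Function.Injective φ := by
    rw [injective_iff_map_eq_zero]
    intro q hq
    -- Algebraic independence is the case of a relation supported on the monomial 1.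
    have h := sum_aeval_genericCoeff_mul_eq_zero (K := K) h₀ h₁ h₁₀ hN
      (fun m => if m = fun i => ⟨0, hN i⟩ then q else 0) (by
        refine Finset.sum_eq_zero fun m _ => ?_
        split_ifs
        · rw [show MvPolynomial.aeval (genericCoeff ix ex c₀) q = 0 from hq, zero_mul]
        · rw [map_zero, zero_mul])
    simpa using congrFun h (fun i => ⟨0, hN i⟩)
  have hcard : Fintype.card τ = Fintype.card C := by
    have hinj : Function.Injective c₀ := fun i j h => by rw [← h₀ i, h, h₀]
    rw [Fintype.card_sum, Fintype.card_subtype_compl, Set.card_range_of_injective hinj,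
      Fintype.card_fin, Nat.sub_add_cancel]
    simpa using Fintype.card_le_of_injective c₀ hinj
  let algRL : Algebra R L := ((algebraMap S L).comp (φ : R →+* S)).toAlgebra
  let modRL : Module R L := Algebra.toModule
  have hRL : ∀ r : R, algebraMap R L r = algebraMap S L (φ r) := fun _ => rfl
  have hRLinj : Function.Injective (algebraMap R L) :=
    (IsFractionRing.injective S L).comp hφ
  have : FaithfulSMul R L := (faithfulSMul_iff_algebraMap_injective R L).mpr hRLinj
  have halg : ∀ y : S, IsAlgebraic R (algebraMap S L y) := by
    intro y
    obtain ⟨p, hp, hpy⟩ := isAlgebraic_of_algebraicIndependent hcard g hφ y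
    refine ⟨p, hp, ?_⟩
    have := congrArg (algebraMap S L) hpy
    rw [Polynomial.hom_eval₂, map_zero] at this
    exact this
  let x : Fin n → L := fun j => algebraMap S L (MvPolynomial.X (Sum.inr j))
  have hx0 : ∀ j, x j ≠ 0 := fun j => by
    simp only [x]
    rw [Ne, IsFractionRing.to_map_eq_zero_iff]
    exact MvPolynomial.X_ne_zero _
  -- The x_j and their inverses are algebraic over the coefficient ring, since there are as many
  -- indeterminates as coefficients. Inverting the multipliers a_j and a'_j makes them integral,
  -- which is the role of P.
  choose a ha hai using fun j => (halg (MvPolynomial.X (Sum.inr j))).exists_integral_multiple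
  choose a' ha' hai' using fun j =>
    (halg (MvPolynomial.X (Sum.inr j))).inv.exists_integral_multiple
  let P : R := ∏ j, a j * a' j
  have hP : P ≠ 0 := Finset.prod_ne_zero_iff.mpr fun j _ => mul_ne_zero (ha j) (ha' j)
  refine ⟨P, hP, fun v hv => ?_⟩
  let RP := Localization.Away P
  have domRP : IsDomain RP := IsLocalization.isDomain_localization
    (powers_le_nonZeroDivisors_of_noZeroDivisors hP)
  let algRPL : Algebra RP L := (IsLocalization.Away.lift (S := RP) P (g := algebraMap R L)
    (isUnit_iff_ne_zero.mpr (by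
      rw [Ne, map_eq_zero_iff _ hRLinj]; exact hP))).toAlgebra
  have towRRPL : IsScalarTower R RP L := IsScalarTower.of_algebraMap_eq fun r =>
    (IsLocalization.Away.lift_eq P _ r).symm
  have towKRL : IsScalarTower K R L := IsScalarTower.of_algebraMap_eq fun r => by
    rw [hRL, AlgHom.commutes]
    rfl
  have towKRPL : IsScalarTower K RP L := IsScalarTower.of_algebraMap_eq fun r => by
    rw [IsScalarTower.algebraMap_apply K R RP, ← IsScalarTower.algebraMap_apply R RP L,
      ← IsScalarTower.algebraMap_apply K R L]
  have hunit : ∀ r : R, r ∣ P → IsUnit (algebraMap R RP r) := fun r hr =>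
    isUnit_of_dvd_unit (map_dvd _ hr) (IsLocalization.Away.algebraMap_isUnit P)
  have hint : ∀ (r : R) (z : L), r ∣ P → IsIntegral R (r • z) → IsIntegral RP z := by
    intro r z hr hz
    obtain ⟨w, hw⟩ := (hunit r hr).exists_left_inv
    have : z = algebraMap RP L w * (r • z) := by
      rw [Algebra.smul_def, IsScalarTower.algebraMap_apply R RP L, ← mul_assoc, ← map_mul, hw,
        map_one, one_mul]
    rw [this]
    exact isIntegral_algebraMap.mul hz.tower_top
  have hdvd : ∀ j, a j * a' j ∣ P := fun j => Finset.dvd_prod_of_mem _ (Finset.mem_univ j)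
  let G : Set L := Set.range x ∪ Set.range fun j => (x j)⁻¹
  let B : Subalgebra RP L := Algebra.adjoin RP G
  have hBfin : Module.Finite RP B := by
    refine (Module.Finite.iff_fg (N := Subalgebra.toSubmodule B)).mpr
      (fg_adjoin_of_finite ((Set.finite_range _).union (Set.finite_range _)) ?_)
    rintro _ (⟨j, rfl⟩ | ⟨j, rfl⟩)
    · exact hint _ _ ((dvd_mul_right _ _).trans (hdvd j)) (hai j)
    · exact hint _ _ ((dvd_mul_left _ _).trans (hdvd j)) (hai' j)
  let xB : Fin n → B := fun j => ⟨x j, Algebra.subset_adjoin (Or.inl ⟨j, rfl⟩)⟩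
  let yB : Fin n → B := fun j => ⟨(x j)⁻¹, Algebra.subset_adjoin (Or.inr ⟨j, rfl⟩)⟩
  have hxy : ∀ j, xB j * yB j = 1 := fun j => Subtype.ext (mul_inv_cancel₀ (hx0 j))
  let evR : R →ₐ[K] K := MvPolynomial.aeval v
  let ev : RP →ₐ[K] K := IsLocalization.liftAlgHom (M := Submonoid.powers P) (f := evR) (by
    rintro ⟨_, k, rfl⟩
    rw [isUnit_iff_ne_zero, map_pow]
    exact pow_ne_zero _ hv)
  have hev : ∀ c, ev (algebraMap R RP (MvPolynomial.X c)) = v c := by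
    intro c
    have : ev (algebraMap R RP (MvPolynomial.X c)) = evR (MvPolynomial.X c) :=
      IsLocalization.lift_eq _ _
    exact this.trans (MvPolynomial.aeval_X _ _)
  have hmonL : ∀ m : Mon n, algebraMap S L (MvPolynomial.monomial (m.mapDomain Sum.inr) 1) =
      ∏ j, x j ^ m j := by
    intro m
    rw [MvPolynomial.monomial_eq, map_one, one_mul, Finsupp.prod_mapDomain_index_inj
      Sum.inr_injective, Finsupp.prod_fintype _ _ (by simp), map_prod]
    simp [x]
  have hcoe : ∀ m : Mon n, ((∏ j, xB j ^ m j : B) : L) = ∏ j, x j ^ m j := fun m =>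
    (map_prod B.val _ _).trans (Finset.prod_congr rfl fun j _ => map_pow B.val _ _)
  have he : LinearIndependent RP fun m : (∀ i, Fin (N i)) => ∏ j, xB j ^ (m j : ℕ) := by
    refine LinearIndependent.of_comp B.toSubmodule.subtype ?_
    refine LinearIndependent.localization RP (Submonoid.powers P) ?_
    rw [Fintype.linearIndependent_iff]
    intro p hp m
    have h := sum_aeval_genericCoeff_mul_eq_zero (K := K) h₀ h₁ h₁₀ hN p (by
      apply IsFractionRing.injective S L
      rw [map_zero, map_sum, ← hp]
      refine Finset.sum_congr rfl fun m _ => ?_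
      rw [map_mul, hmonL, Algebra.smul_def]
      exact congrArg _ (hcoe (Finsupp.equivFunOnFinite.symm fun i => (m i : ℕ))).symm)
    exact congrFun h m
  have hgen : Algebra.adjoin RP (Set.range xB ∪ Set.range yB) = ⊤ := by
    have h1 : Set.range xB ∪ Set.range yB = B.val ⁻¹' G := by
      ext z
      simp only [Set.mem_union, Set.mem_range, Set.mem_preimage, G]
      exact or_congr (exists_congr fun j => Subtype.ext_iff) (exists_congr fun j => Subtype.ext_iff)
    rw [h1]
    exact Algebra.adjoin_adjoin_coe_preimage
  have hr : ∀ i, ∑ c with ix c = i, algebraMap RP B (algebraMap R RP (MvPolynomial.X c)) *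
      ∏ j, xB j ^ (ex c) j = 0 := by
    intro i
    apply Subtype.ext
    have h4 := congrArg (algebraMap S L) (sum_genericCoeff_mul (K := K) (ex := ex) h₀ i)
    rw [map_sum, map_zero] at h4
    refine Eq.trans ?_ h4
    rw [AddSubmonoidClass.coe_finsetSum]
    refine Finset.sum_congr rfl fun c _ => ?_
    rw [map_mul, hmonL]
    have h5 : algebraMap RP L (algebraMap R RP (MvPolynomial.X c)) =
        algebraMap S L (genericCoeff ix ex c₀ c) := by
      rw [← IsScalarTower.algebraMap_apply R RP L, hRL]
      exact congrArg _ (MvPolynomial.aeval_X _ _)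
    rw [← h5, ← hcoe]
    rfl
  have := exists_quotient_of_finite (K := K) ev xB yB hxy hgen N he ix ex
    (fun c => algebraMap R RP (MvPolynomial.X c)) hr
  simp only [hev] at this
  exact this

end GenericSystem
end
end LatticeFGLM

/-! ### Reduced Gröbner bases -/

namespace LatticeFGLM
noncomputable section

section GroebnerBasis

variable {K : Type*} [Field K] {n : ℕ} {ord : MonomialOrder (Fin n)}
  {I : Ideal (MvPolynomial (Fin n) K)} {B : Set (MvPolynomial (Fin n) K)}

theorem IsReducedGB.ne_zero (h : IsReducedGB ord I B) {g : MvPolynomial (Fin n) K} (hg : g ∈ B) :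
    g ≠ 0 := by
  rintro rfl
  simpa using h.monic 0 hg

theorem IsReducedGB.degree_mem_support (h : IsReducedGB ord I B) {g : MvPolynomial (Fin n) K}
    (hg : g ∈ B) : ord.degree g ∈ g.support :=
  (ord.degree_mem_support_iff g).mpr (h.ne_zero hg)

theorem IsReducedGB.eq_of_degree_le (h : IsReducedGB ord I B) {g g' : MvPolynomial (Fin n) K}
    (hg : g ∈ B) (hg' : g' ∈ B) (hle : ord.degree g ≤ ord.degree g') : g = g' := by
  by_contra hne
  exact h.reduced g hg g' hg' hne _ (h.degree_mem_support hg') hle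

theorem staircase_of_le {s t : Mon n} (hs : s ∈ staircase ord B) (hts : t ≤ s) :
    t ∈ staircase ord B :=
  fun g hg hle => hs g hg (hle.trans hts)

theorem IsReducedGB.mem_staircase_of_lt (h : IsReducedGB ord I B) {g : MvPolynomial (Fin n) K}
    (hg : g ∈ B) {m : Mon n} (hm : m < ord.degree g) : m ∈ staircase ord B := by
  intro g' hg' hle
  have := h.eq_of_degree_le hg' hg (hle.trans hm.le)
  subst this
  exact not_lt_of_ge hle hm

theorem IsReducedGB.mem_staircase_of_mem_support (h : IsReducedGB ord I B)
    {g : MvPolynomial (Fin n) K} (hg : g ∈ B) {m : Mon n} (hm : m ∈ g.support)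
    (hne : m ≠ ord.degree g) : m ∈ staircase ord B := by
  intro g' hg' hle
  by_cases hgg : g' = g
  · subst hgg
    have h1 := ord.toSyn_monotone hle
    have h2 := ord.le_degree hm
    exact hne (ord.toSyn.injective (le_antisymm h2 h1))
  · exact h.reduced g' hg' g hg hgg m hm hle

theorem IsReducedGB.eq_zero_of_support_subset (h : IsReducedGB ord I B)
    {f : MvPolynomial (Fin n) K} (hf : f ∈ I) (hs : (f.support : Set (Mon n)) ⊆ staircase ord B) :
    f = 0 := by
  by_contra hne
  obtain ⟨g, hg, hle⟩ := h.lead_dvd f hf hne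
  exact hs ((ord.degree_mem_support_iff f).mpr hne) g hg hle

theorem IsReducedGB.exists_normalForm (h : IsReducedGB ord I B) (f : MvPolynomial (Fin n) K) :
    ∃ r, f - r ∈ Ideal.span B ∧ (r.support : Set (Mon n)) ⊆ staircase ord B := by
  obtain ⟨g, r, hfr, _, hr⟩ := ord.div_set (B := B)
    (fun b hb => by rw [h.monic b hb]; exact isUnit_one) f
  refine ⟨r, ?_, fun c hc b hb => hr c hc b hb⟩
  rw [hfr, add_sub_cancel_right, Finsupp.linearCombination_apply]
  exact Ideal.sum_mem _ fun b _ => Ideal.mul_mem_left _ _ (Ideal.subset_span b.2)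

theorem IsReducedGB.span_eq (h : IsReducedGB ord I B) : Ideal.span B = I := by
  apply le_antisymm (Ideal.span_le.mpr h.subset)
  intro f hf
  obtain ⟨r, hr, hs⟩ := h.exists_normalForm f
  have hrI : r ∈ I := by
    have := I.sub_mem hf (Ideal.span_le.mpr h.subset hr)
    rwa [sub_sub_cancel] at this
  rw [h.eq_zero_of_support_subset hrI hs, sub_zero] at hr
  exact hr

theorem IsReducedGB.card_staircase_le_finrank (h : IsReducedGB ord I B) (S : Finset (Mon n))
    (hS : (S : Set (Mon n)) ⊆ staircase ord B) [Module.Finite K (MvPolynomial (Fin n) K ⧸ I)] :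
    S.card ≤ Module.finrank K (MvPolynomial (Fin n) K ⧸ I) := by
  have : LinearIndependent K fun s : S =>
      Ideal.Quotient.mkₐ K I (MvPolynomial.monomial s.1 1) := by
    rw [Fintype.linearIndependent_iff]
    intro c hc s
    have h1 : ∑ s : S, MvPolynomial.monomial s.1 (c s) ∈ I := by
      rw [← Ideal.Quotient.eq_zero_iff_mem, ← hc]
      change Ideal.Quotient.mkₐ K I _ = _
      rw [map_sum]
      refine Finset.sum_congr rfl fun s _ => ?_
      rw [← map_smul, MvPolynomial.smul_monomial, smul_eq_mul, mul_one]
    have h2 := h.eq_zero_of_support_subset h1 (by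
      intro m hm
      apply hS
      have := MvPolynomial.support_sum hm
      rw [Finset.mem_biUnion] at this
      obtain ⟨s, -, hs⟩ := this
      have := MvPolynomial.support_monomial_subset hs
      rw [Finset.mem_singleton] at this
      rw [this]
      exact s.2)
    have h3 := congrArg (MvPolynomial.coeff s.1) h2
    rw [MvPolynomial.coeff_sum, Finset.sum_eq_single s] at h3
    · simpa using h3
    · intro b _ hb
      rw [MvPolynomial.coeff_monomial, if_neg]
      exact fun hh => hb (Subtype.ext hh)
    · simp
  simpa using this.fintype_card_le_finrank

end GroebnerBasis

/-! ### G-homogeneous components -/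

section GComponent

variable {K : Type*} [Field K] {n : ℕ} (G : Subgroup (Fin n → Kˣ))

theorem gDegree_zero : gDegree G 0 = 1 := by
  ext g; simp [gDegree]

theorem gDegree_add (m m' : Mon n) : gDegree G (m + m') = gDegree G m * gDegree G m' := by
  ext g
  simp [gDegree, pow_add, Finset.prod_mul_distrib]

theorem inClass_gLattice_iff (a m : Mon n) :
    InClass (gLattice G) a m ↔ gDegree G m = gDegree G a := by
  have key : ∀ g : Fin n → Kˣ, ∏ i, g i ^ ((m i : ℤ) - a i) = 1 ↔
      ∏ i, g i ^ m i = ∏ i, g i ^ a i := by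
    intro g
    simp_rw [zpow_sub, zpow_natCast]
    rw [Finset.prod_mul_distrib, Finset.prod_inv_distrib, mul_inv_eq_one]
  constructor
  · intro h
    ext1 g
    exact (key g.1).mp (h g.1 g.2)
  · intro h g hg
    exact (key g).mpr (DFunLike.congr_fun h ⟨g, hg⟩)

open scoped Classical in
/-- The component of `G`-degree `χ` of a polynomial. -/
def gComponent (χ : G →* Kˣ) (f : MvPolynomial (Fin n) K) : MvPolynomial (Fin n) K :=
  ∑ m ∈ f.support with gDegree G m = χ, MvPolynomial.monomial m (f.coeff m)

open scoped Classical in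
theorem coeff_gComponent (χ : G →* Kˣ) (f : MvPolynomial (Fin n) K) (m : Mon n) :
    (gComponent G χ f).coeff m = if gDegree G m = χ then f.coeff m else 0 := by
  rw [gComponent, MvPolynomial.coeff_sum]
  simp only [MvPolynomial.coeff_monomial, Finset.sum_ite_eq', Finset.mem_filter,
    MvPolynomial.mem_support_iff]
  by_cases h : f.coeff m = 0 <;> simp [h]

theorem gComponent_zero (χ : G →* Kˣ) : gComponent G χ (0 : MvPolynomial (Fin n) K) = 0 := by
  simp [gComponent]

theorem gComponent_add (χ : G →* Kˣ) (f g : MvPolynomial (Fin n) K) :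
    gComponent G χ (f + g) = gComponent G χ f + gComponent G χ g := by
  classical
  ext m
  simp only [coeff_gComponent, MvPolynomial.coeff_add]
  split_ifs <;> simp

theorem gComponent_sub (χ : G →* Kˣ) (f g : MvPolynomial (Fin n) K) :
    gComponent G χ (f - g) = gComponent G χ f - gComponent G χ g := by
  classical
  ext m
  simp only [coeff_gComponent, MvPolynomial.coeff_sub]
  split_ifs <;> simp

theorem gComponent_monomial_mul (χ : G →* Kˣ) (a : Mon n) (c : K) (f : MvPolynomial (Fin n) K) :
    gComponent G χ (MvPolynomial.monomial a c * f) =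
      MvPolynomial.monomial a c * gComponent G (χ / gDegree G a) f := by
  classical
  ext m
  rw [coeff_gComponent, MvPolynomial.coeff_monomial_mul', MvPolynomial.coeff_monomial_mul',
    coeff_gComponent]
  by_cases h : a ≤ m
  · obtain ⟨b, rfl⟩ := exists_add_of_le h
    have h1 : gDegree G a * gDegree G b = χ ↔ gDegree G b = χ / gDegree G a := by
      simp only [MonoidHom.ext_iff, MonoidHom.mul_apply, MonoidHom.div_apply]
      exact forall_congr' fun g => by rw [mul_comm, eq_div_iff_mul_eq']
    rw [if_pos h, if_pos h, add_tsub_cancel_left, gDegree_add, mul_ite, mul_zero]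
    exact if_congr h1 rfl rfl
  · simp [h]

theorem gComponent_of_forall {χ : G →* Kˣ} {f : MvPolynomial (Fin n) K}
    (h : ∀ m ∈ f.support, gDegree G m = χ) (ψ : G →* Kˣ) [Decidable (χ = ψ)] :
    gComponent G ψ f = if χ = ψ then f else 0 := by
  classical
  ext m
  rw [coeff_gComponent]
  by_cases hm : m ∈ f.support
  · rw [h m hm]
    split_ifs <;> simp
  · rw [MvPolynomial.notMem_support_iff.mp hm]
    split_ifs <;> simp [MvPolynomial.notMem_support_iff.mp hm]

variable {G}

/-- An ideal that is generated by `G`-homogeneous polynomials contains the components of its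
elements. -/
theorem gComponent_mem_span {ι : Type*} {f : ι → MvPolynomial (Fin n) K} {χ : ι → (G →* Kˣ)}
    (hf : ∀ i, ∀ m ∈ (f i).support, gDegree G m = χ i) {p : MvPolynomial (Fin n) K}
    (hp : p ∈ Ideal.span (Set.range f)) (ψ : G →* Kˣ) :
    gComponent G ψ p ∈ Ideal.span (Set.range f) := by
  classical
  induction hp using Submodule.span_induction generalizing ψ with
  | mem x h =>
    obtain ⟨i, rfl⟩ := h
    rw [gComponent_of_forall G (hf i)]
    split_ifs
    · exact Ideal.subset_span ⟨i, rfl⟩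
    · exact Ideal.zero_mem _
  | zero => rw [gComponent_zero]; exact Ideal.zero_mem _
  | add x y _ _ hx hy => rw [gComponent_add]; exact Ideal.add_mem _ (hx ψ) (hy ψ)
  | smul a x _ hx =>
    rw [smul_eq_mul]
    induction a using MvPolynomial.induction_on' generalizing ψ with
    | monomial u c => rw [gComponent_monomial_mul]; exact Ideal.mul_mem_left _ _ (hx _)
    | add p q hp hq => rw [add_mul, gComponent_add]; exact Ideal.add_mem _ (hp ψ) (hq ψ)

/-- Subtracting from g its component of the G-degree of the leading monomial leaves an element of I
that no longer contains the leading monomial. Its support lies in the staircase, so it is zero. -/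
theorem IsReducedGB.gDegree_eq {ord : MonomialOrder (Fin n)} {I : Ideal (MvPolynomial (Fin n) K)}
    {B : Set (MvPolynomial (Fin n) K)} (h : IsReducedGB ord I B)
    (hI : ∀ p ∈ I, ∀ ψ, gComponent G ψ p ∈ I) {g : MvPolynomial (Fin n) K} (hg : g ∈ B)
    {m : Mon n} (hm : m ∈ g.support) : gDegree G m = gDegree G (ord.degree g) := by
  classical
  have h1 : g - gComponent G (gDegree G (ord.degree g)) g = 0 := by
    apply h.eq_zero_of_support_subset (I.sub_mem (h.subset g hg) (hI g (h.subset g hg) _))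
    intro m hm
    have hm' : m ∈ (g - gComponent G (gDegree G (ord.degree g)) g).support := hm
    rw [MvPolynomial.mem_support_iff, MvPolynomial.coeff_sub, coeff_gComponent] at hm'
    apply h.mem_staircase_of_mem_support hg
    · rw [MvPolynomial.mem_support_iff]
      intro h0
      simp [h0] at hm'
    · rintro rfl
      simp at hm'
  rw [sub_eq_zero] at h1
  rw [MvPolynomial.mem_support_iff, h1, coeff_gComponent] at hm
  by_contra hne
  exact hm (if_neg hne)

end GComponent

/-! ### Brackets, relations and rank profiles -/

section Relations

variable {K : Type*} [Field K] {n : ℕ} (u : Mon n → K)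

theorem bracket_eq_sum {f : MvPolynomial (Fin n) K} {X : Finset (Mon n)} (h : f.support ⊆ X) :
    bracket u f = ∑ m ∈ X, f.coeff m * u m :=
  Finset.sum_subset h fun m _ hm => by rw [MvPolynomial.notMem_support_iff.mp hm, zero_mul]

theorem bracket_add (f g : MvPolynomial (Fin n) K) :
    bracket u (f + g) = bracket u f + bracket u g := by
  classical
  rw [bracket_eq_sum u (MvPolynomial.support_add (p := f) (q := g)),
    bracket_eq_sum u (Finset.subset_union_left (s₁ := f.support) (s₂ := g.support)),
    bracket_eq_sum u (Finset.subset_union_right (s₁ := f.support) (s₂ := g.support)),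
    ← Finset.sum_add_distrib]
  exact Finset.sum_congr rfl fun m _ => by rw [MvPolynomial.coeff_add, add_mul]

theorem bracket_monomial (m : Mon n) (c : K) :
    bracket u (MvPolynomial.monomial m c) = c * u m := by
  classical
  rw [bracket_eq_sum u MvPolynomial.support_monomial_subset]
  simp

theorem bracket_sum {ι : Type*} (s : Finset ι) (f : ι → MvPolynomial (Fin n) K) :
    bracket u (∑ i ∈ s, f i) = ∑ i ∈ s, bracket u (f i) := by
  classical
  induction s using Finset.induction_on with
  | empty => simp [bracket]
  | insert a s ha ih => rw [Finset.sum_insert ha, Finset.sum_insert ha, bracket_add, ih]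

theorem bracket_smul (c : K) (f : MvPolynomial (Fin n) K) :
    bracket u (c • f) = c * bracket u f := by
  rw [bracket_eq_sum u (MvPolynomial.support_smul (a := c) (f := f)), bracket, Finset.mul_sum]
  exact Finset.sum_congr rfl fun m _ => by rw [MvPolynomial.coeff_smul, smul_eq_mul, mul_assoc]

variable {u}

theorem IsRelation.bracket_mul {f : MvPolynomial (Fin n) K} (h : IsRelation u f)
    (p : MvPolynomial (Fin n) K) : bracket u (f * p) = 0 := by
  induction p using MvPolynomial.induction_on' with
  | monomial m c =>
    have : f * MvPolynomial.monomial m c = c • (f * MvPolynomial.monomial m 1) := by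
      rw [← mul_smul_comm, MvPolynomial.smul_monomial, smul_eq_mul, mul_one]
    rw [this, bracket_smul, h m, mul_zero]
  | add p q hp hq => rw [mul_add, bracket_add, hp, hq, add_zero]

theorem isRelation_of_mem_span {B : Set (MvPolynomial (Fin n) K)} (hB : ∀ g ∈ B, IsRelation u g)
    {f : MvPolynomial (Fin n) K} (hf : f ∈ Ideal.span B) : IsRelation u f := by
  induction hf using Submodule.span_induction with
  | mem x h => exact hB x h
  | zero => intro i; simp [bracket]
  | add x y _ _ hx hy => intro i; rw [add_mul, bracket_add, hx i, hy i, add_zero]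
  | smul a x _ hx =>
    intro i
    rw [smul_eq_mul, mul_comm a, mul_assoc]
    exact hx.bracket_mul _

theorem bracket_relPoly_mul (X : Finset (Mon n)) (g t : Mon n) (γ : Mon n → K) :
    bracket u (relPoly X g γ * MvPolynomial.monomial t 1) =
      u (g + t) + ∑ s ∈ X, γ s * u (s + t) := by
  rw [relPoly, add_mul, Finset.sum_mul, bracket_add, bracket_sum, MvPolynomial.monomial_mul,
    bracket_monomial, mul_one, one_mul]
  congr 1
  exact Finset.sum_congr rfl fun s _ => by rw [MvPolynomial.monomial_mul, bracket_monomial, mul_one]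

theorem solves_iff (X : Finset (Mon n)) (g : Mon n) (γ : Mon n → K) :
    Solves u X g γ ↔ ∀ t ∈ X, bracket u (relPoly X g γ * MvPolynomial.monomial t 1) = 0 := by
  simp only [bracket_relPoly_mul]
  rw [Solves, funext_iff]
  have : ∀ t : X, (hankel u X X).mulVec (fun s => γ s.1) t +
      (hankel u X {g}).col ⟨g, Finset.mem_singleton_self g⟩ t =
      u (g + t) + ∑ s ∈ X, γ s * u (s + t) := by
    intro t
    rw [add_comm, Matrix.mulVec, dotProduct, ← Finset.sum_coe_sort X]
    congr 1
    · simp [hankel, add_comm]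
    · exact Finset.sum_congr rfl fun s _ => by simp [hankel, mul_comm, add_comm]
  constructor
  · intro h t ht
    rw [← this ⟨t, ht⟩]
    exact h ⟨t, ht⟩
  · intro h t
    exact (this t).trans (h t.1 t.2)

theorem Solves.relPoly_eq {Y : Finset (Mon n)} (hdet : IsUnit (hankel u Y Y).det) {g : Mon n}
    {γ γ' : Mon n → K} (h : Solves u Y g γ) (h' : Solves u Y g γ') :
    relPoly Y g γ = relPoly Y g γ' := by
  have h1 := add_right_cancel (h.trans h'.symm)
  have h2 := Matrix.mulVec_injective_of_isUnit
    ((Matrix.isUnit_iff_isUnit_det _).mpr hdet) h1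
  unfold relPoly
  congr 1
  exact Finset.sum_congr rfl fun s hs => by rw [congrFun h2 ⟨s, hs⟩]

/-- A column outside Y is a combination of earlier columns of Y, so it is not in the profile. A
column of Y depends on no earlier columns: they could be replaced by columns of Y, which are
independent already on the rows of Y. -/
theorem rankProfile_eq (ord : MonomialOrder (Fin n)) {X Y : Finset (Mon n)} (hYX : Y ⊆ X)
    (hdet : IsUnit (hankel u Y Y).det)
    (hspan : ∀ c ∈ X, c ∉ Y → ∃ γ : Mon n → K, (∀ s ∈ Y, γ s ≠ 0 → ord.toSyn s < ord.toSyn c) ∧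
      ∀ t ∈ X, u (c + t) = ∑ s ∈ Y, γ s * u (s + t)) :
    rankProfile ord u X = Y := by
  classical
  have hcol : ∀ c : X, c.1 ∉ Y → (hankel u X X).col c ∈ Submodule.span K
      ((hankel u X X).col '' {c' | c'.1 ∈ Y ∧ ord.toSyn c'.1 < ord.toSyn c.1}) := by
    intro c hc
    obtain ⟨γ, h1, h2⟩ := hspan c.1 c.2 hc
    have : (hankel u X X).col c = ∑ s : Y, γ s.1 • (hankel u X X).col ⟨s.1, hYX s.2⟩ := by
      funext t
      have h3 := h2 t.1 t.2
      rw [← Finset.sum_coe_sort] at h3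
      rw [Finset.sum_apply, show (hankel u X X).col c t = u (c.1 + t.1) by simp [hankel, add_comm],
        h3]
      exact Finset.sum_congr rfl fun s _ => by simp [hankel, add_comm]
    rw [this]
    refine Submodule.sum_mem _ fun s _ => ?_
    by_cases h0 : γ s.1 = 0
    · rw [h0, zero_smul]; exact Submodule.zero_mem _
    · exact Submodule.smul_mem _ _ (Submodule.subset_span
        ⟨⟨s.1, hYX s.2⟩, ⟨s.2, h1 s.1 s.2 h0⟩, rfl⟩)
  ext c
  simp only [rankProfile, Finset.mem_map, Finset.mem_filter, Finset.mem_univ, true_and,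
    Function.Embedding.subtype_apply]
  constructor
  · rintro ⟨c, hc, rfl⟩
    by_contra hY
    refine hc (Submodule.span_mono (Set.image_mono ?_) (hcol c hY))
    exact fun c' h => h.2
  · intro hcY
    refine ⟨⟨c, hYX hcY⟩, fun hc => ?_, rfl⟩
    have hle : Submodule.span K ((hankel u X X).col '' {c' | ord.toSyn c'.1 < ord.toSyn c}) ≤
        Submodule.span K ((hankel u X X).col ''
          {c' | c'.1 ∈ Y ∧ ord.toSyn c'.1 < ord.toSyn c}) := by
      rw [Submodule.span_le]
      rintro _ ⟨c', hc', rfl⟩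
      by_cases h : c'.1 ∈ Y
      · exact Submodule.subset_span ⟨c', ⟨h, hc'⟩, rfl⟩
      · refine Submodule.span_mono (Set.image_mono ?_) (hcol c' h)
        exact fun d hd => ⟨hd.1, hd.2.trans hc'⟩
    have h1 := hle hc
    have hind : LinearIndependent K (hankel u Y Y).col := by
      rw [Matrix.linearIndependent_cols_iff_isUnit]
      exact (Matrix.isUnit_iff_isUnit_det _).mpr hdet
    let ρ : (X → K) →ₗ[K] (Y → K) := LinearMap.funLeft K K fun t : Y => (⟨t.1, hYX t.2⟩ : X)
    have h2 := Submodule.mem_map_of_mem (f := ρ) h1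
    rw [Submodule.map_span, ← Set.image_comp] at h2
    have h3 : (hankel u Y Y).col ⟨c, hcY⟩ ∈ Submodule.span K
        ((hankel u Y Y).col '' {s | ord.toSyn s.1 < ord.toSyn c}) := by
      refine Submodule.span_mono ?_ h2
      rintro _ ⟨c', ⟨h, hlt⟩, rfl⟩
      exact ⟨⟨c'.1, h⟩, hlt, rfl⟩
    exact hind.notMem_span_image (lt_irrefl (ord.toSyn c)) h3

end Relations

end
end LatticeFGLM

/-! ### Correctness of the two guessing algorithms -/

namespace LatticeFGLM
noncomputable section

section Output

theorem stabilize_eq {n : ℕ} {T S : Finset (Mon n)} (h : ∀ s ∈ S, ∀ m ≤ s, m ∈ S) :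
    stabilize T S = S := by
  ext m
  simp only [stabilize, Finset.mem_union, Finset.mem_filter]
  refine ⟨?_, Or.inl⟩
  rintro (hm | ⟨_, s, hs, hms⟩)
  · exact hm
  · exact h s hs m hms

variable {K : Type*} [Field K] {n : ℕ} {ord : MonomialOrder (Fin n)}
  {I : Ideal (MvPolynomial (Fin n) K)} {B : Set (MvPolynomial (Fin n) K)} {S T : Finset (Mon n)}
  {u : Mon n → K}

theorem degree_notMem_staircase {g : MvPolynomial (Fin n) K} (hg : g ∈ B) :
    ord.degree g ∉ staircase ord B :=
  fun h => h g hg le_rfl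

theorem IsReducedGB.mem_selected_iff (hB : IsReducedGB ord I B)
    (hS : (S : Set (Mon n)) = staircase ord B)
    (hT : (T : Set (Mon n)) = staircase ord B ∪ leadMons ord B) (m : Mon n) :
    m ∈ selected T S ↔ ∃ g ∈ B, ord.degree g = m := by
  classical
  have hmS : ∀ m, m ∈ S ↔ m ∈ staircase ord B := fun m => by rw [← hS, Finset.mem_coe]
  have hmT : ∀ m, m ∈ T ↔ m ∈ staircase ord B ∨ ∃ g ∈ B, ord.degree g = m := fun m => by
    rw [← Finset.mem_coe, hT]; rfl
  have hTS : ∀ m, m ∈ T \ S ↔ ∃ g ∈ B, ord.degree g = m := fun m => by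
    rw [Finset.mem_sdiff, hmS, hmT]
    constructor
    · exact fun h => h.1.resolve_left h.2
    · rintro ⟨g, hg, rfl⟩
      exact ⟨Or.inr ⟨g, hg, rfl⟩, degree_notMem_staircase hg⟩
  simp only [selected, Finset.mem_filter, hTS]
  refine ⟨And.left, fun h => ⟨h, ?_⟩⟩
  obtain ⟨g, hg, rfl⟩ := h
  rintro _ ⟨g', hg', rfl⟩ hle
  rw [hB.eq_of_degree_le hg' hg hle]

theorem IsReducedGB.relPoly_coeff (hB : IsReducedGB ord I B) {g : MvPolynomial (Fin n) K}
    (hg : g ∈ B) {Y : Finset (Mon n)} (hY : ∀ m ∈ g.support, m ≠ ord.degree g → m ∈ Y)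
    (hgY : ord.degree g ∉ Y) : relPoly Y (ord.degree g) (fun s => g.coeff s) = g := by
  classical
  ext m
  rw [relPoly, MvPolynomial.coeff_add, MvPolynomial.coeff_sum]
  simp only [MvPolynomial.coeff_monomial, Finset.sum_ite_eq']
  by_cases hm : m = ord.degree g
  · subst hm
    rw [if_pos rfl, if_neg hgY, add_zero]
    exact (hB.monic g hg).symm
  · rw [if_neg (Ne.symm hm), zero_add]
    split_ifs with h
    · rfl
    · by_contra hne
      exact h (hY m (MvPolynomial.mem_support_iff.mpr (Ne.symm hne)) hm)

theorem IsReducedGB.relPoly_eq (hB : IsReducedGB ord I B) (hu : ∀ f ∈ I, IsRelation u f)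
    {g : MvPolynomial (Fin n) K} (hg : g ∈ B) {Y : Finset (Mon n)}
    (hdet : IsUnit (hankel u Y Y).det) (hY : ∀ m ∈ g.support, m ≠ ord.degree g → m ∈ Y)
    (hgY : ord.degree g ∉ Y) {γ : Mon n → K} (hγ : Solves u Y (ord.degree g) γ) :
    relPoly Y (ord.degree g) γ = g := by
  rw [hγ.relPoly_eq hdet (γ' := fun s => g.coeff s), hB.relPoly_coeff hg hY hgY]
  rw [solves_iff, hB.relPoly_coeff hg hY hgY]
  exact fun t _ => hu g (hB.subset g hg) t

/-- The basis element with leading monomial c expresses the column of c by the columns of its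
smaller monomials. -/
theorem IsReducedGB.rankProfile_eq (hB : IsReducedGB ord I B) (hu : ∀ f ∈ I, IsRelation u f)
    {X Y : Finset (Mon n)} (hYX : Y ⊆ X) (hdet : IsUnit (hankel u Y Y).det)
    (h : ∀ c ∈ X, c ∉ Y → ∃ g ∈ B, ord.degree g = c ∧ ∀ m ∈ g.support, m ≠ c → m ∈ Y) :
    rankProfile ord u X = Y := by
  refine LatticeFGLM.rankProfile_eq ord hYX hdet fun c _ hcY => ?_
  obtain ⟨g, hg, rfl, hgY⟩ := h c ‹_› hcY
  refine ⟨fun s => -g.coeff s, fun s hs hne => ?_, fun t _ => ?_⟩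
  · refine lt_of_le_of_ne (ord.le_degree (MvPolynomial.mem_support_iff.mpr (neg_ne_zero.mp hne))) ?_
    intro heq
    exact hcY (ord.toSyn.injective heq ▸ hs)
  · have h1 := hu g (hB.subset g hg) t
    rw [← hB.relPoly_coeff hg hgY hcY, bracket_relPoly_mul] at h1
    rw [eq_neg_of_add_eq_zero_left h1, ← Finset.sum_neg_distrib]
    exact Finset.sum_congr rfl fun s _ => by ring

/-- A kernel vector is a polynomial supported on S that is orthogonal to S. It turns out to be a
relation, so it lies in I, and an element of I supported on the staircase is zero. -/
theorem IsReducedGB.isUnit_det_hankel (hB : IsReducedGB ord I B) (hu : ∀ f ∈ I, IsRelation u f)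
    (hS : (S : Set (Mon n)) = staircase ord B) (hI : ∀ f, IsRelation u f → f ∈ I) :
    IsUnit (hankel u S S).det := by
  rw [← Matrix.isUnit_iff_isUnit_det, ← Matrix.mulVec_injective_iff_isUnit,
    ← Matrix.coe_mulVecLin, injective_iff_map_eq_zero]
  intro c hc
  let f : MvPolynomial (Fin n) K := ∑ s : S, MvPolynomial.monomial s.1 (c s)
  have hfS : ∀ m ∈ f.support, m ∈ S := by
    classical
    intro m hm
    have := MvPolynomial.support_sum hm
    rw [Finset.mem_biUnion] at this
    obtain ⟨s, -, hs⟩ := this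
    have := MvPolynomial.support_monomial_subset hs
    rw [Finset.mem_singleton] at this
    exact this ▸ s.2
  have h1 : ∀ t : S, bracket u (f * MvPolynomial.monomial t.1 1) = 0 := by
    intro t
    have h2 : (hankel u S S).mulVecLin c t = 0 := congrFun hc t
    simp only [f, Finset.sum_mul, bracket_sum, MvPolynomial.monomial_mul, bracket_monomial]
    rw [← h2, Matrix.mulVecLin_apply, Matrix.mulVec, dotProduct]
    exact Finset.sum_congr rfl fun s _ => by simp [hankel, mul_comm, add_comm]
  have h2 : IsRelation u f := by
    intro i
    -- Any test monomial may be replaced by its normal form: the difference lies in I and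
    -- contributes nothing to the bracket.
    obtain ⟨r, hr, hrs⟩ := hB.exists_normalForm (MvPolynomial.monomial i 1)
    rw [hB.span_eq] at hr
    have h3 : f * MvPolynomial.monomial i 1 =
        (MvPolynomial.monomial i 1 - r) * f + f * r := by ring
    rw [h3, bracket_add, (hu _ hr).bracket_mul, zero_add]
    conv_lhs => rw [r.as_sum, Finset.mul_sum, bracket_sum]
    refine Finset.sum_eq_zero fun m hm => ?_
    have hmS : m ∈ S := by rw [← Finset.mem_coe, hS]; exact hrs hm
    have : f * MvPolynomial.monomial m (r.coeff m) =
        r.coeff m • (f * MvPolynomial.monomial m 1) := by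
      rw [← mul_smul_comm, MvPolynomial.smul_monomial, smul_eq_mul, mul_one]
    rw [this, bracket_smul, h1 ⟨m, hmS⟩, mul_zero]
  have h4 := hB.eq_zero_of_support_subset (hI f h2) fun m hm => hS ▸ hfS m hm
  funext s
  have h5 := congrArg (MvPolynomial.coeff s.1) h4
  simp only [f, MvPolynomial.coeff_sum, MvPolynomial.coeff_monomial] at h5
  rw [Finset.sum_eq_single s] at h5
  · simpa using h5
  · exact fun b _ hb => if_neg fun hh => hb (Subtype.ext hh)
  · simp

theorem IsReducedGB.scalar_output_eq (hB : IsReducedGB ord I B) (hu : ∀ f ∈ I, IsRelation u f)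
    (hS : (S : Set (Mon n)) = staircase ord B)
    (hT : (T : Set (Mon n)) = staircase ord B ∪ leadMons ord B)
    (hI : ∀ f, IsRelation u f → f ∈ I) {R : Set (MvPolynomial (Fin n) K)}
    (hR : IsScalarFGLMOutput ord u T R) : R = B := by
  have hmS : ∀ m, m ∈ S ↔ m ∈ staircase ord B := fun m => by rw [← hS, Finset.mem_coe]
  have hdet := hB.isUnit_det_hankel hu hS hI
  have hST : S ⊆ T := by
    rw [← Finset.coe_subset, hS, hT]
    exact Set.subset_union_left
  have hsup : ∀ g ∈ B, ∀ m ∈ g.support, m ≠ ord.degree g → m ∈ S := fun g hg m hm hne =>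
    (hmS m).mpr (hB.mem_staircase_of_mem_support hg hm hne)
  have hnS : ∀ g ∈ B, ord.degree g ∉ S := fun g hg h => degree_notMem_staircase hg ((hmS _).mp h)
  have hrp : rankProfile ord u T = S := by
    refine hB.rankProfile_eq hu hST hdet fun c hc hcS => ?_
    rw [← Finset.mem_coe, hT] at hc
    obtain ⟨g, hg, rfl⟩ := hc.resolve_left fun h => hcS ((hmS c).mpr h)
    exact ⟨g, hg, rfl, hsup g hg⟩
  have hst : stabilize T S = S := stabilize_eq fun s hs m hms =>
    (hmS m).mpr (staircase_of_le ((hmS s).mp hs) hms)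
  obtain ⟨γ, hγ, rfl⟩ := hR
  simp only [hrp, hst] at hγ ⊢
  ext p
  simp only [Set.mem_ofPred_eq, hB.mem_selected_iff hS hT] at hγ ⊢
  constructor
  · rintro ⟨_, ⟨g, hg, rfl⟩, rfl⟩
    rw [hB.relPoly_eq hu hg hdet (hsup g hg) (hnS g hg) (hγ _ ⟨g, hg, rfl⟩)]
    exact hg
  · intro hp
    exact ⟨_, ⟨p, hp, rfl⟩,
      (hB.relPoly_eq hu hp hdet (hsup p hp) (hnS p hp) (hγ _ ⟨p, hp, rfl⟩)).symm⟩

theorem IsFundamentalDomain.exists_inClass {Λ : AddSubgroup (Fin n → ℤ)} {A : Finset (Mon n)}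
    (hA : IsFundamentalDomain Λ A) (m : Mon n) : ∃ a ∈ A, InClass Λ a m := by
  obtain ⟨a, ha, -⟩ := hA.2 fun i => (m i : ℤ)
  exact ⟨a, ha.1, ha.2⟩

theorem mem_part {Λ : AddSubgroup (Fin n → ℤ)} {T : Finset (Mon n)} {a m : Mon n} :
    m ∈ part Λ T a ↔ m ∈ T ∧ InClass Λ a m := by
  simp [part]

theorem IsReducedGB.lattice_output_eq (hB : IsReducedGB ord I B) (hu : ∀ f ∈ I, IsRelation u f)
    (hS : (S : Set (Mon n)) = staircase ord B)
    (hT : (T : Set (Mon n)) = staircase ord B ∪ leadMons ord B) {G : Subgroup (Fin n → Kˣ)}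
    (hI : ∀ p ∈ I, ∀ ψ, gComponent G ψ p ∈ I) {A : Finset (Mon n)}
    (hA : IsFundamentalDomain (gLattice G) A)
    (hdet : ∀ a ∈ A, IsUnit (hankel u (insert 0 (part (gLattice G) S a))
      (insert 0 (part (gLattice G) S a))).det) {R : Set (MvPolynomial (Fin n) K)}
    (hR : IsLatticeFGLMOutput ord (gLattice G) A u T R) : R = B := by
  classical
  have hmS : ∀ m, m ∈ S ↔ m ∈ staircase ord B := fun m => by rw [← hS, Finset.mem_coe]
  have hST : S ⊆ T := by
    rw [← Finset.coe_subset, hS, hT]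
    exact Set.subset_union_left
  -- An empty staircase would mean 1 ∈ I, hence a zero table and a zero Hankel matrix on the
  -- nonempty set {1} ∪ S_0. So adding 1 to a block does not leave S.
  have h0S : 0 ∈ S := by
    by_contra h0
    rw [hmS] at h0
    simp only [staircase, Set.mem_ofPred_eq, not_forall, not_not] at h0
    obtain ⟨g, hg, hle⟩ := h0
    have hg0 : ord.degree g = 0 := le_antisymm hle _root_.zero_le
    have hg1 : g = 1 := by
      rw [ord.eq_C_of_degree_eq_zero hg0, hB.monic g hg, map_one]
    have hu0 : ∀ t, u t = 0 := by
      intro t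
      have := hu g (hB.subset g hg) t
      rwa [hg1, one_mul, bracket_monomial, one_mul] at this
    have h1 := hdet 0 hA.1
    have hz : hankel u (insert 0 (part (gLattice G) S 0))
        (insert 0 (part (gLattice G) S 0)) = 0 := by
      ext x y; simp [hankel, hu0]
    have : Nonempty ↥(insert 0 (part (gLattice G) S 0)) := ⟨⟨0, Finset.mem_insert_self _ _⟩⟩
    rw [hz, Matrix.det_zero] at h1
    exact not_isUnit_zero h1
  have hsup : ∀ g ∈ B, ∀ a, InClass (gLattice G) a (ord.degree g) → ∀ m ∈ g.support,
      m ≠ ord.degree g → m ∈ insert 0 (part (gLattice G) S a) := by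
    intro g hg a ha m hm hne
    rw [inClass_gLattice_iff] at ha
    refine Finset.mem_insert_of_mem (mem_part.mpr
      ⟨(hmS m).mpr (hB.mem_staircase_of_mem_support hg hm hne), ?_⟩)
    rw [inClass_gLattice_iff, hB.gDegree_eq hI hg hm, ha]
  have hYS : ∀ a, insert 0 (part (gLattice G) S a) ⊆ S := fun a =>
    Finset.insert_subset h0S (Finset.filter_subset _ _)
  have hnS : ∀ g ∈ B, ∀ a, ord.degree g ∉ insert 0 (part (gLattice G) S a) := fun g hg a h =>
    degree_notMem_staircase hg ((hmS _).mp (hYS a h))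
  have hrp : ∀ a ∈ A, rankProfile ord u (insert 0 (part (gLattice G) T a)) =
      insert 0 (part (gLattice G) S a) := by
    intro a ha
    refine hB.rankProfile_eq hu (Finset.insert_subset_insert _ (Finset.filter_subset_filter _ hST))
      (hdet a ha) fun c hc hcY => ?_
    rw [Finset.mem_insert, not_or] at hcY
    have hc1 := mem_part.mp (Finset.mem_of_mem_insert_of_ne hc hcY.1)
    have hcT := hc1.1
    rw [← Finset.mem_coe, hT] at hcT
    obtain ⟨g, hg, rfl⟩ := hcT.resolve_left fun h => hcY.2 (mem_part.mpr ⟨(hmS c).mpr h, hc1.2⟩)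
    exact ⟨g, hg, rfl, hsup g hg a hc1.2⟩
  have hun : A.biUnion (fun a => rankProfile ord u (insert 0 (part (gLattice G) T a))) = S := by
    rw [Finset.biUnion_congr rfl hrp]
    refine Finset.Subset.antisymm (Finset.biUnion_subset.mpr fun a _ => hYS a) fun s hs => ?_
    obtain ⟨a, ha, hsa⟩ := hA.exists_inClass s
    exact Finset.mem_biUnion.mpr ⟨a, ha, Finset.mem_insert_of_mem (mem_part.mpr ⟨hs, hsa⟩)⟩
  have hst : stabilize T S = S := stabilize_eq fun s hs m hms =>
    (hmS m).mpr (staircase_of_le ((hmS s).mp hs) hms)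
  obtain ⟨γ, hγ, rfl⟩ := hR
  have hun' : stabilize T (A.biUnion fun a =>
      rankProfile ord u (insert 0 (part (gLattice G) T a))) = S := by rw [hun, hst]
  have key : ∀ g ∈ B, ∀ a ∈ A, InClass (gLattice G) a (ord.degree g) →
      relPoly (rankProfile ord u (insert 0 (part (gLattice G) T a))) (ord.degree g)
        (γ (ord.degree g)) = g := by
    intro g hg a ha hga
    have h1 := hγ (ord.degree g) (by
      convert (hB.mem_selected_iff hS hT _).mpr ⟨g, hg, rfl⟩) a ha hga
    beta_reduce at h1
    rw [hrp a ha] at h1 ⊢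
    exact hB.relPoly_eq hu hg (hdet a ha) (hsup g hg a hga) (hnS g hg a) h1
  ext p
  simp only [Set.mem_ofPred_eq]
  have hsel : ∀ m, m ∈ selected T (stabilize T (A.biUnion fun a =>
      rankProfile ord u (insert 0 (part (gLattice G) T a)))) ↔ ∃ g ∈ B, ord.degree g = m := by
    intro m
    rw [hun', hB.mem_selected_iff hS hT]
  constructor
  · rintro ⟨m, hm, a, ha, hma, rfl⟩
    obtain ⟨g, hg, rfl⟩ := (hsel m).mp (by convert hm)
    convert hg
    exact key g hg a ha hma
  · intro hp
    obtain ⟨a, ha, hpa⟩ := hA.exists_inClass (ord.degree p)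
    refine ⟨ord.degree p, ?_, a, ha, hpa, ?_⟩
    · convert (hsel _).mpr ⟨p, hp, rfl⟩
    · convert (key p hp a ha hpa).symm

end Output

end
end LatticeFGLM

/-! ### Characters of a finite diagonal group -/

namespace LatticeFGLM
noncomputable section

section Characters

/-- Distinct characters are linearly independent functions on H (Dedekind). -/
theorem finite_monoidHom_and_card_le (H K : Type*) [CommMonoid H] [Finite H] [Field K] :
    Finite (H →* Kˣ) ∧ Nat.card (H →* Kˣ) ≤ Nat.card H := by
  have := Fintype.ofFinite H
  have hind : LinearIndependent K fun χ : H →* Kˣ => ((Units.coeHom K).comp χ : H → K) := by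
    refine (linearIndependent_monoidHom H K).comp (fun χ : H →* Kˣ => (Units.coeHom K).comp χ) ?_
    intro χ χ' h
    ext x
    exact DFunLike.congr_fun h x
  have hfin : Finite (H →* Kˣ) := hind.finite
  have := Fintype.ofFinite (H →* Kˣ)
  refine ⟨hfin, ?_⟩
  rw [Nat.card_eq_fintype_card, Nat.card_eq_fintype_card,
    ← Module.finrank_fintype_fun_eq_card (η := H) K]
  exact hind.fintype_card_le_finrank

variable {K : Type*} [Field K] {n : ℕ} (G : Subgroup (Fin n → Kˣ))

theorem gDegree_card_smul (m : Mon n) : gDegree G (Nat.card G • m) = 1 := by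
  ext1 g
  have h : g ^ Nat.card G = 1 := pow_card_eq_one'
  have h' : ∀ i, g.1 i ^ Nat.card G = 1 := fun i => congrFun (congrArg Subtype.val h) i
  simp [gDegree, pow_mul, h']

theorem gDegree_add_card_smul (m m' : Mon n) :
    gDegree G (m + Nat.card G • m') = gDegree G m := by
  rw [gDegree_add, gDegree_card_smul]
  ext1 g
  simp

variable [Finite G]

instance finite_characters : Finite (G →* Kˣ) := (finite_monoidHom_and_card_le G K).1

/-- Let M be the group of G-degrees of monomials. Evaluation embeds G into the characters of M,
because the diagonal entries separate elements; so |G| ≤ |Hom(M, Kˣ)| ≤ |M| ≤ |Hom(G, Kˣ)| ≤ |G|,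
and all are equal. -/
theorem card_characters_and_gDegree_surjective :
    Nat.card (G →* Kˣ) = Nat.card G ∧ Function.Surjective (gDegree G) := by
  let φ : Multiplicative (Mon n) →* (G →* Kˣ) :=
    { toFun := fun m => gDegree G m.toAdd
      map_one' := gDegree_zero G
      map_mul' := fun m m' => gDegree_add G m.toAdd m'.toAdd }
  let M := MonoidHom.mrange φ
  let ev : G → (M →* Kˣ) := fun g =>
    { toFun := fun χ => χ.1 g
      map_one' := rfl
      map_mul' := fun _ _ => rfl }
  have hev : Function.Injective ev := by
    intro g h hgh
    apply Subtype.ext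
    funext i
    have := DFunLike.congr_fun hgh
      ⟨gDegree G (Finsupp.single i 1), Multiplicative.ofAdd (Finsupp.single i 1), rfl⟩
    have h2 : gDegree G (Finsupp.single i 1) g = gDegree G (Finsupp.single i 1) h := this
    simpa [gDegree, Finsupp.single_apply, pow_ite, Finset.prod_ite_eq'] using h2
  have h1 := (finite_monoidHom_and_card_le G K).2
  obtain ⟨hfin, h2⟩ := finite_monoidHom_and_card_le M K
  have h3 := Nat.card_le_card_of_injective ev hev
  have h4 := Nat.card_le_card_of_injective (Subtype.val : M → (G →* Kˣ)) Subtype.val_injective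
  refine ⟨by omega, fun χ => ?_⟩
  have h5 := (Nat.bijective_iff_injective_and_card (Subtype.val : M → (G →* Kˣ))).mpr
    ⟨Subtype.val_injective, by omega⟩
  obtain ⟨⟨_, m, rfl⟩, rfl⟩ := h5.2 χ
  exact ⟨m.toAdd, rfl⟩

/-- The G-degree depends only on the exponents modulo |G|. -/
theorem exists_gDegree_eq (χ : G →* Kˣ) :
    ∃ m : Mon n, gDegree G m = χ ∧ m.degree ≤ n * Nat.card G := by
  obtain ⟨m, rfl⟩ := (card_characters_and_gDegree_surjective G).2 χ
  refine ⟨m.mapRange (· % Nat.card G) (Nat.zero_mod _), ?_, ?_⟩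
  · have : m = m.mapRange (· % Nat.card G) (Nat.zero_mod _) +
        Nat.card G • m.mapRange (· / Nat.card G) (Nat.zero_div _) := by
      ext i
      simp [Nat.mod_add_div]
    conv_rhs => rw [this, gDegree_add_card_smul]
  · rw [Finsupp.degree_eq_sum]
    calc _ ≤ ∑ _i : Fin n, Nat.card G := Finset.sum_le_sum fun i _ => by
          simpa using (Nat.mod_lt _ Nat.card_pos).le
      _ = n * Nat.card G := by simp

theorem IsFundamentalDomain.card_eq {A : Finset (Mon n)}
    (hA : IsFundamentalDomain (gLattice G) A) : A.card = Nat.card G := by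
  have hb : Function.Bijective fun a : A => gDegree G a.1 := by
    constructor
    · rintro ⟨a, ha⟩ ⟨b, hb⟩ h
      apply Subtype.ext
      obtain ⟨c, -, hc⟩ := hA.2 fun i => (a i : ℤ)
      exact (hc a ⟨ha, (inClass_gLattice_iff G a a).mpr rfl⟩).trans
        (hc b ⟨hb, (inClass_gLattice_iff G b a).mpr h⟩).symm
    · intro χ
      obtain ⟨m, rfl⟩ := (card_characters_and_gDegree_surjective G).2 χ
      obtain ⟨a, ha, hma⟩ := hA.exists_inClass m
      exact ⟨⟨a, ha⟩, ((inClass_gLattice_iff G a m).mp hma).symm⟩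
  rw [← (card_characters_and_gDegree_surjective G).1, ← Nat.card_eq_of_bijective _ hb]
  simp

instance finite_coeffIndex (d : Fin n → ℕ) (χ : Fin n → (G →* Kˣ)) : Finite (CoeffIndex G d χ) := by
  have : Set.Finite {p : Fin n × Mon n | p.2.degree ≤ d p.1 ∧ gDegree G p.2 = χ p.1} := by
    refine Set.Finite.subset ((Set.finite_univ (α := Fin n)).prod
      (Finsupp.finite_of_degree_le (σ := Fin n) (∑ i, d i))) ?_
    rintro ⟨i, m⟩ ⟨h, -⟩
    exact ⟨trivial, h.trans (Finset.single_le_sum (f := d) (fun _ _ => Nat.zero_le _)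
      (Finset.mem_univ i))⟩
  exact this.to_subtype

end Characters

/-! ### Counting standard monomials and corners -/

section Counting

variable {K : Type*} [Field K] {n : ℕ} {G : Subgroup (Fin n → Kˣ)} [Finite G]

/-- If the variables are units of a quotient `A` of an algebra with a `G`-stable ideal, then the
classes of the standard monomials have at least `dim A / |G|` elements. -/
theorem finrank_le_card_mul_card {ord : MonomialOrder (Fin n)}
    {I : Ideal (MvPolynomial (Fin n) K)} {B : Set (MvPolynomial (Fin n) K)}
    (hB : IsReducedGB ord I B) (hI : ∀ p ∈ I, ∀ ψ, gComponent G ψ p ∈ I) {S : Finset (Mon n)}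
    (hS : (S : Set (Mon n)) = staircase ord B) {A : Type*} [CommRing A] [Algebra K A]
    [Module.Finite K A] (ψ : MvPolynomial (Fin n) K →ₐ[K] A) (hψ : Function.Surjective ψ)
    (hψI : ∀ p ∈ I, ψ p = 0) (hu : ∀ j, IsUnit (ψ (MvPolynomial.X j))) (a : Mon n) :
    Module.finrank K A ≤ Nat.card G * (part (gLattice G) S a).card := by
  classical
  have := Fintype.ofFinite (G →* Kˣ)
  let V : (G →* Kˣ) → Submodule K A := fun χ =>
    Submodule.span K ((fun m => ψ (MvPolynomial.monomial m 1)) '' {m | gDegree G m = χ})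
  have hunit : ∀ m : Mon n, IsUnit (ψ (MvPolynomial.monomial m 1)) := by
    intro m
    rw [MvPolynomial.monomial_eq, map_one, one_mul, Finsupp.prod_fintype _ _ (by simp), map_prod]
    refine (Finset.univ.prod_induction _ IsUnit (fun _ _ => IsUnit.mul) isUnit_one fun j _ => ?_)
    rw [map_pow]
    exact (hu j).pow _
  -- Multiplication by a monomial of G-degree χ'/χ is injective because the variables are units.
  have hle : ∀ χ χ', Module.finrank K (V χ) ≤ Module.finrank K (V χ') := by
    intro χ χ'
    obtain ⟨m, hm⟩ := (card_characters_and_gDegree_surjective G).2 (χ' / χ)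
    let f := LinearMap.mulLeft K (ψ (MvPolynomial.monomial m 1))
    have hf : Function.Injective f := fun x y h => (hunit m).mul_left_cancel h
    rw [(Submodule.equivMapOfInjective f hf _).finrank_eq]
    refine Submodule.finrank_mono ?_
    rw [Submodule.map_span, Submodule.span_le]
    rintro _ ⟨_, ⟨m', hm', rfl⟩, rfl⟩
    refine Submodule.subset_span ⟨m + m', ?_, ?_⟩
    · change gDegree G (m + m') = χ'
      rw [gDegree_add, hm, show gDegree G m' = χ from hm']
      ext1 g
      simp
    · change ψ _ = ψ _ * ψ _
      rw [← map_mul, MvPolynomial.monomial_mul, one_mul]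
  have htop : (⨆ χ, V χ) = ⊤ := by
    rw [eq_top_iff]
    rintro x -
    obtain ⟨p, rfl⟩ := hψ x
    induction p using MvPolynomial.induction_on' with
    | monomial m c =>
      have : MvPolynomial.monomial m c =
          c • (MvPolynomial.monomial m 1 : MvPolynomial (Fin n) K) := by
        rw [MvPolynomial.smul_monomial, smul_eq_mul, mul_one]
      rw [this, map_smul]
      exact Submodule.smul_mem _ _ (Submodule.mem_iSup_of_mem (gDegree G m)
        (Submodule.subset_span ⟨m, rfl, rfl⟩))
    | add p q hp hq => rw [map_add]; exact Submodule.add_mem _ hp hq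
  have hsum : ∀ s : Finset (G →* Kˣ), Module.finrank K (s.sup V : Submodule K A) ≤
      ∑ χ ∈ s, Module.finrank K (V χ) := by
    intro s
    induction s using Finset.induction_on with
    | empty => simp
    | insert χ s hχ ih =>
      rw [Finset.sup_insert, Finset.sum_insert hχ]
      exact (Submodule.finrank_add_le_finrank_add_finrank _ _).trans (Nat.add_le_add_left ih _)
  -- By G-stability of I, the monomial m is congruent to the component of its own G-degree in its
  -- normal form, which involves only standard monomials of the class of a.
  have hV : ∀ m : Mon n, gDegree G m = gDegree G a → ψ (MvPolynomial.monomial m 1) ∈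
      Submodule.span K (((part (gLattice G) S a).image
        fun m => ψ (MvPolynomial.monomial m 1) : Finset A) : Set A) := by
    intro m hm
    obtain ⟨r, hr, hrs⟩ := hB.exists_normalForm (MvPolynomial.monomial m 1)
    rw [hB.span_eq] at hr
    have h1 := hψI _ (hI _ hr (gDegree G a))
    rw [gComponent_sub, map_sub, sub_eq_zero, gComponent_of_forall (χ := gDegree G a), if_pos rfl]
      at h1
    · rw [h1, gComponent, map_sum]
      refine Submodule.sum_mem _ fun s hs => ?_
      rw [Finset.mem_filter] at hs
      have : MvPolynomial.monomial s (r.coeff s) =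
          r.coeff s • (MvPolynomial.monomial s 1 : MvPolynomial (Fin n) K) := by
        rw [MvPolynomial.smul_monomial, smul_eq_mul, mul_one]
      rw [this, map_smul]
      refine Submodule.smul_mem _ _ (Submodule.subset_span ?_)
      rw [Finset.mem_coe, Finset.mem_image]
      refine ⟨s, mem_part.mpr ⟨?_, (inClass_gLattice_iff G a s).mpr hs.2⟩, rfl⟩
      rw [← Finset.mem_coe, hS]
      exact hrs hs.1
    · intro m' hm'
      have := MvPolynomial.support_monomial_subset hm'
      rw [Finset.mem_singleton] at this
      rw [this, hm]
  calc Module.finrank K A = Module.finrank K (⊤ : Submodule K A) := (finrank_top K A).symm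
    _ ≤ ∑ χ, Module.finrank K (V χ) := by
        rw [← htop, ← Finset.sup_univ_eq_iSup]
        exact hsum _
    _ ≤ ∑ _χ : G →* Kˣ, Module.finrank K (V (gDegree G a)) :=
        Finset.sum_le_sum fun χ _ => hle _ _
    _ = Nat.card G * Module.finrank K (V (gDegree G a)) := by
        rw [Finset.sum_const, Finset.card_univ, smul_eq_mul, ← Nat.card_eq_fintype_card,
          (card_characters_and_gDegree_surjective G).1]
    _ ≤ Nat.card G * (part (gLattice G) S a).card := by
        refine Nat.mul_le_mul_left _ ?_
        refine (Submodule.finrank_mono (t := Submodule.span K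
          (((part (gLattice G) S a).image fun m => ψ (MvPolynomial.monomial m 1) : Finset A) :
            Set A)) ?_).trans ((finrank_span_finset_le_card _).trans Finset.card_image_le)
        rw [Submodule.span_le]
        rintro _ ⟨m, hm, rfl⟩
        exact hV m hm

/-- A corner with j-th exponent at least k has k proper divisors in direction j, all in S. Corners
on the same line in direction j are comparable, hence equal, so these divisors are distinct for
fixed j. At most k^n corners have all exponents below k. -/
theorem card_mul_card_antichain_le {k : ℕ} {S L : Finset (Mon n)}
    (hL : ∀ g ∈ L, ∀ h ∈ L, g ≤ h → g = h) (hS : ∀ g ∈ L, ∀ m < g, m ∈ S) :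
    k * L.card ≤ n * S.card + k * k ^ n := by
  classical
  let Lj : Fin n → Finset (Mon n) := fun j => L.filter fun g => k ≤ g j
  let L0 : Finset (Mon n) := L.filter fun g => ∀ j, g j < k
  have h1 : L ⊆ L0 ∪ Finset.univ.biUnion Lj := by
    intro g hg
    by_cases h : ∀ j, g j < k
    · exact Finset.mem_union_left _ (Finset.mem_filter.mpr ⟨hg, h⟩)
    · push Not at h
      obtain ⟨j, hj⟩ := h
      exact Finset.mem_union_right _ (Finset.mem_biUnion.mpr
        ⟨j, Finset.mem_univ j, Finset.mem_filter.mpr ⟨hg, hj⟩⟩)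
  have h0 : L0.card ≤ k ^ n := by
    have : L0.card ≤ (Fintype.piFinset fun _ : Fin n => Finset.range k).card := by
      refine Finset.card_le_card_of_injOn (fun g => (g : Fin n → ℕ)) ?_ ?_
      · intro g hg
        rw [Finset.mem_coe, Finset.mem_filter] at hg
        simpa using hg.2
      · exact fun g _ h _ hgh => DFunLike.coe_injective hgh
    simpa using this
  have hj : ∀ j, k * (Lj j).card ≤ S.card := by
    intro j
    rw [mul_comm, ← Finset.card_range k, ← Finset.card_product]
    refine Finset.card_le_card_of_injOn
      (fun p => p.1 - Finsupp.single j (p.2 + 1)) ?_ ?_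
    · rintro ⟨g, t⟩ hp
      simp only [Finset.coe_product, Set.mem_prod, Finset.mem_coe, Finset.mem_range, Lj,
        Finset.mem_filter] at hp
      refine hS g hp.1.1 _ (lt_of_le_of_ne tsub_le_self fun h => ?_)
      have := DFunLike.congr_fun h j
      simp at this
      omega
    · rintro ⟨g, t⟩ hp ⟨g', t'⟩ hp' h
      simp only [Finset.coe_product, Set.mem_prod, Finset.mem_coe, Finset.mem_range, Lj,
        Finset.mem_filter] at hp hp'
      have hne : ∀ i, i ≠ j → g i = g' i := by
        intro i hi
        have := DFunLike.congr_fun h i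
        simpa [Finsupp.single_apply, Ne.symm hi] using this
      have hjj : g j - (t + 1) = g' j - (t' + 1) := by
        have := DFunLike.congr_fun h j
        simpa using this
      have hgg : g = g' := by
        rcases le_total (g j) (g' j) with hle | hle
        · exact hL g hp.1.1 g' hp'.1.1 fun i => by
            by_cases hi : i = j
            · subst hi; exact hle
            · exact (hne i hi).le
        · exact (hL g' hp'.1.1 g hp.1.1 fun i => by
            by_cases hi : i = j
            · subst hi; exact hle
            · exact (hne i hi).ge).symm
      subst hgg
      have : t = t' := by omega
      rw [this]
  calc k * L.card ≤ k * (L0.card + ∑ j, (Lj j).card) :=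
        Nat.mul_le_mul_left _ ((Finset.card_le_card h1).trans ((Finset.card_union_le _ _).trans
          (Nat.add_le_add_left Finset.card_biUnion_le _)))
    _ = k * L0.card + ∑ j, k * (Lj j).card := by rw [mul_add, Finset.mul_sum]
    _ ≤ k * k ^ n + ∑ _j : Fin n, S.card :=
        Nat.add_le_add (Nat.mul_le_mul_left _ h0) (Finset.sum_le_sum fun j _ => hj j)
    _ = n * S.card + k * k ^ n := by simp [add_comm]

end Counting

end
end LatticeFGLM

/-! ### Equidistribution of the blocks -/

namespace LatticeFGLM
noncomputable section

section Equidistribution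

/-- Lower bounds on all the other parts, together with the total, bound each part from above. -/
theorem abs_sub_div_card_le {α : Type*} (A : Finset α) (t : α → ℝ) {T δ ε : ℝ} (hT : 0 ≤ T)
    (hsum : ∑ a ∈ A, t a = T) (hδ : 0 ≤ δ) (hδε : δ * A.card ≤ ε)
    (ht : ∀ a ∈ A, (1 - δ) * (T / A.card) ≤ t a) :
    ∀ a ∈ A, |t a - T / A.card| ≤ ε * (T / A.card) := by
  classical
  intro a ha
  have hq : (1 : ℝ) ≤ A.card := by
    exact_mod_cast Finset.card_pos.mpr ⟨a, ha⟩
  have h0 : 0 ≤ T / A.card := by positivity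
  have hT' : T = A.card * (T / A.card) := by field_simp
  have h1 : ∑ b ∈ A.erase a, (1 - δ) * (T / A.card) ≤ ∑ b ∈ A.erase a, t b :=
    Finset.sum_le_sum fun b hb => ht b (Finset.mem_of_mem_erase hb)
  rw [Finset.sum_const, Finset.card_erase_of_mem ha, nsmul_eq_mul,
    Nat.cast_sub (Finset.card_pos.mpr ⟨a, ha⟩), Nat.cast_one] at h1
  have h2 := Finset.add_sum_erase A t ha
  have h3 := mul_le_mul_of_nonneg_right hδε h0
  have h4 : δ ≤ δ * A.card := le_mul_of_one_le_right hδ hq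
  have h5 := mul_le_mul_of_nonneg_right h4 h0
  rw [abs_le]
  constructor
  · linarith [ht a ha]
  · nlinarith [ht a ha, mul_nonneg hδ h0]

variable {K : Type*} [Field K] {n : ℕ} {G : Subgroup (Fin n → Kˣ)}

theorem zero_mem_of_coe_eq {ord : MonomialOrder (Fin n)} {B : Set (MvPolynomial (Fin n) K)}
    {T : Finset (Mon n)} (hT : (T : Set (Mon n)) = staircase ord B ∪ leadMons ord B) : 0 ∈ T := by
  rw [← Finset.mem_coe, hT]
  by_cases h : (0 : Mon n) ∈ staircase ord B
  · exact Or.inl h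
  · simp only [staircase, Set.mem_ofPred_eq, not_forall, not_not] at h
    obtain ⟨g, hg, hle⟩ := h
    exact Or.inr ⟨g, hg, le_antisymm hle _root_.zero_le⟩

theorem IsFundamentalDomain.sum_card_part {Λ : AddSubgroup (Fin n → ℤ)} {A : Finset (Mon n)}
    (hA : IsFundamentalDomain Λ A) (T : Finset (Mon n)) :
    ∑ a ∈ A, (part Λ T a).card = T.card := by
  classical
  rw [← Finset.card_biUnion]
  · congr 1
    ext m
    rw [Finset.mem_biUnion]
    constructor
    · rintro ⟨a, -, hm⟩
      exact (mem_part.mp hm).1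
    · intro hm
      obtain ⟨a, ha, hma⟩ := hA.exists_inClass m
      exact ⟨a, ha, mem_part.mpr ⟨hm, hma⟩⟩
  · intro a ha b hb hab
    rw [Function.onFun, Finset.disjoint_left]
    intro m hma hmb
    obtain ⟨c, -, hc⟩ := hA.2 fun i => (m i : ℤ)
    exact hab ((hc a ⟨ha, (mem_part.mp hma).2⟩).trans (hc b ⟨hb, (mem_part.mp hmb).2⟩).symm)

theorem sum_monomial_coeffs [Finite G] {d : Fin n → ℕ} {χ : Fin n → (G →* Kˣ)}
    {f : Fin n → MvPolynomial (Fin n) K} (hf : IsGSystem G d χ f) [Fintype (CoeffIndex G d χ)]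
    [DecidableEq (Fin n)] (i : Fin n) :
    ∑ c : CoeffIndex G d χ with c.1.1 = i, MvPolynomial.monomial c.1.2 (coeffs f c) = f i := by
  classical
  ext m
  rw [MvPolynomial.coeff_sum]
  simp only [MvPolynomial.coeff_monomial]
  by_cases hm : m ∈ (f i).support
  · let c : CoeffIndex G d χ := ⟨(i, m), (MvPolynomial.le_totalDegree hm).trans (hf i).1,
      (hf i).2 m hm⟩
    rw [Finset.sum_eq_single c]
    · rw [if_pos rfl]; rfl
    · intro b hb hbc
      rw [if_neg]
      intro hbm
      exact hbc (Subtype.ext (Prod.ext (Finset.mem_filter.mp hb).2 hbm))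
    · intro hc
      exact (hc (Finset.mem_filter.mpr ⟨Finset.mem_univ _, rfl⟩)).elim
  · rw [MvPolynomial.notMem_support_iff.mp hm]
    refine Finset.sum_eq_zero fun c hc => ?_
    rw [Finset.mem_filter] at hc
    split_ifs with h
    · subst h
      rw [coeffs, hc.2, MvPolynomial.notMem_support_iff.mp hm]
    · rfl

/-- For a generic `G`-homogeneous system, each class of standard monomials has at least
`∏ i, N i / |G|` elements, where `N i` is a multiple of `|G|` that is close to `d i`. -/
theorem exists_generic_prod_le_card_part [Finite G] (d N : Fin n → ℕ) (hN : ∀ i, 0 < N i)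
    (hG : ∀ i, Nat.card G ∣ N i) (hd : ∀ i, n * Nat.card G + N i ≤ d i) (χ : Fin n → (G →* Kˣ)) :
    ∃ P : MvPolynomial (CoeffIndex G d χ) K, P ≠ 0 ∧
      ∀ f : Fin n → MvPolynomial (Fin n) K, IsGSystem G d χ f →
        MvPolynomial.eval (coeffs f) P ≠ 0 →
      ∀ (ord : MonomialOrder (Fin n)) (B : Set (MvPolynomial (Fin n) K)),
        IsReducedGB ord (Ideal.span (Set.range f)) B →
      ∀ S : Finset (Mon n), (S : Set (Mon n)) = staircase ord B → ∀ a,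
        ∏ i, N i ≤ Nat.card G * (part (gLattice G) S a).card := by
  classical
  have := Fintype.ofFinite (CoeffIndex G d χ)
  choose a ha hadeg using fun i => exists_gDegree_eq G (χ i)
  have hN' : ∀ i, gDegree G (a i + Finsupp.single i (N i)) = χ i := by
    intro i
    obtain ⟨k, hk⟩ := hG i
    rw [hk, ← smul_eq_mul, ← Finsupp.smul_single, gDegree_add_card_smul, ha]
  -- Both monomials of equation i have G-degree χ_i: a_i by choice, and a_i + N_i e_i because |G|
  -- divides N_i. The degree of a_i accounts for the margin n |G|.
  let c₀ : Fin n → CoeffIndex G d χ := fun i =>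
    ⟨(i, a i), (hadeg i).trans ((Nat.le_add_right _ _).trans (hd i)), ha i⟩
  let c₁ : Fin n → CoeffIndex G d χ := fun i =>
    ⟨(i, a i + Finsupp.single i (N i)), by
      rw [map_add, Finsupp.degree_single]
      exact (Nat.add_le_add_right (hadeg i) _).trans (hd i), hN' i⟩
  obtain ⟨P, hP, h⟩ := exists_generic_quotient (K := K) (C := CoeffIndex G d χ)
    (fun c => c.1.1) (fun c => c.1.2) c₀ c₁ N (fun _ => rfl) (fun _ => rfl) (fun _ => rfl) hN
  refine ⟨P, hP, fun f hf hfP ord B hB S hS b => ?_⟩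
  obtain ⟨A, _, _, ψ, hfin, hsurj, hunit, hzero, hle⟩ := h _ hfP
  simp only [sum_monomial_coeffs hf] at hzero
  refine hle.trans (finrank_le_card_mul_card hB
    (fun p hp => gComponent_mem_span (fun i => (hf i).2) hp) hS ψ hsurj ?_ hunit b)
  intro p hp
  have : Ideal.span (Set.range f) ≤ RingHom.ker ψ := by
    rw [Ideal.span_le]
    rintro _ ⟨i, rfl⟩
    exact hzero i
  exact this hp

theorem exists_generic_card_part (n : ℕ) (G : Subgroup (Fin n → Kˣ)) [Finite G] {ε : ℝ}
    (hε : 0 < ε) :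
    ∃ d₀ : ℕ, ∀ d : Fin n → ℕ, (∀ i, d₀ ≤ d i) → ∀ χ : Fin n → (G →* Kˣ),
      ∃ P : MvPolynomial (CoeffIndex G d χ) K, P ≠ 0 ∧
        ∀ f : Fin n → MvPolynomial (Fin n) K, IsGSystem G d χ f →
          MvPolynomial.eval (coeffs f) P ≠ 0 →
        Module.Finite K (MvPolynomial (Fin n) K ⧸ Ideal.span (Set.range f)) →
        ∀ (ord : MonomialOrder (Fin n)) (B : Set (MvPolynomial (Fin n) K)),
          IsReducedGB ord (Ideal.span (Set.range f)) B →
        ∀ S T : Finset (Mon n), (S : Set (Mon n)) = staircase ord B →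
          (T : Set (Mon n)) = staircase ord B ∪ leadMons ord B →
        ∀ A : Finset (Mon n), IsFundamentalDomain (gLattice G) A → Nat.card G ≤ T.card ∧
          ∀ a ∈ A, |((part (gLattice G) T a).card : ℝ) - (T.card : ℝ) / Nat.card G| ≤
            ε * ((T.card : ℝ) / Nat.card G) := by
  classical
  let q := Nat.card G
  have hq : 0 < q := Nat.card_pos
  have hqR : (0 : ℝ) < q := by exact_mod_cast hq
  -- The trivial group is treated apart; this includes n = 0, where the degrees give no control on
  -- D.
  rcases (Nat.succ_le_of_lt hq).eq_or_lt with hq1 | hq2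
  · refine ⟨0, fun d _ χ => ⟨1, one_ne_zero, fun f _ _ _ ord B _ S T _ hT A hA => ?_⟩⟩
    have hAc := hA.card_eq
    have hsum := hA.sum_card_part T
    have hq1' : Nat.card G = 1 := hq1.symm
    refine ⟨hq1' ▸ Finset.card_pos.mpr ⟨0, zero_mem_of_coe_eq hT⟩, fun a ha => ?_⟩
    obtain ⟨b, rfl⟩ := Finset.card_eq_one.mp (hAc.trans hq1')
    rw [Finset.mem_singleton] at ha
    subst ha
    rw [Finset.sum_singleton] at hsum
    rw [hsum, hq1', Nat.cast_one, div_one, sub_self, abs_zero]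
    positivity
  have hn : 0 < n := by
    by_contra h0
    have : n = 0 := by omega
    subst this
    have : q ≤ 1 := by
      have : Subsingleton G := inferInstance
      exact Finite.card_le_one_iff_subsingleton.mpr this
    omega
  have hnR : (0 : ℝ) < n := by exact_mod_cast hn
  -- The final lower bound on blocks loses a factor 1 - 2δ, and passing to a two-sided bound
  -- multiplies 2δ by the number q of blocks.
  let δ : ℝ := min (1 / 2) (ε / (2 * q))
  have hδ : 0 < δ := by positivity
  have hδ1 : δ ≤ 1 / 2 := min_le_left _ _
  have hδ2 : 2 * δ * q ≤ ε := by
    have := min_le_right (1 / 2) (ε / (2 * q))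
    rw [le_div_iff₀ (by positivity)] at this
    linarith
  -- With k fixed so that n/k ≤ δ/2, the bound d1 makes (n+1)q at most (δ/n) d_i, and d2 makes k^n
  -- at most (δ/2) D.
  obtain ⟨k, hk⟩ := exists_nat_ge (2 * n / δ)
  have hk0 : (0 : ℝ) < k := lt_of_lt_of_le (by positivity) hk
  obtain ⟨d1, hd1⟩ := exists_nat_ge (n * ((n + 1) * q) / δ)
  obtain ⟨d2, hd2⟩ := exists_nat_ge (2 * (k : ℝ) ^ n / δ)
  refine ⟨max d1 (max d2 ((n + 1) * q)), fun d hd χ => ?_⟩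
  -- The largest multiple of q that leaves the margin nq; it differs from d_i by at most (n+1)q.
  let N : Fin n → ℕ := fun i => q * ((d i - n * q) / q)
  have hdq : ∀ i, (n + 1) * q ≤ d i := fun i =>
    (le_max_right _ _).trans ((le_max_right _ _).trans (hd i))
  have hNle : ∀ i, n * q + N i ≤ d i := fun i => by
    have h1 := Nat.mul_div_le (d i - n * q) q
    have h2 := hdq i
    rw [add_mul] at h2
    simp only [N]
    omega
  have hNge : ∀ i, d i ≤ N i + (n + 1) * q := fun i => by
    have h1 := Nat.div_add_mod (d i - n * q) q
    have h3 := Nat.mod_lt (d i - n * q) hq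
    have h2 := hdq i
    rw [add_mul] at h2 ⊢
    simp only [N]
    omega
  have hN : ∀ i, 0 < N i := fun i => by
    refine Nat.mul_pos hq (Nat.div_pos ?_ hq)
    have h2 := hdq i
    rw [add_mul] at h2
    omega
  obtain ⟨P, hP, h⟩ := exists_generic_prod_le_card_part d N hN (fun i => Dvd.intro _ rfl) hNle χ
  refine ⟨P, hP, fun f hf hfP hfin ord B hB S T hS hT A hA => ?_⟩
  have hlow := h f hf hfP ord B hB S hS
  have hAc := hA.card_eq
  have hsum := hA.sum_card_part T
  have hST : S ⊆ T := by
    rw [← Finset.coe_subset, hS, hT]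
    exact Set.subset_union_left
  let D : ℕ := ∏ i, d i
  have hdpos : ∀ i, 0 < d i := fun i => lt_of_lt_of_le (by positivity) (hdq i)
  have hSD : S.card ≤ D := (hB.card_staircase_le_finrank S hS.le).trans
    (finrank_quotient_le_prod f d hdpos (fun i => (hf i).1) hfin)
  have hD2 : d2 ≤ D := by
    refine (le_max_left d2 _).trans ((le_max_right _ _).trans ((hd ⟨0, hn⟩).trans ?_))
    exact Finset.single_le_prod' (f := d) (fun i _ => hdpos i) (Finset.mem_univ _)
  have hmS : ∀ m, m ∈ S ↔ m ∈ staircase ord B := fun m => by rw [← hS, Finset.mem_coe]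
  have hL : ∀ m ∈ T \ S, ∃ g ∈ B, ord.degree g = m := by
    intro m hm
    rw [Finset.mem_sdiff, hmS, ← Finset.mem_coe, hT] at hm
    exact hm.1.resolve_left hm.2
  have hkL := card_mul_card_antichain_le (k := k) (S := S) (L := T \ S)
    (by
      intro m hm m' hm' hle
      obtain ⟨g, hg, rfl⟩ := hL m hm
      obtain ⟨g', hg', rfl⟩ := hL m' hm'
      rw [hB.eq_of_degree_le hg hg' hle])
    (by
      intro m hm m' hlt
      obtain ⟨g, hg, rfl⟩ := hL m hm
      exact (hmS _).mpr (hB.mem_staircase_of_lt hg hlt))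
  have hTcard : T.card = S.card + (T \ S).card := by
    rw [Finset.card_sdiff_of_subset hST, Nat.add_sub_cancel' (Finset.card_le_card hST)]
  have hTD : (T.card : ℝ) ≤ (1 + δ) * D := by
    have h1 : (k : ℝ) * (T \ S).card ≤ n * D + k * (k : ℝ) ^ n := by
      have : k * (T \ S).card ≤ n * D + k * k ^ n :=
        hkL.trans (Nat.add_le_add_right (Nat.mul_le_mul_left _ hSD) _)
      exact_mod_cast this
    have h2 : (n : ℝ) ≤ k * (δ / 2) := by
      rw [div_le_iff₀ hδ] at hk
      linarith
    have h3 : (k : ℝ) ^ n ≤ D * (δ / 2) := by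
      rw [div_le_iff₀ hδ] at hd2
      have : (d2 : ℝ) ≤ D := by exact_mod_cast hD2
      nlinarith
    have h4 : (k : ℝ) * (T \ S).card ≤ k * (δ * D) := by
      have h5 := mul_le_mul_of_nonneg_right h2 (Nat.cast_nonneg D : (0 : ℝ) ≤ D)
      have h6 := mul_le_mul_of_nonneg_left h3 hk0.le
      linarith
    have h5 := le_of_mul_le_mul_left h4 hk0
    have h6 : (S.card : ℝ) ≤ D := by exact_mod_cast hSD
    rw [hTcard, Nat.cast_add]
    linarith
  -- Each factor loses at most a proportion δ/n, and Bernoulli's inequality bounds the loss in the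
  -- product.
  have hND : (1 - δ) * (D : ℝ) ≤ ∏ i, (N i : ℝ) := by
    by_cases hx : (d1 : ℝ) = 0
    · rw [hx] at hd1
      exact absurd hd1 (not_le.mpr (by positivity))
    have hd1pos : (0 : ℝ) < d1 := lt_of_le_of_ne (Nat.cast_nonneg _) (Ne.symm hx)
    let x : ℝ := δ / n
    have hx0 : 0 ≤ x := by positivity
    have hx1 : x ≤ 1 := by
      rw [div_le_one hnR]
      have : (1 : ℝ) ≤ n := by exact_mod_cast hn
      linarith
    have h1 : ∀ i, (1 - x) * (d i : ℝ) ≤ N i := by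
      intro i
      have h2 : ((n : ℝ) + 1) * q ≤ x * d i := by
        have h3 : (d1 : ℝ) ≤ d i := by exact_mod_cast (le_max_left _ _).trans (hd i)
        have h4 := hd1.trans h3
        rw [div_le_iff₀ hδ] at h4
        rw [div_mul_eq_mul_div, le_div_iff₀ hnR]
        linarith
      have h5 : (d i : ℝ) ≤ N i + (n + 1) * q := by exact_mod_cast hNge i
      linarith
    calc (1 - δ) * (D : ℝ) ≤ (1 - x) ^ n * D := by
          refine mul_le_mul_of_nonneg_right ?_ (Nat.cast_nonneg _)
          have h6 := one_add_mul_le_pow (a := -x) (by linarith) n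
          have h7 : (n : ℝ) * x = δ := by simp only [x]; field_simp
          calc 1 - δ = 1 + n * -x := by rw [← h7]; ring
            _ ≤ (1 + -x) ^ n := h6
            _ = (1 - x) ^ n := by rw [sub_eq_add_neg]
      _ = ∏ i, (1 - x) * (d i : ℝ) := by
          rw [Finset.prod_mul_distrib]
          simp [D]
      _ ≤ ∏ i, (N i : ℝ) := Finset.prod_le_prod
          (fun i _ => mul_nonneg (by linarith) (Nat.cast_nonneg _)) fun i _ => h1 i
  have hlowT : ∀ a, ∏ i, N i ≤ q * (part (gLattice G) T a).card := fun a =>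
    (hlow a).trans (Nat.mul_le_mul_left _ (Finset.card_le_card (Finset.filter_subset_filter _ hST)))
  have hpos : ∀ a, 1 ≤ (part (gLattice G) T a).card := by
    intro a
    by_contra h0
    have h1 := hlowT a
    have h2 : 0 < ∏ i, N i := Finset.prod_pos fun i _ => hN i
    rw [show (part (gLattice G) T a).card = 0 by omega] at h1
    omega
  constructor
  · rw [← hAc, ← hsum, Finset.card_eq_sum_ones]
    exact Finset.sum_le_sum fun a _ => hpos a
  · rw [← hAc]
    refine abs_sub_div_card_le A (fun a => ((part (gLattice G) T a).card : ℝ)) (δ := 2 * δ)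
      (Nat.cast_nonneg _) (by exact_mod_cast hsum) (by positivity) (by rw [hAc]; exact hδ2) ?_
    intro a _
    rw [hAc, ← mul_div_assoc, div_le_iff₀ hqR]
    have h1 : (∏ i, (N i : ℝ)) ≤ q * (part (gLattice G) T a).card := by exact_mod_cast hlowT a
    -- Here (1 - 2δ)(1 + δ) = 1 - δ - 2δ² ≤ 1 - δ, which compares #T with ∏ N_i.
    have h2 : (1 - 2 * δ) * (T.card : ℝ) ≤ (1 - 2 * δ) * ((1 + δ) * D) :=
      mul_le_mul_of_nonneg_left hTD (by linarith)
    have h3 : 0 ≤ (δ + 2 * δ ^ 2) * (D : ℝ) - δ * D := by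
      have : (δ + 2 * δ ^ 2) * (D : ℝ) - δ * D = 2 * δ ^ 2 * D := by ring
      rw [this]
      positivity
    nlinarith
end Equidistribution

end
end LatticeFGLM

/-! ### Composition of programs and their costs -/

namespace LatticeFGLM
noncomputable section

section Composition

variable {K ι ι₁ β β' γ γ' : Type*}

/-- The address map of a program that is run after other instructions, after one more register is
filled. -/
def extendAddr {k m : ℕ} (σ : ι₁ ⊕ Fin k → ι ⊕ Fin m) : ι₁ ⊕ Fin (k + 1) → ι ⊕ Fin (m + 1) :=
  Sum.elim (fun i => (σ (Sum.inl i)).map id Fin.castSucc)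
    (Fin.snoc (α := fun _ => ι ⊕ Fin (m + 1)) (fun j => (σ (Sum.inr j)).map id Fin.castSucc)
      (Sum.inr (Fin.last m)))

/-- Run a program after other instructions, its addresses being translated by `σ`. -/
def Program.transplant : {k : ℕ} → Program K ι₁ β γ k → {m : ℕ} →
    (ι₁ ⊕ Fin k → ι ⊕ Fin m) → Program K ι β γ m
  | _, .halt l out, _, σ => .halt l (σ ∘ out)
  | _, .const c next, _, σ => .const c (next.transplant (extendAddr σ))
  | _, .op o a b next, _, σ => .op o (σ a) (σ b) (next.transplant (extendAddr σ))
  | _, .test a p q, _, σ => .test (σ a) (p.transplant σ) (q.transplant σ)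

/-- Run a program, then another one, which depends on the label that the first one returns, and
has access to the input and to the output of the first one. -/
def Program.bind : {m : ℕ} → Program K ι β γ m → (γ → Program K (ι ⊕ β) β' γ' 0) →
    Program K ι β' γ' m
  | _, .halt l out, q => (q l).transplant (Sum.elim (Sum.elim Sum.inl out) Fin.elim0)
  | _, .const c next, q => .const c (next.bind q)
  | _, .op o a b next, q => .op o a b (next.bind q)
  | _, .test a p p', q => .test a (p.bind q) (p'.bind q)

theorem elim_extendAddr {x : ι → K} {x₁ : ι₁ → K} {k m : ℕ} {r : Fin m → K} {r₁ : Fin k → K}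
    {σ : ι₁ ⊕ Fin k → ι ⊕ Fin m} (h : ∀ a, Sum.elim x r (σ a) = Sum.elim x₁ r₁ a) (v : K)
    (a : ι₁ ⊕ Fin (k + 1)) :
    Sum.elim x (Fin.snoc (α := fun _ => K) r v) (extendAddr σ a) =
      Sum.elim x₁ (Fin.snoc (α := fun _ => K) r₁ v) a := by
  have key : ∀ a : ι ⊕ Fin m, Sum.elim x (Fin.snoc (α := fun _ => K) r v)
      (a.map id Fin.castSucc) = Sum.elim x r a := by
    rintro (i | j) <;> simp
  rcases a with i | j
  · simp only [extendAddr, Sum.elim_inl, key, h]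
  · refine Fin.lastCases ?_ (fun j => ?_) j
    · simp [extendAddr]
    · simp only [extendAddr, Sum.elim_inr, Fin.snoc_castSucc, key, h]

variable [Field K]

/-- Translating addresses is free: the cost agrees as well as the result. -/
theorem Program.run_transplant {x : ι → K} {x₁ : ι₁ → K} {k : ℕ} (p : Program K ι₁ β γ k) :
    ∀ {m : ℕ} {r : Fin m → K} {r₁ : Fin k → K} {σ : ι₁ ⊕ Fin k → ι ⊕ Fin m},
      (∀ a, Sum.elim x r (σ a) = Sum.elim x₁ r₁ a) → (p.transplant σ).run x r = p.run x₁ r₁ := by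
  induction p with
  | halt l out => intro m r r₁ σ h; simp [Program.transplant, Program.run, h]
  | const c next ih =>
    intro m r r₁ σ h
    simp only [Program.transplant, Program.run]
    rw [ih (elim_extendAddr h c)]
  | op o a b next ih =>
    intro m r r₁ σ h
    simp only [Program.transplant, Program.run, h]
    rw [ih (elim_extendAddr h _)]
  | test a p q ihp ihq =>
    intro m r r₁ σ h
    simp only [Program.transplant, Program.run]
    rw [ihp h, ihq h]
    by_cases h0 : Sum.elim x₁ r₁ a = 0
    · rw [if_pos h0, if_pos ((h a).trans h0)]
    · rw [if_neg h0, if_neg fun h1 => h0 ((h a).symm.trans h1)]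

theorem Program.run_bind (x : ι → K) (q : γ → Program K (ι ⊕ β) β' γ' 0) {m : ℕ}
    (p : Program K ι β γ m) : ∀ r : Fin m → K, (p.bind q).run x r =
      (((q (p.run x r).1.1).run (Sum.elim x (p.run x r).1.2) Fin.elim0).1,
        (p.run x r).2 + ((q (p.run x r).1.1).run (Sum.elim x (p.run x r).1.2) Fin.elim0).2) := by
  induction p with
  | halt l out =>
    intro r
    simp only [Program.bind, Program.run, zero_add]
    rw [Program.run_transplant]
    rintro ((i | b) | j)
    · rfl
    · rfl
    · exact j.elim0
  | const c next ih => intro r; simp only [Program.bind, Program.run, ih]; ring_nf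
  | op o a b next ih => intro r; simp only [Program.bind, Program.run, ih]; ring_nf
  | test a p p' ihp ihp' =>
    intro r
    simp only [Program.bind, Program.run, ihp, ihp']
    split_ifs <;> ring_nf

/-- Some program satisfies the specification `F` (a relation between the input, the label, and the
output) at a cost of at most `c`. -/
def Computes (c : ℝ) (F : (ι → K) → γ → (β → K) → Prop) : Prop :=
  ∃ p : Program K ι β γ 0, ∀ x, F x (p.result x).1 (p.result x).2 ∧ (p.cost x : ℝ) ≤ c

theorem Computes.mono {c c' : ℝ} {F F' : (ι → K) → γ → (β → K) → Prop} (h : Computes c F)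
    (hc : c ≤ c') (hF : ∀ x l y, F x l y → F' x l y) : Computes c' F' := by
  obtain ⟨p, hp⟩ := h
  exact ⟨p, fun x => ⟨hF _ _ _ (hp x).1, (hp x).2.trans hc⟩⟩

theorem computes_halt (l : γ) (σ : β → ι) :
    Computes (K := K) 0 fun x l' y => l' = l ∧ y = fun b => x (σ b) :=
  ⟨.halt l fun b => Sum.inl (σ b), fun x => ⟨⟨rfl, rfl⟩, by simp [Program.cost, Program.run]⟩⟩

/-- The choice of the second program may depend on the discrete label, but on the field elements
only through its own tests. This is how a rank profile steers later instructions. -/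
theorem Computes.bind {c c' : ℝ} {F : (ι → K) → γ → (β → K) → Prop}
    {F' : γ → (ι ⊕ β → K) → γ' → (β' → K) → Prop} (h : Computes c F)
    (h' : ∀ l, Computes c' (F' l)) :
    Computes (c + c') fun x l' z => ∃ l y, F x l y ∧ F' l (Sum.elim x y) l' z := by
  obtain ⟨p, hp⟩ := h
  choose q hq using h'
  refine ⟨p.bind q, fun x => ⟨⟨_, _, (hp x).1, ?_⟩, ?_⟩⟩
  · have := (hq (p.result x).1 (Sum.elim x (p.result x).2)).1
    unfold Program.result at this ⊢
    rw [Program.run_bind]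
    exact this
  · have := (hq (p.result x).1 (Sum.elim x (p.result x).2)).2
    have h2 := (hp x).2
    unfold Program.result Program.cost at *
    rw [Program.run_bind]
    push_cast
    exact add_le_add h2 this

/-- Change the label and select the output among the input and the output. -/
theorem Computes.map {c : ℝ} {F : (ι → K) → γ → (β → K) → Prop} (h : Computes c F)
    (f : γ → γ') (σ : γ → β' → ι ⊕ β) :
    Computes c fun x l' z => ∃ l y, F x l y ∧ l' = f l ∧ z = fun b => Sum.elim x y (σ l b) := by
  have := h.bind fun l => computes_halt (K := K) (f l) (σ l)
  rwa [add_zero] at this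

/-- Select the input. -/
theorem Computes.comap {c : ℝ} {F : (ι₁ → K) → γ → (β → K) → Prop} (h : Computes c F)
    (σ : ι₁ → ι) : Computes c fun x l y => F (fun i => x (σ i)) l y := by
  obtain ⟨p, hp⟩ := h
  refine ⟨p.transplant (Sum.elim (fun i => Sum.inl (σ i)) Fin.elim0), fun x => ?_⟩
  have h := hp fun i => x (σ i)
  unfold Program.result Program.cost at *
  rw [Program.run_transplant (x₁ := fun i => x (σ i)) (r₁ := Fin.elim0)]
  · exact h
  · rintro (i | j)
    · rfl
    · exact j.elim0

theorem computes_test {c : ℝ} {F F' : (ι → K) → γ → (β → K) → Prop} (a : ι) (h : Computes c F)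
    (h' : Computes c F') :
    Computes (c + 1) fun x l y => x a = 0 ∧ F x l y ∨ x a ≠ 0 ∧ F' x l y := by
  obtain ⟨p, hp⟩ := h
  obtain ⟨q, hq⟩ := h'
  refine ⟨.test (Sum.inl a) p q, fun x => ?_⟩
  have h1 := hp x
  have h2 := hq x
  unfold Program.result Program.cost at *
  simp only [Program.run, Sum.elim_inl]
  by_cases hx : x a = 0
  · simp only [hx, if_true, true_and]
    exact ⟨Or.inl h1.1, by push_cast; linarith [h1.2]⟩
  · simp only [hx, if_false]
    exact ⟨Or.inr ⟨hx, h2.1⟩, by push_cast; linarith [h2.2]⟩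

theorem computes_pi_fin {c : ℝ} : ∀ {t : ℕ} {F : Fin t → (ι → K) → γ → (β → K) → Prop},
    (∀ i, Computes c (F i)) → Computes (t * c) fun x (l : Fin t → γ) (y : Fin t × β → K) =>
      ∀ i, F i x (l i) fun b => y (i, b)
  | 0, F, _ => (computes_halt (K := K) (ι := ι) (β := Fin 0 × β) (γ := Fin 0 → γ) Fin.elim0
      fun p => p.1.elim0).mono (by simp) fun x l y _ i => i.elim0
  | t + 1, F, h => by
    have h1 := computes_pi_fin fun i : Fin t => h i.castSucc
    have h2 := h1.bind fun l => ((h (Fin.last t)).comap Sum.inl).map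
      (fun l' => Fin.snoc (α := fun _ => γ) l l')
      (fun _ (p : Fin (t + 1) × β) => Fin.lastCases (motive := fun _ => (ι ⊕ Fin t × β) ⊕ β)
        (Sum.inr p.2) (fun i => Sum.inl (Sum.inr (i, p.2))) p.1)
    refine h2.mono (by push_cast; linarith) ?_
    rintro x l z ⟨l1, y1, h1, l2, y2, h2, rfl, rfl⟩ i
    refine Fin.lastCases ?_ (fun i => ?_) i
    · simpa using h2
    · simpa using h1 i

theorem computes_pi {τ : Type*} [Fintype τ] {c : ℝ} {F : τ → (ι → K) → γ → (β → K) → Prop}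
    (h : ∀ i, Computes c (F i)) :
    Computes (Fintype.card τ * c) fun x (l : τ → γ) (y : τ × β → K) =>
      ∀ i, F i x (l i) fun b => y (i, b) := by
  let e := Fintype.equivFin τ
  refine ((computes_pi_fin fun i => h (e.symm i)).map (fun l i => l (e i))
    (fun _ (p : τ × β) => Sum.inr (e p.1, p.2))).mono le_rfl ?_
  rintro x _ _ ⟨l, y, hy, rfl, rfl⟩ i
  simpa using hy (e i)

end Composition

section Functions

variable {K ι ι₁ β β' : Type*} [Field K]

/-- Some program computes the function `F` at a cost of at most `c`. -/
def FComputes (c : ℝ) (F : (ι → K) → (β → K)) : Prop :=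
  Computes c fun x (_ : Unit) y => y = F x

theorem FComputes.mono {c c' : ℝ} {F : (ι → K) → (β → K)} (h : FComputes c F) (hc : c ≤ c') :
    FComputes c' F :=
  Computes.mono h hc fun _ _ _ h => h

theorem fcomputes_reindex (σ : β → ι) : FComputes (K := K) 0 fun x b => x (σ b) :=
  (computes_halt () σ).mono le_rfl fun _ _ _ h => h.2

theorem FComputes.comp {c c' : ℝ} {F : (ι → K) → (β → K)} {H : (β → K) → (β' → K)}
    (hH : FComputes c' H) (hF : FComputes c F) : FComputes (c + c') fun x => H (F x) := by
  refine (Computes.bind hF fun _ => Computes.comap hH Sum.inr).mono le_rfl ?_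
  rintro x _ z ⟨_, y, rfl, rfl⟩
  rfl

theorem FComputes.pair {c c' : ℝ} {F : (ι → K) → (β → K)} {H : (ι → K) → (β' → K)}
    (hF : FComputes c F) (hH : FComputes c' H) :
    FComputes (c + c') fun x => Sum.elim (F x) (H x) := by
  refine (Computes.bind hF fun _ => (Computes.comap hH Sum.inl).map id
    fun _ => Sum.elim (fun b => Sum.inl (Sum.inr b)) Sum.inr).mono le_rfl ?_
  rintro x _ z ⟨_, y, rfl, _, y', rfl, rfl, rfl⟩
  funext b
  rcases b with b | b <;> rfl

theorem FComputes.pi {τ : Type*} [Fintype τ] {c : ℝ} {F : τ → (ι → K) → (β → K)}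
    (h : ∀ i, FComputes c (F i)) :
    FComputes (Fintype.card τ * c) fun x (p : τ × β) => F p.1 x p.2 := by
  refine ((computes_pi h).map (fun _ => ()) fun _ b => Sum.inr b).mono le_rfl ?_
  rintro x _ _ ⟨l, y, hy, -, rfl⟩
  funext p
  exact congrFun (hy p.1) p.2

theorem fcomputes_const (c : K) : FComputes (ι := ι) (β := β) 1 fun _ _ => c := by
  refine ⟨.const c (.halt () fun _ => Sum.inr 0), fun x => ?_⟩
  simp only [Program.result, Program.cost, Program.run, Sum.elim_inr, Nat.cast_one,
    zero_add, le_refl, and_true]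
  funext b
  exact Fin.snoc_last (α := fun _ => K) (n := 0) c Fin.elim0

theorem fcomputes_op_single (o : FieldOp) (a b : ι) :
    FComputes (K := K) (β := Unit) 1 fun x _ => o.eval (x a) (x b) := by
  refine ⟨.op o (Sum.inl a) (Sum.inl b) (.halt () fun _ => Sum.inr 0), fun x => ?_⟩
  simp only [Program.result, Program.cost, Program.run, Sum.elim_inr, Nat.cast_one,
    zero_add, le_refl, and_true]
  funext b
  exact Fin.snoc_last (α := fun _ => K) (n := 0) _ Fin.elim0

theorem fcomputes_op [Fintype β] (o : FieldOp) (σ τ : β → ι) :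
    FComputes (K := K) (Fintype.card β) fun x b => o.eval (x (σ b)) (x (τ b)) := by
  have h := (fcomputes_reindex (K := K) fun b : β => (b, ())).comp
    (FComputes.pi fun b : β => fcomputes_op_single (K := K) o (σ b) (τ b))
  exact h.mono (by simp)

theorem fcomputes_sum : ∀ (t : ℕ) (σ : Fin t → ι),
    FComputes (K := K) (β := Unit) (t + 1) fun x _ => ∑ i, x (σ i)
  | 0, σ => by simpa using fcomputes_const (K := K) (ι := ι) (β := Unit) 0
  | t + 1, σ => by
    have h1 := fcomputes_sum t fun i => σ i.castSucc
    have h2 := h1.pair (fcomputes_reindex (K := K) fun _ : Unit => σ (Fin.last t))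
    have h3 := (fcomputes_op_single (K := K) .add (Sum.inl ()) (Sum.inr ())).comp h2
    simp only [Sum.elim_inl, Sum.elim_inr, FieldOp.eval] at h3
    simp only [Fin.sum_univ_castSucc]
    exact h3.mono (by push_cast; linarith)

end Functions

end
end LatticeFGLM

/-! ### Products of rectangular matrices -/

namespace LatticeFGLM
noncomputable section

section Matrices

variable {K ι ι₁ μ ν κ : Type*} [Field K]

/-- Two `N × N` matrices can be multiplied at a cost of at most `c * N ^ ω`. -/
def MulBound (K : Type*) [Field K] (c ω : ℝ) : Prop :=
  ∀ N : ℕ, FComputes (c * (N : ℝ) ^ ω)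
    fun (x : (Fin N × Fin N) ⊕ (Fin N × Fin N) → K) (e : Fin N × Fin N) =>
      ∑ k, x (Sum.inl (e.1, k)) * x (Sum.inr (k, e.2))

theorem IsMatMulExponent.exists_mulBound {ω : ℝ} (h : IsMatMulExponent K ω) :
    ∃ c : ℝ, 0 ≤ c ∧ MulBound K c ω := by
  obtain ⟨c, hc⟩ := h
  refine ⟨|c|, abs_nonneg c, fun N => ?_⟩
  obtain ⟨p, hp⟩ := hc N
  refine ⟨p, fun x => ?_⟩
  have h1 := hp (fun i j => x (Sum.inl (i, j))) fun i j => x (Sum.inr (i, j))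
  have h2 : (Sum.elim (fun e : Fin N × Fin N => x (Sum.inl (e.1, e.2)))
      fun e : Fin N × Fin N => x (Sum.inr (e.1, e.2))) = x := by
    funext e
    rcases e with e | e <;> rfl
  rw [h2] at h1
  exact ⟨h1.1, h1.2.trans (mul_le_mul_of_nonneg_right (le_abs_self c)
    (Real.rpow_nonneg (Nat.cast_nonneg N) ω))⟩

/-- There are pqr products of N × N blocks; each entry is then a sum of q terms, started from a
loaded 0. -/
theorem MulBound.block {c ω : ℝ} (h : MulBound K c ω) (N p q r : ℕ) :
    FComputes (p * q * r * (c * (N : ℝ) ^ ω) + p * N * (r * N) * (q + 1))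
      fun (x : ((Fin p × Fin N) × (Fin q × Fin N)) ⊕ ((Fin q × Fin N) × (Fin r × Fin N)) → K)
        (e : (Fin p × Fin N) × (Fin r × Fin N)) =>
        ∑ k, x (Sum.inl (e.1, k)) * x (Sum.inr (k, e.2)) := by
  have h1 := FComputes.pi fun t : Fin p × Fin q × Fin r => (h N).comp
    (fcomputes_reindex (K := K) (Sum.elim
      (fun e => Sum.inl ((t.1, e.1), (t.2.1, e.2)))
      (fun e => Sum.inr ((t.2.1, e.1), (t.2.2, e.2))) :
        _ → ((Fin p × Fin N) × (Fin q × Fin N)) ⊕ ((Fin q × Fin N) × (Fin r × Fin N))))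
  have h2 := FComputes.pi fun t : (Fin p × Fin N) × (Fin r × Fin N) =>
    fcomputes_sum (K := K) q fun k => (((t.1.1, k, t.2.1), (t.1.2, t.2.2)) :
      (Fin p × Fin q × Fin r) × (Fin N × Fin N))
  have h3 := ((fcomputes_reindex (K := K) fun b : (Fin p × Fin N) × (Fin r × Fin N) =>
    (b, ())).comp h2).comp h1
  simp only [Sum.elim_inl, Sum.elim_inr] at h3
  simp only [Fintype.sum_prod_type]
  refine h3.mono (le_of_eq ?_)
  simp only [Fintype.card_prod, Fintype.card_fin]
  push_cast
  ring

/-- The entries of the matrix `X x` can be computed from `x` at a cost of at most `c`. -/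
def MComputes (c : ℝ) (X : (ι → K) → Matrix μ ν K) : Prop :=
  FComputes c fun x (e : μ × ν) => X x e.1 e.2

theorem mcomputes_of (σ : μ → ν → ι) :
    MComputes (K := K) 0 fun x => Matrix.of fun i j => x (σ i j) :=
  fcomputes_reindex fun e : μ × ν => σ e.1 e.2

theorem MComputes.sub [Fintype μ] [Fintype ν] {c c' : ℝ} {X Y : (ι → K) → Matrix μ ν K}
    (hX : MComputes c X) (hY : MComputes c' Y) :
    MComputes (c + c' + Fintype.card μ * Fintype.card ν) fun x => X x - Y x := by
  have h := (fcomputes_op (K := K) .sub (fun e : μ × ν => (Sum.inl e : _ ⊕ (μ × ν)))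
    Sum.inr).comp (hX.pair hY)
  refine FComputes.mono h (le_of_eq ?_)
  rw [Fintype.card_prod]
  push_cast
  ring

theorem MComputes.mul [Fintype μ] [Fintype ν] [Fintype κ] {c₀ ω : ℝ} (hMM : MulBound K c₀ ω)
    (hω : 2 ≤ ω) {c c' : ℝ} {X : (ι → K) → Matrix μ ν K} {Y : (ι → K) → Matrix ν κ K}
    (hX : MComputes c X) (hY : MComputes c' Y) {N p q r : ℕ} (hμ : Fintype.card μ = p * N)
    (hν : Fintype.card ν = q * N) (hκ : Fintype.card κ = r * N) (hq : 0 < q) (hN : 0 < N) :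
    MComputes (c + c' + p * q * r * ((c₀ + 2) * (N : ℝ) ^ ω)) fun x => X x * Y x := by
  have eμ : μ ≃ Fin p × Fin N := Fintype.equivOfCardEq (by simpa using hμ)
  have eν : ν ≃ Fin q × Fin N := Fintype.equivOfCardEq (by simpa using hν)
  have eκ : κ ≃ Fin r × Fin N := Fintype.equivOfCardEq (by simpa using hκ)
  have h1 := (fcomputes_reindex (K := K) fun e : μ × κ => (eμ e.1, eκ e.2)).comp
    ((hMM.block N p q r).comp ((fcomputes_reindex (K := K) (Sum.elim
      (fun e => Sum.inl (eμ.symm e.1, eν.symm e.2))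
      (fun e => Sum.inr (eν.symm e.1, eκ.symm e.2)) :
        _ → (μ × ν) ⊕ (ν × κ))).comp (hX.pair hY)))
  simp only [Sum.elim_inl, Sum.elim_inr, Equiv.symm_apply_apply] at h1
  have h2 : ∀ x (e : μ × κ), (X x * Y x) e.1 e.2 =
      ∑ k, X x e.1 (eν.symm k) * Y x (eν.symm k) e.2 := fun x e => by
    rw [Matrix.mul_apply]
    exact (Equiv.sum_comp eν.symm fun k => X x e.1 k * Y x k e.2).symm
  unfold MComputes
  simp only [h2]
  refine h1.mono ?_
  have h3 : (N : ℝ) ^ 2 ≤ (N : ℝ) ^ ω := by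
    rw [← Real.rpow_natCast]
    exact Real.rpow_le_rpow_of_exponent_le (by exact_mod_cast hN) (by exact_mod_cast hω)
  have h4 : (1 : ℝ) ≤ q := by exact_mod_cast hq
  -- The additions are absorbed in the block products, since ω ≥ 2 and q ≥ 1.
  have h5 : (p : ℝ) * r * (q + 1) * (N : ℝ) ^ 2 ≤ p * r * (2 * q) * (N : ℝ) ^ ω := by
    refine mul_le_mul (mul_le_mul_of_nonneg_left (by linarith) (by positivity)) h3
      (by positivity) (by positivity)
  linarith

end Matrices

end
end LatticeFGLM

/-! ### Elimination by blocks of columns -/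

namespace LatticeFGLM
noncomputable section

section Elimination

variable {K μ ν ν' : Type*} [Field K] [Fintype μ] [Fintype ν] [Fintype ν']

/-- `Q` is the column rank profile of `A`, and `W` is a generalized inverse of `A` whose nonzero
rows have their labels in `Q`. -/
structure IsElimination [LT ν] (A : Matrix μ ν K) (Q : Finset ν) (W : Matrix ν μ K) : Prop where
  mem_iff : ∀ j, j ∈ Q ↔ A.col j ∉ Submodule.span K (A.col '' {j' | j' < j})
  mul_mul : A * W * A = A
  eq_zero : ∀ j, j ∉ Q → ∀ i, W j i = 0

variable [LT ν] [LT ν'] {A : Matrix μ ν' K} (e : ν ⊕ ν ≃ ν')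

/-- Elimination in a matrix `[A₁ A₂]`, from eliminations in `A₁` and in the projection of `A₂`
along the columns of `A₁`. -/
theorem IsElimination.append (hll : ∀ a b, e (Sum.inl a) < e (Sum.inl b) ↔ a < b)
    (hrr : ∀ a b, e (Sum.inr a) < e (Sum.inr b) ↔ a < b)
    (hlr : ∀ a b, e (Sum.inl a) < e (Sum.inr b)) (hrl : ∀ a b, ¬ e (Sum.inr a) < e (Sum.inl b))
    {A₁ A₂ : Matrix μ ν K} (hA₁ : ∀ i j, A₁ i j = A i (e (Sum.inl j)))
    (hA₂ : ∀ i j, A₂ i j = A i (e (Sum.inr j))) {Q₁ Q₂ : Finset ν} {W₁ W₂ : Matrix ν μ K}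
    (h₁ : IsElimination A₁ Q₁ W₁) (h₂ : IsElimination (A₂ - A₁ * (W₁ * A₂)) Q₂ W₂)
    {Y : Matrix ν μ K} (hY : Y = W₂ - W₂ * A₁ * W₁) :
    IsElimination A ((Q₁.disjSum Q₂).map e.toEmbedding)
      (Matrix.of fun j i => Sum.elim (fun j => (W₁ - W₁ * A₂ * Y) j i) (fun j => Y j i)
        (e.symm j)) := by
  classical
  set B := A₂ - A₁ * (W₁ * A₂) with hB
  have hP : A₁ * W₁ * A₁ = A₁ := h₁.mul_mul
  have hc₁ : ∀ j, A.col (e (Sum.inl j)) = A₁.col j := fun j => funext fun i => (hA₁ i j).symm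
  have hc₂ : ∀ j, A.col (e (Sum.inr j)) = A₂.col j := fun j => funext fun i => (hA₂ i j).symm
  have hset₁ : ∀ j, A.col '' {j' | j' < e (Sum.inl j)} = A₁.col '' {j' | j' < j} := by
    intro j
    ext v
    constructor
    · rintro ⟨j', hj', rfl⟩
      obtain ⟨s | s, rfl⟩ := e.surjective j'
      · exact ⟨s, (hll _ _).mp hj', (hc₁ s).symm⟩
      · exact (hrl _ _ hj').elim
    · rintro ⟨s, hs, rfl⟩
      exact ⟨_, (hll _ _).mpr hs, hc₁ s⟩
  have hset₂ : ∀ j, A.col '' {j' | j' < e (Sum.inr j)} =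
      Set.range A₁.col ∪ A₂.col '' {j' | j' < j} := by
    intro j
    ext v
    constructor
    · rintro ⟨j', hj', rfl⟩
      obtain ⟨s | s, rfl⟩ := e.surjective j'
      · exact Or.inl ⟨s, (hc₁ s).symm⟩
      · exact Or.inr ⟨s, (hrr _ _).mp hj', (hc₂ s).symm⟩
    · rintro (⟨s, rfl⟩ | ⟨s, hs, rfl⟩)
      · exact ⟨_, hlr _ _, hc₁ s⟩
      · exact ⟨_, (hrr _ _).mpr hs, hc₂ s⟩
  have hcolmul : ∀ (M : Matrix μ μ K) (C : Matrix μ ν K) j, (M * C).col j = M.mulVec (C.col j) :=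
    fun M C j => funext fun i => rfl
  have hrange : ∀ v, (A₁ * W₁).mulVec v ∈ Submodule.span K (Set.range A₁.col) := by
    intro v
    rw [← Matrix.mulVec_mulVec, ← Matrix.range_mulVecLin]
    exact ⟨W₁.mulVec v, rfl⟩
  have hBcol : ∀ j, B.col j = A₂.col j - (A₁ * W₁).mulVec (A₂.col j) := by
    intro j
    rw [← hcolmul, hB, Matrix.mul_assoc]
    rfl
  have hker : ∀ j, A₁.col j - (A₁ * W₁).mulVec (A₁.col j) = 0 := by
    intro j
    rw [← hcolmul, hP, sub_self]
  have hsum : ∀ (i : μ) (M : Matrix ν' μ K) (k : μ), (A * M) i k =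
      ∑ j, A₁ i j * M (e (Sum.inl j)) k + ∑ j, A₂ i j * M (e (Sum.inr j)) k := by
    intro i M k
    rw [Matrix.mul_apply, ← Equiv.sum_comp e, Fintype.sum_sum_type]
    simp only [hA₁, hA₂]
  set Z := W₁ - W₁ * A₂ * Y with hZ
  set W : Matrix ν' μ K := Matrix.of fun j i => Sum.elim (fun j => Z j i) (fun j => Y j i)
        (e.symm j) with hW
  -- Here Y = W₂ (1 - A₁W₁), so Y A₁ = 0 and Y A₂ = W₂ B. Hence A W fixes A₁, and it fixes A₂ =
  -- A₁W₁A₂ + B because B W₂ B = B.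
  have hAW : A * W = A₁ * W₁ + B * Y := by
    have h3 : A * W = A₁ * Z + A₂ * Y := by
      ext i k
      rw [hsum, Matrix.add_apply, Matrix.mul_apply, Matrix.mul_apply]
      simp [hW]
    rw [h3, hZ, hB]
    simp only [Matrix.mul_sub, Matrix.sub_mul, Matrix.mul_assoc]
    abel
  have hAW₁ : A * W * A₁ = A₁ := by
    have h3 : Y * A₁ = 0 := by
      rw [hY, Matrix.sub_mul, Matrix.mul_assoc W₂ A₁ W₁, Matrix.mul_assoc W₂, hP, sub_self]
    rw [hAW, Matrix.add_mul, hP, Matrix.mul_assoc B, h3, Matrix.mul_zero, add_zero]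
  have hAW₂ : A * W * A₂ = A₂ := by
    have h3 : Y * A₂ = W₂ * B := by
      rw [hY, hB]
      simp only [Matrix.mul_sub, Matrix.sub_mul, Matrix.mul_assoc]
    rw [hAW, Matrix.add_mul, Matrix.mul_assoc B, h3, ← Matrix.mul_assoc, h₂.mul_mul, hB,
      Matrix.mul_assoc]
    abel
  refine ⟨fun j => ?_, ?_, fun j hj i => ?_⟩
  · obtain ⟨s | s, rfl⟩ := e.surjective j
    · rw [hset₁, hc₁, ← h₁.mem_iff]
      simp
    · rw [hset₂, hc₂]
      have : e (Sum.inr s) ∈ (Q₁.disjSum Q₂).map e.toEmbedding ↔ s ∈ Q₂ := by simp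
      -- The projection 1 - A₁W₁ kills the columns of A₁ and changes those of A₂ only by elements of
      -- their span. So dependence on A₁ and earlier columns of A₂ amounts to dependence on earlier
      -- columns of B.
      rw [this, h₂.mem_iff, not_iff_not]
      constructor
      · intro h
        have h3 : Submodule.span K (B.col '' {j' | j' < s}) ≤
            Submodule.span K (Set.range A₁.col ∪ A₂.col '' {j' | j' < s}) := by
          rw [Submodule.span_le]
          rintro _ ⟨t, ht, rfl⟩
          rw [hBcol]
          exact Submodule.sub_mem _ (Submodule.subset_span (Or.inr ⟨t, ht, rfl⟩))
            (Submodule.span_mono Set.subset_union_left (hrange _))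
        have h4 := Submodule.add_mem _ (h3 h)
          (Submodule.span_mono (Set.subset_union_left (t := A₂.col '' {j' | j' < s}))
            (hrange (A₂.col s)))
        rwa [hBcol, sub_add_cancel] at h4
      · intro h
        let E : (μ → K) →ₗ[K] (μ → K) := LinearMap.id - (A₁ * W₁).mulVecLin
        have h3 : Submodule.span K (Set.range A₁.col ∪ A₂.col '' {j' | j' < s}) ≤
            (Submodule.span K (B.col '' {j' | j' < s})).comap E := by
          rw [Submodule.span_le]
          rintro _ (⟨t, rfl⟩ | ⟨t, ht, rfl⟩)
          · have : E (A₁.col t) = 0 := hker t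
            rw [SetLike.mem_coe, Submodule.mem_comap, this]
            exact Submodule.zero_mem _
          · exact Submodule.subset_span ⟨t, ht, hBcol t⟩
        rw [hBcol]
        exact h3 h
  · ext i j
    obtain ⟨s | s, rfl⟩ := e.surjective j
    · rw [← hA₁]
      conv_rhs => rw [← hAW₁]
      simp only [Matrix.mul_apply, hA₁]
    · rw [← hA₂]
      conv_rhs => rw [← hAW₂]
      simp only [Matrix.mul_apply, hA₂]
  · have hY0 : ∀ s ∉ Q₂, Y s i = 0 := by
      intro s hs
      rw [hY, Matrix.mul_assoc, Matrix.sub_apply, Matrix.mul_apply]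
      simp [h₂.eq_zero s hs]
    obtain ⟨s | s, rfl⟩ := e.surjective j
    · have hs : s ∉ Q₁ := by simpa using hj
      simp only [hW, Matrix.of_apply, Equiv.symm_apply_apply, Sum.elim_inl, hZ]
      rw [Matrix.mul_assoc, Matrix.sub_apply, Matrix.mul_apply]
      simp [h₁.eq_zero s hs]
    · have hs : s ∉ Q₂ := by simpa using hj
      simp only [hW, Matrix.of_apply, Equiv.symm_apply_apply, Sum.elim_inr]
      exact hY0 s hs

end Elimination

end
end LatticeFGLM

/-! ### Cost of the recursive elimination -/

namespace LatticeFGLM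
noncomputable section

section EliminationPrograms

theorem FComputes.bind_computes {K ι β β' γ : Type*} [Field K] {c c' : ℝ}
    {F : (ι → K) → (β → K)} {F' : (β → K) → γ → (β' → K) → Prop} (h : FComputes c F)
    (h' : Computes c' F') : Computes (c + c') fun x l y => F' (F x) l y := by
  refine (Computes.bind h fun _ => h'.comap Sum.inr).mono le_rfl ?_
  rintro x l z ⟨_, y, rfl, h⟩
  exact h

variable {K μ ν : Type*} [Field K]

-- A nonzero column has as generalized inverse the row whose only nonzero entry is the inverse of a
-- nonzero entry of the column. Beyond the zero tests, this takes two constants and one division,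
-- whence the 3.
open scoped Classical in
theorem computes_firstNonzero (j₀ : ν) : ∀ l : List μ, Computes (l.length + 3)
    fun (x : μ × ν → K) (Q : Finset ν) (y : ν × μ → K) =>
      ((∀ i ∈ l, x (i, j₀) = 0) ∧ Q = ∅ ∧ y = 0) ∨
        ∃ i ∈ l, x (i, j₀) ≠ 0 ∧ Q = {j₀} ∧ y = fun e => if e.2 = i then (x (i, j₀))⁻¹ else 0
  | [] => by
    refine (Computes.map (fcomputes_const (K := K) (ι := μ × ν) (β := ν × μ) 0)
      (fun _ => (∅ : Finset ν)) fun _ b => Sum.inr b).mono (by norm_num) ?_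
    rintro x _ _ ⟨_, y, rfl, rfl, rfl⟩
    exact Or.inl ⟨by simp, rfl, rfl⟩
  | i :: l => by
    have h : Computes (l.length + 3) fun (x : μ × ν → K) (Q : Finset ν) (y : ν × μ → K) =>
        Q = {j₀} ∧ y = fun e => if e.2 = i then (x (i, j₀))⁻¹ else 0 := by
      have h1 := ((fcomputes_const (K := K) (ι := μ × ν) (β := Unit) 1).pair
        (fcomputes_const (K := K) (ι := μ × ν) (β := Unit) 0)).pair
          (fcomputes_reindex (K := K) fun _ : Unit => (i, j₀))
      have h2 := ((fcomputes_op_single (K := K) .div (Sum.inl (Sum.inl ())) (Sum.inr ())).pair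
        (fcomputes_reindex (K := K) fun _ : Unit =>
          (Sum.inl (Sum.inr ()) : (Unit ⊕ Unit) ⊕ Unit))).comp h1
      refine (Computes.map h2 (fun _ => ({j₀} : Finset ν)) fun _ (b : ν × μ) =>
        Sum.inr (if b.2 = i then Sum.inl () else Sum.inr ())).mono ?_ ?_
      · have : (0 : ℝ) ≤ l.length := Nat.cast_nonneg _
        linarith
      · rintro x _ _ ⟨_, y, rfl, rfl, rfl⟩
        refine ⟨rfl, funext fun b => ?_⟩
        split_ifs <;> simp [FieldOp.eval]
    refine (computes_test (i, j₀) (computes_firstNonzero j₀ l) h).mono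
      (by rw [List.length_cons]; push_cast; linarith) ?_
    rintro x Q y (⟨h0, ⟨h1, h2⟩ | ⟨i', hi', h1⟩⟩ | ⟨h0, h1⟩)
    · exact Or.inl ⟨by simpa [h0] using h1, h2⟩
    · exact Or.inr ⟨i', List.mem_cons_of_mem _ hi', h1⟩
    · exact Or.inr ⟨i, List.mem_cons_self, h0, h1⟩

/-- Elimination in a matrix with a single column. -/
theorem computes_elimination_of_subsingleton [Fintype μ] [Fintype ν] [Preorder ν] [Subsingleton ν]
    (j₀ : ν) : Computes (Fintype.card μ + 3)
      fun (x : μ × ν → K) (Q : Finset ν) (y : ν × μ → K) =>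
        IsElimination (Matrix.of fun i j => x (i, j)) Q (Matrix.of fun j i => y (j, i)) := by
  classical
  refine (computes_firstNonzero j₀ (Finset.univ : Finset μ).toList).mono (by simp) ?_
  have hlt : ∀ j : ν, {j' | j' < j} = ∅ := fun j => Set.eq_empty_of_forall_notMem fun j' h =>
    lt_irrefl j (Subsingleton.elim j' j ▸ h)
  rintro x Q y (⟨h, rfl, rfl⟩ | ⟨i, -, hi, rfl, rfl⟩)
  · have h0 : ∀ i j, x (i, j) = 0 := fun i j =>
      Subsingleton.elim j₀ j ▸ h i (Finset.mem_toList.mpr (Finset.mem_univ _))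
    have hA : (Matrix.of fun i j => x (i, j) : Matrix μ ν K) = 0 := by
      ext i j; exact h0 i j
    refine ⟨fun j => ?_, by rw [hA]; simp, fun j _ i => rfl⟩
    rw [hA, hlt]
    simp only [Finset.notMem_empty, Set.image_empty, Submodule.span_empty, Submodule.mem_bot,
      false_iff, not_not]
    rfl
  · refine ⟨fun j => ?_, ?_, fun j hj => ?_⟩
    · rw [hlt, Set.image_empty, Submodule.span_empty, Submodule.mem_bot, Subsingleton.elim j j₀]
      simp only [Finset.mem_singleton, true_iff]
      exact fun h => hi (congrFun h i)
    · have : (Matrix.of fun (_ : ν) m => if m = i then (x (i, j₀))⁻¹ else 0 : Matrix ν μ K) *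
          (Matrix.of fun i j => x (i, j) : Matrix μ ν K) = 1 := by
        ext j j'
        obtain rfl := Subsingleton.elim j j₀
        obtain rfl := Subsingleton.elim j' j
        simp [Matrix.mul_apply, inv_mul_cancel₀ hi]
      rw [Matrix.mul_assoc, this, Matrix.mul_one]
    · exact (hj (Finset.mem_singleton.mpr (Subsingleton.elim j j₀))).elim

/-- The two halves of `Fin (2 ^ (k + 1))`. -/
def finTwoPowSumEquiv (k : ℕ) : Fin (2 ^ k) ⊕ Fin (2 ^ k) ≃ Fin (2 ^ (k + 1)) :=
  finSumFinEquiv.trans (finCongr (by ring))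

theorem computes_elimination_step [Fintype μ] {c₀ ω : ℝ} (hMM : MulBound K c₀ ω) (hω : 2 ≤ ω)
    {k a : ℕ} (hμ : Fintype.card μ = a * 2 ^ k) (ha : 0 < a) {T : ℝ}
    (h : Computes T fun (x : μ × Fin (2 ^ k) → K) (Q : Finset (Fin (2 ^ k)))
      (y : Fin (2 ^ k) × μ → K) =>
        IsElimination (Matrix.of fun i j => x (i, j)) Q (Matrix.of fun j i => y (j, i))) :
    Computes (2 * T + (8 * (c₀ + 2) + 4) * (a * ((2 ^ k : ℕ) : ℝ) ^ ω))
      fun (x : μ × Fin (2 ^ (k + 1)) → K) (Q : Finset (Fin (2 ^ (k + 1))))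
        (y : Fin (2 ^ (k + 1)) × μ → K) =>
        IsElimination (Matrix.of fun i j => x (i, j)) Q (Matrix.of fun j i => y (j, i)) := by
  let e := finTwoPowSumEquiv k
  let ν := Fin (2 ^ k)
  let ι := μ × Fin (2 ^ (k + 1))
  have hν : Fintype.card ν = 1 * 2 ^ k := by simp [ν]
  have hN : 0 < 2 ^ k := by positivity
  let A₁ : (ι ⊕ ν × μ → K) → Matrix μ ν K := fun x =>
    Matrix.of fun i j => x (Sum.inl (i, e (Sum.inl j)))
  let A₂ : (ι ⊕ ν × μ → K) → Matrix μ ν K := fun x =>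
    Matrix.of fun i j => x (Sum.inl (i, e (Sum.inr j)))
  let W₁ : (ι ⊕ ν × μ → K) → Matrix ν μ K := fun x => Matrix.of fun j i => x (Sum.inr (j, i))
  have hA₁ : MComputes 0 A₁ := mcomputes_of _
  have hA₂ : MComputes 0 A₂ := mcomputes_of _
  have hW₁ : MComputes 0 W₁ := mcomputes_of _
  have hB := hA₂.sub (hA₁.mul hMM hω (hW₁.mul hMM hω hA₂ hν hμ hν ha hN) hμ hν hν one_pos hN)
  let A₁' : ((ι ⊕ ν × μ) ⊕ ν × μ → K) → Matrix μ ν K := fun x =>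
    Matrix.of fun i j => x (Sum.inl (Sum.inl (i, e (Sum.inl j))))
  let A₂' : ((ι ⊕ ν × μ) ⊕ ν × μ → K) → Matrix μ ν K := fun x =>
    Matrix.of fun i j => x (Sum.inl (Sum.inl (i, e (Sum.inr j))))
  let W₁' : ((ι ⊕ ν × μ) ⊕ ν × μ → K) → Matrix ν μ K := fun x =>
    Matrix.of fun j i => x (Sum.inl (Sum.inr (j, i)))
  let W₂' : ((ι ⊕ ν × μ) ⊕ ν × μ → K) → Matrix ν μ K := fun x =>
    Matrix.of fun j i => x (Sum.inr (j, i))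
  have hA₁' : MComputes 0 A₁' := mcomputes_of _
  have hA₂' : MComputes 0 A₂' := mcomputes_of _
  have hW₁' : MComputes 0 W₁' := mcomputes_of _
  have hW₂' : MComputes 0 W₂' := mcomputes_of _
  have hY := hW₂'.sub ((hW₂'.mul hMM hω hA₁' hν hμ hν ha hN).mul hMM hω hW₁' hν hν hμ one_pos hN)
  have hZ := hW₁'.sub ((hW₁'.mul hMM hω hA₂' hν hμ hν ha hN).mul hMM hω hY hν hν hμ one_pos hN)
  have hout := (fcomputes_reindex (K := K) fun b : Fin (2 ^ (k + 1)) × μ =>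
    (Sum.elim (fun j => Sum.inl (j, b.2)) (fun j => Sum.inr (j, b.2)) (e.symm b.1) :
      ν × μ ⊕ ν × μ)).comp (FComputes.pair hZ hY)
  have hall := (h.comap fun p : μ × ν => ((p.1, e (Sum.inl p.2)) : ι)).bind fun Q₁ =>
    (FComputes.bind_computes hB h).bind fun Q₂ =>
      Computes.map hout (fun _ => (Q₁.disjSum Q₂).map e.toEmbedding) fun _ b => Sum.inr b
  refine hall.mono ?_ ?_
  -- There are eight products and four subtractions: B takes two products, Z two more besides Y, and
  -- Y, which is computed twice, two each time.
  · have h2 : ((2 ^ k : ℕ) : ℝ) ^ 2 ≤ ((2 ^ k : ℕ) : ℝ) ^ ω := by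
      rw [← Real.rpow_natCast]
      exact Real.rpow_le_rpow_of_exponent_le (by exact_mod_cast hN) (by exact_mod_cast hω)
    have h3 := mul_le_mul_of_nonneg_left h2 (Nat.cast_nonneg a : (0 : ℝ) ≤ a)
    rw [hμ, hν]
    generalize ((2 ^ k : ℕ) : ℝ) ^ ω = U at h3 ⊢
    push_cast at h3 ⊢
    nlinarith
  · rintro x _ _ ⟨Q₁, y₁, h₁, Q₂, y₂, h₂, _, _, rfl, rfl, rfl⟩
    have hval : ∀ s, (e s).1 = Sum.elim (fun j : ν => j.1) (fun j : ν => 2 ^ k + j.1) s := by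
      rintro (j | j) <;> simp [e, finTwoPowSumEquiv, add_comm]
    have key := IsElimination.append (A := Matrix.of fun i j => x (i, j)) e
      (fun a b => by simp only [Fin.lt_def, hval, Sum.elim_inl])
      (fun a b => by simp only [Fin.lt_def, hval, Sum.elim_inr, Nat.add_lt_add_iff_left])
      (fun a b => by
        simp only [Fin.lt_def, hval, Sum.elim_inl, Sum.elim_inr]
        exact a.2.trans_le (Nat.le_add_right _ _))
      (fun a b => by
        simp only [Fin.lt_def, hval, Sum.elim_inl, Sum.elim_inr]
        have := b.2
        omega)
      (A₁ := A₁ (Sum.elim x y₁)) (A₂ := A₂ (Sum.elim x y₁))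
      (fun _ _ => rfl) (fun _ _ => rfl) h₁ h₂ rfl
    convert key using 1
    ext j i
    simp only [Matrix.of_apply, Sum.elim_inr]
    cases e.symm j <;> rfl

theorem rpow_two_pow (ω : ℝ) (k : ℕ) :
    ((2 ^ k : ℕ) : ℝ) ^ ω = 2 ^ k * ((2 : ℝ) ^ (ω - 1)) ^ k := by
  have h1 : (2 : ℝ) ^ ω = 2 * (2 : ℝ) ^ (ω - 1) := by
    rw [Real.rpow_sub_one two_ne_zero]
    ring
  rw [← mul_pow, ← h1]
  push_cast
  rw [← Real.rpow_natCast, ← Real.rpow_natCast, ← Real.rpow_mul zero_le_two,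
    ← Real.rpow_mul zero_le_two, mul_comm]

/-- The number of rows stays 2^M while the columns are halved. One level of the recursion doubles
the cost and adds a term that grows like t^k with t = 2^(ω-1); since t > 2, this term dominates and
no logarithm appears. -/
theorem exists_computes_elimination {c₀ ω : ℝ} (hMM : MulBound K c₀ ω) (hω : 2 < ω) :
    ∃ E : ℝ, 0 ≤ E ∧ ∀ (μ : Type) [Fintype μ] (M : ℕ), Fintype.card μ = 2 ^ M → ∀ k ≤ M,
      Computes (E * 2 ^ M * ((2 : ℝ) ^ (ω - 1)) ^ k)
        fun (x : μ × Fin (2 ^ k) → K) (Q : Finset (Fin (2 ^ k))) (y : Fin (2 ^ k) × μ → K) =>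
          IsElimination (Matrix.of fun i j => x (i, j)) Q (Matrix.of fun j i => y (j, i)) := by
  let t := (2 : ℝ) ^ (ω - 1)
  have ht : 0 < t - 2 := by
    have : (2 : ℝ) ^ (1 : ℝ) < 2 ^ (ω - 1) :=
      Real.rpow_lt_rpow_of_exponent_lt one_lt_two (by linarith)
    rw [Real.rpow_one] at this
    exact sub_pos.mpr this
  let D := 8 * (c₀ + 2) + 4
  -- The second entry gives 2E + D ≤ E t, the induction step; the 4 covers a single column, where
  -- 2^M + 3 ≤ 4 · 2^M.
  let E := max 4 (D / (t - 2))
  have hE4 : 4 ≤ E := le_max_left _ _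
  have hED : 2 * E + D ≤ E * t := by
    have : D / (t - 2) ≤ E := le_max_right _ _
    rw [div_le_iff₀ ht] at this
    linarith
  refine ⟨E, by linarith, fun μ _ M hμ k => ?_⟩
  induction k with
  | zero =>
    intro _
    have : Subsingleton (Fin (2 ^ 0)) := by rw [pow_zero]; infer_instance
    refine (computes_elimination_of_subsingleton (K := K) (μ := μ)
      (⟨0, by positivity⟩ : Fin (2 ^ 0))).mono ?_ fun _ _ _ h => h
    rw [hμ, pow_zero, mul_one]
    push_cast
    have : (1 : ℝ) ≤ 2 ^ M := one_le_pow₀ one_le_two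
    nlinarith
  | succ k ih =>
    intro hk
    have hμ' : Fintype.card μ = 2 ^ (M - k) * 2 ^ k := by
      rw [hμ, ← pow_add, Nat.sub_add_cancel (by omega)]
    refine (computes_elimination_step hMM hω.le hμ' (by positivity) (ih (by omega))).mono ?_
      fun _ _ _ h => h
    have h1 : ((2 ^ (M - k) : ℕ) : ℝ) * ((2 ^ k : ℕ) : ℝ) ^ ω = 2 ^ M * t ^ k := by
      rw [rpow_two_pow, ← mul_assoc]
      push_cast
      rw [← pow_add, Nat.sub_add_cancel (by omega)]
    rw [h1, pow_succ]
    have h2 := mul_le_mul_of_nonneg_right hED (by positivity : 0 ≤ 2 ^ M * t ^ k)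
    change 2 * (E * 2 ^ M * t ^ k) + D * (2 ^ M * t ^ k) ≤ E * 2 ^ M * (t ^ k * t)
    linarith

end EliminationPrograms

end
end LatticeFGLM

/-! ### Rank profiles and relations of Hankel matrices -/

namespace LatticeFGLM
noncomputable section

section GuessPrograms

variable {K : Type*} [Field K] {n : ℕ}

theorem exists_sorted_enumeration (ord : MonomialOrder (Fin n)) (X : Finset (Mon n)) {m : ℕ}
    (hm : X.card < m) : ∃ (c : Fin m → Mon n) (idx : Mon n → Fin m),
      (∀ i : Fin m, i.1 < X.card → c i ∈ X ∧ idx (c i) = i) ∧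
      (∀ g ∈ X, (idx g).1 < X.card ∧ c (idx g) = g) ∧
      ∀ g ∈ X, ∀ h ∈ X, idx g < idx h ↔ ord.toSyn g < ord.toSyn h := by
  classical
  let Y := X.map ord.toSyn.toEquiv.toEmbedding
  have hY : Y.card = X.card := Finset.card_map _
  let f : Fin X.card ≃o Y := Y.orderIsoOfFin hY
  have hfX : ∀ i, ord.toSyn.symm (f i) ∈ X := by
    intro i
    obtain ⟨g, hg, hgi⟩ := Finset.mem_map.mp (f i).2
    have hgi' : ord.toSyn g = f i := hgi
    rw [← hgi', AddEquiv.symm_apply_apply]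
    exact hg
  have hXY : ∀ g ∈ X, ord.toSyn g ∈ Y := fun g hg => Finset.mem_map.mpr ⟨g, hg, rfl⟩
  let c : Fin m → Mon n := fun i => if h : i.1 < X.card then ord.toSyn.symm (f ⟨i.1, h⟩) else 0
  let idx : Mon n → Fin m := fun g => if h : g ∈ X then
    (f.symm ⟨ord.toSyn g, hXY g h⟩).castLE hm.le else ⟨X.card, hm⟩
  refine ⟨c, idx, fun i hi => ?_, fun g hg => ?_, fun g hg h hh => ?_⟩
  · have hci : c i = ord.toSyn.symm (f ⟨i.1, hi⟩) := dif_pos hi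
    rw [hci]
    refine ⟨hfX _, ?_⟩
    simp only [idx]
    rw [dif_pos (hfX _)]
    simp
  · have hig : idx g = (f.symm ⟨ord.toSyn g, hXY g hg⟩).castLE hm.le := dif_pos hg
    rw [hig]
    refine ⟨(f.symm ⟨ord.toSyn g, hXY g hg⟩).2, ?_⟩
    simp [c]
  · simp only [idx]
    rw [dif_pos hg, dif_pos hh]
    rw [Fin.lt_def, Fin.val_castLE, Fin.val_castLE, ← Fin.lt_def, f.symm.lt_iff_lt]
    rfl

/-- The specification of a program that computes a column rank profile and the relations between
the columns. -/
def IsGuess (ord : MonomialOrder (Fin n)) (X : Finset (Mon n)) (u : Mon n → K)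
    (Q : Finset (Mon n)) (y : Mon n × Mon n → K) : Prop :=
  Q = rankProfile ord u X ∧ (∀ g s, s ∉ Q → y (g, s) = 0) ∧
    ∀ g ∈ X, ∀ t ∈ X, u (g + t) + ∑ s ∈ Q, y (g, s) * u (s + t) = 0

/-- The output of the elimination in a Hankel matrix that is padded by zeros. -/
theorem IsElimination.guess {ord : MonomialOrder (Fin n)} {u : Mon n → K} {X : Finset (Mon n)}
    {m : ℕ} {c : Fin m → Mon n} {idx : Mon n → Fin m}
    (hc : ∀ i : Fin m, i.1 < X.card → c i ∈ X ∧ idx (c i) = i)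
    (hidx : ∀ g ∈ X, (idx g).1 < X.card ∧ c (idx g) = g)
    (hord : ∀ g ∈ X, ∀ h ∈ X, idx g < idx h ↔ ord.toSyn g < ord.toSyn h)
    {A : Matrix (Fin m) (Fin m) K}
    (hA : ∀ i j : Fin m, A i j = if i.1 < X.card ∧ j.1 < X.card then u (c i + c j) else 0)
    {Q : Finset (Fin m)} {W : Matrix (Fin m) (Fin m) K} (h : IsElimination A Q W)
    {y : Mon n × Mon n → K}
    (hy : ∀ g s, y (g, s) = if g ∈ X ∧ s ∈ X then -(W * A) (idx s) (idx g) else 0) :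
    IsGuess ord X u (Q.image c) y := by
  classical
  have hQ : ∀ j ∈ Q, j.1 < X.card := by
    intro j hj
    by_contra hlt
    have h0 : A.col j = 0 := funext fun i => by
      change A i j = 0
      rw [hA, if_neg fun hh => hlt hh.2]
    have := (h.mem_iff j).mp hj
    rw [h0] at this
    exact this (Submodule.zero_mem _)
  -- Extension by zeros is injective and sends Hankel columns to columns of the padded matrix, so it
  -- preserves the column dependences.
  let L : (X → K) →ₗ[K] (Fin m → K) :=
    { toFun := fun v i => if hi : i.1 < X.card then v ⟨c i, (hc i hi).1⟩ else 0
      map_add' := fun v w => funext fun i => by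
        by_cases hi : i.1 < X.card <;> simp [hi]
      map_smul' := fun a v => funext fun i => by
        by_cases hi : i.1 < X.card <;> simp [hi] }
  have hL : Function.Injective L := by
    intro v w hvw
    funext x
    have h1 := congrFun hvw (idx x.1)
    have h2 : ∀ v, L v (idx x.1) = v x := fun v => by
      have h3 := hidx x.1 x.2
      change (if hi : (idx x.1).1 < X.card then v ⟨c (idx x.1), (hc _ hi).1⟩ else 0) = v x
      rw [dif_pos h3.1]
      congr 1
      exact Subtype.ext h3.2
    rwa [h2, h2] at h1
  have hLcol : ∀ x : X, L ((hankel u X X).col x) = A.col (idx x.1) := by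
    intro x
    funext i
    have h3 := hidx x.1 x.2
    change (if hi : i.1 < X.card then u (c i + x.1) else 0) = A i (idx x.1)
    rw [hA, h3.2]
    by_cases hi : i.1 < X.card <;> simp [hi, h3.1]
  have hset : ∀ x : X, A.col '' {j' | j' < idx x.1} =
      L '' ((hankel u X X).col '' {c' | ord.toSyn c'.1 < ord.toSyn x.1}) := by
    intro x
    ext v
    constructor
    · rintro ⟨j, hj, rfl⟩
      have hj' : j.1 < X.card := lt_trans hj (hidx x.1 x.2).1
      obtain ⟨h1, h2⟩ := hc j hj'
      refine ⟨_, ⟨⟨c j, h1⟩, ?_, rfl⟩, ?_⟩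
      · refine (hord _ h1 _ x.2).mp ?_
        rw [h2]
        exact hj
      · rw [hLcol, h2]
    · rintro ⟨_, ⟨x', hx', rfl⟩, rfl⟩
      exact ⟨idx x'.1, (hord _ x'.2 _ x.2).mpr hx', (hLcol x').symm⟩
  have hprofile : Q.image c = rankProfile ord u X := by
    ext s
    simp only [rankProfile, Finset.mem_image, Finset.mem_map, Finset.mem_filter, Finset.mem_univ,
      true_and, Function.Embedding.subtype_apply]
    have key : ∀ x : X, idx x.1 ∈ Q ↔ (hankel u X X).col x ∉ Submodule.span K
        ((hankel u X X).col '' {c' | ord.toSyn c'.1 < ord.toSyn x.1}) := by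
      intro x
      rw [h.mem_iff, hset, ← hLcol, ← Submodule.map_span, not_iff_not, Submodule.mem_map]
      exact ⟨fun ⟨w, hw, hwx⟩ => hL hwx ▸ hw, fun hh => ⟨_, hh, rfl⟩⟩
    constructor
    · rintro ⟨j, hj, rfl⟩
      obtain ⟨h1, h2⟩ := hc j (hQ j hj)
      exact ⟨⟨c j, h1⟩, (key _).mp (by rw [h2]; exact hj), rfl⟩
    · rintro ⟨x, hx, rfl⟩
      exact ⟨idx x.1, (key x).mpr hx, (hidx x.1 x.2).2⟩
  have hWA : ∀ j ∉ Q, ∀ k, (W * A) j k = 0 := by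
    intro j hj k
    rw [Matrix.mul_apply]
    exact Finset.sum_eq_zero fun i _ => by rw [h.eq_zero j hj, zero_mul]
  refine ⟨hprofile, fun g s hs => ?_, fun g hg t ht => ?_⟩
  · rw [hy]
    split_ifs with hgs
    · rw [hWA, neg_zero]
      intro hsQ
      exact hs (Finset.mem_image.mpr ⟨_, hsQ, (hidx s hgs.2).2⟩)
    · rfl
  -- A = A (W A) writes the column of g on the columns in Q, since the rows of W outside Q are zero.
  · have h1 : u (g + t) = ∑ j ∈ Q, A (idx t) j * (W * A) j (idx g) := by
      have h2 : A (idx t) (idx g) = u (g + t) := by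
        rw [hA, if_pos ⟨(hidx t ht).1, (hidx g hg).1⟩, (hidx t ht).2, (hidx g hg).2, add_comm]
      rw [← h2]
      conv_lhs => rw [← h.mul_mul, Matrix.mul_assoc, Matrix.mul_apply]
      exact (Finset.sum_subset (Finset.subset_univ Q) fun j _ hj => by
        rw [hWA j hj, mul_zero]).symm
    rw [Finset.sum_image, h1, ← Finset.sum_add_distrib]
    · refine Finset.sum_eq_zero fun j hj => ?_
      obtain ⟨h2, h3⟩ := hc j (hQ j hj)
      rw [hy, if_pos ⟨hg, h2⟩, h3, hA, if_pos ⟨(hidx t ht).1, hQ j hj⟩, (hidx t ht).2,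
        add_comm t]
      ring
    · intro j hj j' hj' hjj
      rw [← (hc j (hQ j hj)).2, hjj, (hc j' (hQ j' hj')).2]

theorem exists_computes_isGuess {c₀ ω : ℝ} (hc₀ : 0 ≤ c₀) (hMM : MulBound K c₀ ω) (hω : 2 < ω) :
    ∃ C : ℝ, 0 ≤ C ∧ ∀ (n : ℕ) (ord : MonomialOrder (Fin n)) (X : Finset (Mon n)), X.Nonempty →
      Computes (C * (X.card : ℝ) ^ ω) (IsGuess (K := K) ord X) := by
  classical
  obtain ⟨E, hE, hElim⟩ := exists_computes_elimination hMM hω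
  -- Elimination, one product, then one subtraction and one loaded constant; the padded size is at
  -- most 2 #X, whence the factor 2^ω.
  refine ⟨(E + (c₀ + 2) + 2) * 2 ^ ω, by positivity, fun n ord X hX => ?_⟩
  let M := Nat.log 2 X.card + 1
  have hXM : X.card < 2 ^ M := Nat.lt_pow_succ_log_self one_lt_two _
  have hMX : 2 ^ M ≤ 2 * X.card := by
    rw [pow_succ, mul_comm]
    exact Nat.mul_le_mul_left 2 (Nat.pow_log_le_self 2 (Finset.card_pos.mpr hX).ne')
  obtain ⟨c, idx, hc, hidx, hord⟩ := exists_sorted_enumeration ord X hXM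
  let ι := Mon n ⊕ Unit
  let σ : Fin (2 ^ M) → Fin (2 ^ M) → ι := fun i j =>
    if i.1 < X.card ∧ j.1 < X.card then Sum.inl (c i + c j) else Sum.inr ()
  let A : (ι ⊕ Fin (2 ^ M) × Fin (2 ^ M) → K) → Matrix (Fin (2 ^ M)) (Fin (2 ^ M)) K := fun x =>
    Matrix.of fun i j => x (Sum.inl (σ i j))
  let W : (ι ⊕ Fin (2 ^ M) × Fin (2 ^ M) → K) → Matrix (Fin (2 ^ M)) (Fin (2 ^ M)) K := fun x =>
    Matrix.of fun j i => x (Sum.inr (j, i))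
  -- All entries of Z are the loaded constant 0, which also pads the Hankel matrix; subtraction from
  -- Z negates W A.
  let Z : (ι ⊕ Fin (2 ^ M) × Fin (2 ^ M) → K) → Matrix (Fin (2 ^ M)) (Fin (2 ^ M)) K := fun x =>
    Matrix.of fun _ _ => x (Sum.inl (Sum.inr ()))
  have hcard : Fintype.card (Fin (2 ^ M)) = 1 * 2 ^ M := by simp
  have hA : MComputes 0 A := mcomputes_of _
  have hW : MComputes 0 W := mcomputes_of _
  have hZ : MComputes 0 Z := mcomputes_of _
  have hΓ : FComputes _ fun x (e : Fin (2 ^ M) × Fin (2 ^ M)) => (Z x - W x * A x) e.1 e.2 :=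
    hZ.sub (hW.mul hMM hω.le hA hcard hcard hcard one_pos (by positivity))
  have h1 := (hElim (Fin (2 ^ M)) M (by simp) M le_rfl).comap
    fun p : Fin (2 ^ M) × Fin (2 ^ M) => σ p.1 p.2
  have h2 := Computes.bind (fcomputes_const (K := K) (ι := Mon n) (β := Unit) 0) fun _ =>
    h1.bind fun Q => Computes.map hΓ (fun _ => Q.image c) fun _ (b : Mon n × Mon n) =>
      if b.1 ∈ X ∧ b.2 ∈ X then Sum.inr (idx b.2, idx b.1) else Sum.inl (Sum.inl (Sum.inr ()))
  refine h2.mono ?_ ?_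
  · have hU : ((2 ^ M : ℕ) : ℝ) ^ ω = 2 ^ M * ((2 : ℝ) ^ (ω - 1)) ^ M := rpow_two_pow ω M
    have h3 : (1 : ℝ) ≤ ((2 ^ M : ℕ) : ℝ) := by exact_mod_cast Nat.one_le_two_pow
    have h4 : ((2 ^ M : ℕ) : ℝ) ^ 2 ≤ ((2 ^ M : ℕ) : ℝ) ^ ω := by
      rw [← Real.rpow_natCast]
      exact Real.rpow_le_rpow_of_exponent_le h3 (by exact_mod_cast hω.le)
    have h5 : ((2 ^ M : ℕ) : ℝ) ^ ω ≤ 2 ^ ω * (X.card : ℝ) ^ ω := by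
      rw [← Real.mul_rpow zero_le_two (Nat.cast_nonneg _)]
      refine Real.rpow_le_rpow (Nat.cast_nonneg _) ?_ (by linarith)
      exact_mod_cast hMX
    have h6 : (1 : ℝ) ≤ ((2 ^ M : ℕ) : ℝ) ^ 2 := one_le_pow₀ h3
    have h7 := mul_le_mul_of_nonneg_left h5 (by positivity : 0 ≤ E + (c₀ + 2) + 2)
    rw [hcard, mul_assoc E, ← hU]
    rw [one_mul]
    push_cast at *
    linarith
  · rintro u _ _ ⟨_, z, rfl, Q, w, hQ, _, γ, rfl, rfl, rfl⟩
    refine IsElimination.guess hc hidx hord (fun i j => ?_) hQ (fun g s => ?_)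
    · simp only [Matrix.of_apply, σ]
      split_ifs <;> rfl
    · split_ifs with h
      · have : (((Z (Sum.elim (Sum.elim u fun _ => 0) w) - W (Sum.elim (Sum.elim u fun _ => 0) w) *
          A (Sum.elim (Sum.elim u fun _ => 0) w)) (idx s) (idx g) : K)) =
            -((Matrix.of fun j i => w (j, i)) * (Matrix.of fun i j =>
              (Sum.elim u (fun _ => 0) : ι → K) (σ i j))) (idx s) (idx g) := by
          rw [Matrix.sub_apply]
          exact zero_sub _
        exact this
      · rfl

end GuessPrograms

end
end LatticeFGLM

/-! ### Programs for the two guessing algorithms -/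

namespace LatticeFGLM
noncomputable section

section FGLMPrograms

variable {K : Type*} [Field K] {n : ℕ} {ord : MonomialOrder (Fin n)} {u : Mon n → K}
  {X Q S T : Finset (Mon n)} {y : Mon n × Mon n → K}

theorem rankProfile_subset (ord : MonomialOrder (Fin n)) (u : Mon n → K) (X : Finset (Mon n)) :
    rankProfile ord u X ⊆ X := by
  intro s hs
  obtain ⟨x, -, rfl⟩ := Finset.mem_map.mp hs
  exact x.2

theorem subset_stabilize (T S : Finset (Mon n)) : S ⊆ stabilize T S := by
  classical
  intro s hs
  simp [stabilize, hs]

theorem stabilize_subset (h : S ⊆ T) : stabilize T S ⊆ T := by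
  classical
  intro s hs
  simp only [stabilize, Finset.mem_union, Finset.mem_filter] at hs
  exact hs.elim (fun hs => h hs) And.left

theorem selected_subset (T S : Finset (Mon n)) : selected T S ⊆ T := by
  classical
  intro g hg
  simp only [selected, Finset.mem_filter, Finset.mem_sdiff] at hg
  exact hg.1.1

theorem relPoly_eq_of_subset {g : Mon n} {γ : Mon n → K} (hST : S ⊆ T)
    (h : ∀ s ∈ T, s ∉ S → γ s = 0) : relPoly T g γ = relPoly S g γ := by
  unfold relPoly
  congr 1
  exact (Finset.sum_subset hST fun s hs hsS => by rw [h s hs hsS, MvPolynomial.monomial_zero]).symm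

/-- The coefficients vanish outside the profile Q, so the same solution serves for the larger set S
obtained by closing under division. -/
theorem IsGuess.solves (h : IsGuess ord X u Q y) (hQS : Q ⊆ S) (hSX : S ⊆ X) {g : Mon n}
    (hg : g ∈ X) : Solves u S g fun s => y (g, s) := by
  rw [solves_iff]
  intro t ht
  rw [bracket_relPoly_mul, ← h.2.2 g hg t (hSX ht)]
  congr 1
  exact (Finset.sum_subset hQS fun s _ hs => by rw [h.2.1 g s hs, zero_mul]).symm

/-- Closing under division and selecting minimal monomials act on the label alone and cost nothing;
the coefficients are already known for every g in T. -/
theorem exists_scalarFGLM_program {c : ℝ} (ord : MonomialOrder (Fin n)) (T : Finset (Mon n))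
    (h : Computes c (IsGuess (K := K) ord T)) :
    ∃ p : GuessProgram K n, ∀ u : Mon n → K,
      IsScalarFGLMOutput ord u T (p.polys T u) ∧ (p.cost u : ℝ) ≤ c := by
  obtain ⟨p, hp⟩ := h.map (fun Q => selected T (stabilize T Q)) fun _ b => Sum.inr b
  refine ⟨p, fun u => ⟨?_, (hp u).2⟩⟩
  obtain ⟨Q, y, hy, hl, hz⟩ := (hp u).1
  have hQ := hy.1
  subst hQ
  have hQT := rankProfile_subset ord u T
  have hST := stabilize_subset hQT
  refine ⟨fun g s => y (g, s), fun g hg =>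
    hy.solves (subset_stabilize _ _) hST (selected_subset _ _ hg), ?_⟩
  ext f
  simp only [GuessProgram.polys, hl, hz, Sum.elim_inr, Set.mem_ofPred_eq]
  refine exists_congr fun g => and_congr_right fun _ => ?_
  rw [relPoly_eq_of_subset hST fun s _ hs => hy.2.1 g s fun hsQ => hs (subset_stabilize _ _ hsQ)]

-- The blocks are treated independently, and the coefficients for g are read from the block of the
-- class of g.
open scoped Classical in
theorem exists_latticeFGLM_program {c : ℝ} (ord : MonomialOrder (Fin n)) {T : Finset (Mon n)}
    (h0 : 0 ∈ T) {Λ : AddSubgroup (Fin n → ℤ)} {A : Finset (Mon n)}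
    (hA : IsFundamentalDomain Λ A)
    (h : ∀ a ∈ A, Computes c (IsGuess (K := K) ord (insert 0 (part Λ T a)))) :
    ∃ p : GuessProgram K n, ∀ u : Mon n → K,
      IsLatticeFGLMOutput ord Λ A u T (p.polys T u) ∧ (p.cost u : ℝ) ≤ A.card * c := by
  choose cls hcls using fun m => hA.exists_inClass m
  have huniq : ∀ a ∈ A, ∀ m, InClass Λ a m → a = cls m := fun a ha m hm => by
    obtain ⟨b, -, hb⟩ := hA.2 fun i => (m i : ℤ)
    exact (hb a ⟨ha, hm⟩).trans (hb _ ⟨(hcls m).1, (hcls m).2⟩).symm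
  obtain ⟨p, hp⟩ := (computes_pi fun a : A => h a.1 a.2).map
    (fun L : A → Finset (Mon n) => selected T (stabilize T (Finset.univ.biUnion L)))
    fun _ (b : Mon n × Mon n) => Sum.inr (⟨cls b.1, (hcls b.1).1⟩, b)
  refine ⟨p, fun u => ⟨?_, (hp u).2.trans (by rw [Fintype.card_coe])⟩⟩
  obtain ⟨L, y, hy, hl, hz⟩ := (hp u).1
  have hL : L = fun a : A => rankProfile ord u (insert 0 (part Λ T a.1)) :=
    funext fun a => (hy a).1
  subst hL
  have hun : Finset.univ.biUnion (fun a : A => rankProfile ord u (insert 0 (part Λ T a.1))) =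
      A.biUnion fun a => rankProfile ord u (insert 0 (part Λ T a)) := by
    ext s
    simp
  rw [hun] at hl
  have hXT : ∀ a, insert 0 (part Λ T a) ⊆ T := fun a =>
    Finset.insert_subset h0 (Finset.filter_subset _ _)
  have hz' : ∀ g s, (p.result u).2 (g, s) = y (⟨cls g, (hcls g).1⟩, (g, s)) := fun g s => by
    rw [hz]
    rfl
  refine ⟨fun g s => (p.result u).2 (g, s), fun g hg a ha hga => ?_, ?_⟩
  · obtain rfl := huniq a ha g hga
    simp only [hz']
    exact (hy ⟨cls g, (hcls g).1⟩).solves subset_rfl (rankProfile_subset _ _ _)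
      (Finset.mem_insert_of_mem (mem_part.mpr ⟨selected_subset _ _ hg, hga⟩))
  · have key : ∀ g, relPoly T g (fun s => (p.result u).2 (g, s)) =
        relPoly (rankProfile ord u (insert 0 (part Λ T (cls g)))) g
          fun s => (p.result u).2 (g, s) := fun g =>
      relPoly_eq_of_subset ((rankProfile_subset _ _ _).trans (hXT _)) fun s _ hs => by
        rw [hz']
        exact (hy ⟨cls g, (hcls g).1⟩).2.1 g s hs
    ext f
    simp only [GuessProgram.polys, hl, Set.mem_ofPred_eq]
    refine exists_congr fun g => and_congr_right fun _ => ?_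
    constructor
    · exact fun hf => ⟨cls g, (hcls g).1, (hcls g).2, hf.trans (key g)⟩
    · rintro ⟨a, ha, hga, hf⟩
      obtain rfl := huniq a ha g hga
      exact hf.trans (key g).symm

end FGLMPrograms

end
end LatticeFGLM

/-! ### The main theorem -/

open LatticeFGLM in
theorem mainTheorem7 {K : Type*} [Field K] (ω : ℝ) (hω : 2 < ω) (hMM : IsMatMulExponent K ω) :
    ∃ C : ℝ, ∀ (n : ℕ) (G : Subgroup (Fin n → Kˣ)), Finite G → ∀ ε : ℝ, 0 < ε →
      ∃ d₀ : ℕ, ∀ d : Fin n → ℕ, (∀ i, d₀ ≤ d i) → ∀ χ : Fin n → (G →* Kˣ),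
        ∃ P : MvPolynomial (CoeffIndex G d χ) K, P ≠ 0 ∧
          ∀ f : Fin n → MvPolynomial (Fin n) K, IsGSystem G d χ f →
            MvPolynomial.eval (coeffs f) P ≠ 0 →
          ∀ I : Ideal (MvPolynomial (Fin n) K), I = Ideal.span (Set.range f) →
            Module.Finite K (MvPolynomial (Fin n) K ⧸ I) →
          ∀ (ord₁ ord₂ : MonomialOrder (Fin n)) (GB₁ GB₂ : Set (MvPolynomial (Fin n) K)),
            IsReducedGB ord₁ I GB₁ → IsReducedGB ord₂ I GB₂ →
          ∀ S T : Finset (Mon n), (S : Set (Mon n)) = staircase ord₂ GB₂ →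
            (T : Set (Mon n)) = staircase ord₂ GB₂ ∪ leadMons ord₂ GB₂ →
          ∀ A : Finset (Mon n), IsFundamentalDomain (gLattice G) A →
            -- there are `|G|` blocks, of sizes about `#T / |G|`
            (A.card = Nat.card G ∧
              ∀ a ∈ A, |((part (gLattice G) T a).card : ℝ) - (T.card : ℝ) / Nat.card G| ≤
                ε * ((T.card : ℝ) / Nat.card G)) ∧
            -- the Scalar-FGLM algorithm
            (∃ p : GuessProgram K n, ∀ u : Mon n → K,
              IsScalarFGLMOutput ord₂ u T (p.polys T u) ∧
                (p.cost u : ℝ) ≤ C * (T.card : ℝ) ^ ω) ∧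
            -- the lattice Scalar-FGLM algorithm
            (∃ p : GuessProgram K n, ∀ u : Mon n → K,
              IsLatticeFGLMOutput ord₂ (gLattice G) A u T (p.polys T u) ∧
                (p.cost u : ℝ) ≤ C * (T.card : ℝ) ^ ω / (Nat.card G : ℝ) ^ (ω - 1)) ∧
            -- on the tables that are built from the first basis, they guess the second one
            (∀ u : Mon n → K, (∀ g ∈ GB₁, IsRelation u g) →
              ((∀ g, IsRelation u g → g ∈ I) →
                ∀ R, IsScalarFGLMOutput ord₂ u T R → R = GB₂) ∧
              ((∀ a ∈ A, IsUnit (hankel u (insert 0 (part (gLattice G) S a))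
                  (insert 0 (part (gLattice G) S a))).det) →
                ∀ R, IsLatticeFGLMOutput ord₂ (gLattice G) A u T R → R = GB₂)) := by
  classical
  obtain ⟨c₀, hc₀, hMul⟩ := hMM.exists_mulBound
  obtain ⟨C, hC, hguess⟩ := exists_computes_isGuess hc₀ hMul hω
  refine ⟨C * 3 ^ ω, fun n G hG ε hε => ?_⟩
  -- Capping ε at 1 bounds each block by 2 #T/|G| independently of ε, so that C does not depend on
  -- ε.
  obtain ⟨d₀, hd₀⟩ := exists_generic_card_part (K := K) n G (lt_min hε one_pos)
  refine ⟨d₀, fun d hd χ => ?_⟩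
  obtain ⟨P, hP, hgen⟩ := hd₀ d hd χ
  refine ⟨P, hP, ?_⟩
  rintro f hf hfP I rfl hfin ord₁ ord₂ GB₁ GB₂ hGB₁ hGB₂ S T hS hT A hA
  obtain ⟨hqT, hcard⟩ := hgen f hf hfP hfin ord₂ GB₂ hGB₂ S T hS hT A hA
  have h0T := zero_mem_of_coe_eq hT
  have hω0 : 0 ≤ ω := by linarith
  have hq : (0 : ℝ) < Nat.card G := by exact_mod_cast Nat.card_pos
  have hstable : ∀ p ∈ Ideal.span (Set.range f), ∀ ψ, gComponent G ψ p ∈ Ideal.span (Set.range f) :=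
    fun p hp => gComponent_mem_span (fun i => (hf i).2) hp
  refine ⟨⟨hA.card_eq, fun a ha => (hcard a ha).trans ?_⟩, ?_, ?_, fun u hu => ?_⟩
  · exact mul_le_mul_of_nonneg_right (min_le_left _ _) (by positivity)
  · obtain ⟨p, hp⟩ := exists_scalarFGLM_program ord₂ T (hguess n ord₂ T ⟨0, h0T⟩)
    refine ⟨p, fun u => ⟨(hp u).1, (hp u).2.trans ?_⟩⟩
    refine mul_le_mul_of_nonneg_right ?_ (by positivity)
    exact le_mul_of_one_le_right hC (Real.one_le_rpow (by norm_num) hω0)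
  -- Two units of #T/|G| bound the block; the third bounds the added monomial 1, because |G| ≤ #T.
  -- Hence the factor 3^ω in the constant.
  · have hle : ∀ a ∈ A, ((insert 0 (part (gLattice G) T a)).card : ℝ) ≤
        3 * ((T.card : ℝ) / Nat.card G) := by
      intro a ha
      have h1 := (abs_le.mp (hcard a ha)).2
      have h2 : (1 : ℝ) ≤ (T.card : ℝ) / Nat.card G := by
        rw [le_div_iff₀ hq, one_mul]
        exact_mod_cast hqT
      have h3 : min ε 1 * ((T.card : ℝ) / Nat.card G) ≤ 1 * ((T.card : ℝ) / Nat.card G) :=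
        mul_le_mul_of_nonneg_right (min_le_right _ _) (by positivity)
      have h4 : ((insert 0 (part (gLattice G) T a)).card : ℝ) ≤
          (part (gLattice G) T a).card + 1 := by exact_mod_cast Finset.card_insert_le _ _
      linarith
    obtain ⟨p, hp⟩ := exists_latticeFGLM_program ord₂ h0T hA
      (c := C * (3 * ((T.card : ℝ) / Nat.card G)) ^ ω) fun a ha =>
        (hguess n ord₂ (insert 0 (part (gLattice G) T a)) (Finset.insert_nonempty _ _)).mono
          (mul_le_mul_of_nonneg_left
            (Real.rpow_le_rpow (Nat.cast_nonneg _) (hle a ha) hω0) hC) fun _ _ _ h => h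
    refine ⟨p, fun u => ⟨(hp u).1, (hp u).2.trans (le_of_eq ?_)⟩⟩
    rw [hA.card_eq, Real.mul_rpow (by norm_num) (by positivity),
      Real.div_rpow (Nat.cast_nonneg _) hq.le, Real.rpow_sub_one hq.ne']
    have : (Nat.card G : ℝ) ^ ω ≠ 0 := (Real.rpow_pos_of_pos hq ω).ne'
    field_simp
  · have hrel : ∀ p ∈ Ideal.span (Set.range f), IsRelation u p := fun p hp =>
      isRelation_of_mem_span hu (hGB₁.span_eq.symm ▸ hp)
    exact ⟨fun hI R hR => hGB₂.scalar_output_eq hrel hS hT hI hR,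
      fun hdet R hR => hGB₂.lattice_output_eq hrel hS hT hstable hA hdet hR⟩
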